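/- **Conventions.** A *locally convex Lie algebra* is a real Lie algebra that is a Hausdorff locally convex space with continuous bracket. Smoothness of maps between open subsets of locally convex spaces means that all iterated directional derivatives $d^kf(a)(h_1,\dots,h_k)=(D_{h_k}\cdots D_{h_1}f)(a)$ exist and all $d^kf:U\times E^k\to F$ are continuous ($k\ge 0$); Lie groups are modelled on Hausdorff locally convex spaces. A *local Lie group* $(U,D,m,e)$ consists of a smooth manifold $U$, an open $D\subseteq U\times U$, $e\in U$ and a smooth $m:D\to U$ such that: if $(x,y),(y,z)\in D$ and one of $(xy)z$, $x(yz)$ is defined, then so is the other and they agree; $(x,e),(e,x)\in D$ and $xe=ex=x$; every $x$ has a unique inverse $x^{-1}$ in $U$, and inversion is smooth; $(x,y)\in D$ implies $(y^{-1},x^{-1})\in D$. A locally convex Lie algebra $\mathfrak g$ is *locally exponential*, witnessed by $(U,D,m,0)$, if $U\subseteq\mathfrak g$ is a circular, convex, open $0$-neighborhood, $D\subseteq\mathfrak g\times\mathfrak g$ is open, and $(U,D,m,0)$ is a local Lie group such that * (E1) for $x\in U$ and $|t|,|s|,|t+s|\le 1$: $(tx,sx)\in D$ and $m(tx,sx)=(t+s)x$;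 * (E2) $d^2m(0,0)((x,y),(x,y))=[x,y]$ for all $x,y\in\mathfrak g$. A Lie group $H$ is *locally exponential* if it has a smooth exponential map $\exp_H$ which restricts to a diffeomorphism of an open $0$-neighborhood in $L(H)$ onto an open identity neighborhood in $H$. If $L(H)\cong\mathfrak h$ (as topological Lie algebras), $\exp_H$ is regarded as a map $\mathfrak h\to H$ by means of a fixed isomorphism. **Nonstandard extension.** Let $X\mapsto X^*$ be the nonstandard extension given by the ultrapowers with respect to an ultrafilter, assumed to be $\kappa^+$-saturated, where $\kappa$ is the maximum of $\aleph_0$ and the number of continuous seminorms on $\mathfrak g$. For a locally convex space $E$, let $E_f$ (resp. $\mu(E)$) be the set of $x\in E^*$ for which $q(x)$ is finite (resp. infinitesimal) for every continuous seminorm $q$ on $E$, write $a\sim b$ if $a-b\in\mu(E)$, and for open $O\subseteq E$ let $\operatorname{int}(O^*)=\{a\in O^*: a+\mu(E)\subseteq O^*\}$. A map $f:O\to F$ is *uniformly smooth at finite points* if there are maps $d^kf:O\to\operatorname{Lin}^k(E,F)$ (the $k$-linear maps), $d^0f=f$, such that for all $k\ge0$ and $a\in\operatorname{int}(O^*)\cap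 E_f$: $d^{k+1}f(a)$ maps $(E_f)^{k+1}$ into $F_f$, and $\frac1\delta\big(d^kf(a+\delta x)(h)-d^kf(a)(h)\big)\sim d^{k+1}f(a)(h,x)$ for all $x\in E_f$, $h\in(E_f)^k$ and all positive infinitesimal $\delta$. **Hypotheses.** Let $\mathfrak g$ be a locally exponential Lie algebra witnessed by $(U,D,m,0)$, let $\mathcal H$ be a directed family of closed subalgebras of $\mathfrak g$, and let $V\subseteq U$ be an open symmetric neighborhood of $0$ with $V\times V\subseteq D$. Suppose that: 1. $\bigcup\mathcal H$ is dense in $\mathfrak g$; 2. for each $\mathfrak h\in\mathcal H$ there is a connected locally exponential Lie group with Lie algebra isomorphic to $\mathfrak h$; fix one, denoted $H_{\mathfrak h}$, with exponential map $\exp_{\mathfrak h}:\mathfrak h\to H_{\mathfrak h}$; 3. for each $\mathfrak h\in\mathcal H$, $\exp_{\mathfrak h}$ is injective on $V\cap\mathfrak h$; and that there are open symmetric identity neighborhoods $W_{\mathfrak h}\subseteq\exp_{\mathfrak h}(V\cap\mathfrak h)$ in $H_{\mathfrak h}$ $(\mathfrak h\in\mathcal H)$ and a continuous seminorm $p$ on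 $\mathfrak g$ such that: 4. for each $\mathfrak h\in\mathcal H$ and all $x,y\in\mathfrak h$ with $p(x),p(y)<1$: $\exp_{\mathfrak h}(x)\exp_{\mathfrak h}(y)\in W_{\mathfrak h}$; 5. $\{x\in\mathfrak g: p(x)<1\}^{2}\subseteq D$ and $m$ is uniformly continuous on $\{x\in\mathfrak g:p(x)<1\}^{2}$; 6. $m$ is uniformly smooth at finite points. Let $\mathfrak h\in\mathcal H^*$ be internal, $\mathfrak h_f=\mathfrak h\cap\mathfrak g_f$, $\mu_{\mathfrak h}=\mathfrak h\cap\mu(\mathfrak g)$, and let $\hat{\mathfrak h}=\mathfrak h_f/\mu_{\mathfrak h}$ be the nonstandard hull, with classes $[\![x]\!]=x+\mu_{\mathfrak h}$, bracket $[[\![x]\!],[\![y]\!]]=[\![[x,y]]\!]$ and the topology defined by the seminorms $\hat q([\![x]\!])=\operatorname{st}(q(x))$, where $q$ ranges over all continuous seminorms on $\mathfrak g$. **Conclusion.** $\hat{\mathfrak h}$ is a locally exponential Lie algebra (in particular a locally convex Lie algebra). More precisely, let $\hat W=\{a\in\hat{\mathfrak h}:\hat p(a)<1\}$. If $x,y\in\mathfrak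 h_f$ and $[\![x]\!],[\![y]\!]\in\hat W$, then $x*y:=m(x,y)$ lies in $\mathfrak h_f\cap V^*$ and satisfies $\exp_{\mathfrak h}(x*y)=\exp_{\mathfrak h}(x)\exp_{\mathfrak h}(y)$; $\hat m([\![x]\!],[\![y]\!]):=[\![x*y]\!]$ is a well-defined map $\hat W\times\hat W\to\hat{\mathfrak h}$; and with $D'=\{(a,b)\in\hat W\times\hat W:\hat m(a,b)\in\hat W\}$, the tuple $(\hat W,D',\hat m|_{D'},0)$ is a local Lie group which satisfies (E1) and (E2), and so witnesses that $\hat{\mathfrak h}$ is locally exponential. -/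

import Mathlib

open Filter Topology Set

universe u v

noncomputable section

/-! ### Smooth maps between locally convex spaces -/

section Smooth

variable {E F : Type*} [AddCommGroup E] [Module ℝ E] [TopologicalSpace E]
  [AddCommGroup F] [Module ℝ F] [TopologicalSpace F]

/-- `d k a (h₁, …, h_k)` is the iterated directional derivative
`d^k f (a)(h₁, …, h_k) = (D_{h_k} ⋯ D_{h₁} f)(a)` for `a ∈ U`, all of these exist, and every
`d^k f : U × E^k → F` is continuous.  (For Hausdorff `F` and open `U` the family `d` is determined
by `f` on `U`.) -/
structure HasSmoothDerivs (f : E → F) (U : Set E) (d : (k : ℕ) → E → (Fin k → E) → F) : Prop where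
  zero : ∀ a ∈ U, ∀ h : Fin 0 → E, d 0 a h = f a
  succ : ∀ (k : ℕ), ∀ a ∈ U, ∀ (h : Fin k → E) (x : E),
    Tendsto (fun t : ℝ => t⁻¹ • (d k (a + t • x) h - d k a h)) (𝓝[≠] 0)
      (𝓝 (d (k + 1) a (Fin.snoc (α := fun _ => E) h x)))
  continuousOn : ∀ k : ℕ,
    ContinuousOn (fun z : E × (Fin k → E) => d k z.1 z.2) (U ×ˢ univ)

/-- `f` is smooth (of class `C^k` for all `k`, in the sense of continuous iterated directional
derivatives) on the open set `U`. -/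
def LCSmoothOn (f : E → F) (U : Set E) : Prop :=
  ∃ d : (k : ℕ) → E → (Fin k → E) → F, HasSmoothDerivs f U d

end Smooth

/-! ### Locally convex Lie algebras -/

/-- A (real) Lie algebra which is a Hausdorff locally convex space with continuous bracket. -/
class LocallyConvexLieAlgebra (𝔤 : Type*) [LieRing 𝔤] [LieAlgebra ℝ 𝔤] [TopologicalSpace 𝔤] : Prop
    extends IsTopologicalAddGroup 𝔤, ContinuousSMul ℝ 𝔤, LocallyConvexSpace ℝ 𝔤, T2Space 𝔤 where
  continuous_lie : Continuous fun z : 𝔤 × 𝔤 => ⁅z.1, z.2⁆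

/-! ### Local Lie groups and locally exponential Lie algebras -/

/-- `(U, D, m, e)` is a local Lie group, where the manifold `U` is an open subset of the locally
convex space `E` (with its canonical structure of a smooth manifold). Only the values of `m` on `D`
matter. -/
structure IsLocalLieGroup {E : Type*} [AddCommGroup E] [Module ℝ E] [TopologicalSpace E]
    (U : Set E) (D : Set (E × E)) (m : E × E → E) (e : E) : Prop where
  isOpen_carrier : IsOpen U
  isOpen_domain : IsOpen D
  domain_subset : D ⊆ U ×ˢ U
  mapsTo : MapsTo m D U
  smooth_mul : LCSmoothOn m D
  /-- If `xy` and `yz` are defined, and one of `(xy)z`, `x(yz)` is defined, then so is the other and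
  both agree. -/
  assoc : ∀ x y z : E, (x, y) ∈ D → (y, z) ∈ D →
    ((m (x, y), z) ∈ D ↔ (x, m (y, z)) ∈ D) ∧
      ((m (x, y), z) ∈ D → m (m (x, y), z) = m (x, m (y, z)))
  one_mem : e ∈ U
  mul_one : ∀ x ∈ U, (x, e) ∈ D ∧ m (x, e) = x
  one_mul : ∀ x ∈ U, (e, x) ∈ D ∧ m (e, x) = x
  /-- Every `x` has a unique inverse; inversion is smooth and reverses products. -/
  inverse : ∃ inv : E → E, LCSmoothOn inv U ∧
    (∀ x ∈ U, inv x ∈ U ∧ ((x, inv x) ∈ D ∧ m (x, inv x) = e) ∧ ((inv x, x) ∈ D ∧ m (inv x, x) = e)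
      ∧ ∀ y ∈ U, ((x, y) ∈ D ∧ m (x, y) = e) → ((y, x) ∈ D ∧ m (y, x) = e) → y = inv x) ∧
    ∀ x y : E, (x, y) ∈ D → (inv y, inv x) ∈ D

/-- `(U, D, m, 0)` witnesses that the Lie algebra `𝔤` is locally exponential. -/
structure IsLocExpWitness {𝔤 : Type*} [LieRing 𝔤] [LieAlgebra ℝ 𝔤] [TopologicalSpace 𝔤]
    (U : Set 𝔤) (D : Set (𝔤 × 𝔤)) (m : 𝔤 × 𝔤 → 𝔤) : Prop where
  balanced : Balanced ℝ U
  convex : Convex ℝ U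
  isLocalLieGroup : IsLocalLieGroup U D m 0
  /-- (E1) -/
  E1 : ∀ x ∈ U, ∀ t s : ℝ, |t| ≤ 1 → |s| ≤ 1 → |t + s| ≤ 1 →
    (t • x, s • x) ∈ D ∧ m (t • x, s • x) = (t + s) • x
  /-- (E2): `d²m(0,0)((x,y),(x,y)) = [x,y]`, i.e. `x * y = x + y + ½[x,y] + …`. -/
  E2 : ∃ d : (k : ℕ) → 𝔤 × 𝔤 → (Fin k → 𝔤 × 𝔤) → 𝔤, HasSmoothDerivs m D d ∧
    ∀ x y : 𝔤, d 2 (0, 0) ![(x, y), (x, y)] = ⁅x, y⁆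

/-- `𝔤` is a locally exponential Lie algebra. -/
def IsLocallyExponentialLieAlgebra (𝔤 : Type*) [LieRing 𝔤] [LieAlgebra ℝ 𝔤]
    [TopologicalSpace 𝔤] : Prop :=
  LocallyConvexLieAlgebra 𝔤 ∧
    ∃ (U : Set 𝔤) (D : Set (𝔤 × 𝔤)) (m : 𝔤 × 𝔤 → 𝔤), IsLocExpWitness U D m

/-! ### Lie groups modelled on locally convex spaces -/

section LieGroups

variable (E H : Type*) [AddCommGroup E] [Module ℝ E] [TopologicalSpace E]
  [TopologicalSpace H] [ChartedSpace E H] [Group H]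

/-- `H` is a Lie group modelled on the locally convex space `E`: a Hausdorff smooth manifold with
smooth multiplication and inversion. -/
structure IsLCLieGroup : Prop where
  hausdorff : T2Space H
  smooth_transition : ∀ e ∈ atlas E H, ∀ e' ∈ atlas E H,
    LCSmoothOn (fun x : E => e' (e.symm x)) {x | x ∈ e.target ∧ e.symm x ∈ e'.source}
  continuous_mul : Continuous fun z : H × H => z.1 * z.2
  smooth_mul : ∀ e₁ ∈ atlas E H, ∀ e₂ ∈ atlas E H, ∀ e₃ ∈ atlas E H,
    LCSmoothOn (fun z : E × E => e₃ (e₁.symm z.1 * e₂.symm z.2))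
      {z | z.1 ∈ e₁.target ∧ z.2 ∈ e₂.target ∧ e₁.symm z.1 * e₂.symm z.2 ∈ e₃.source}
  continuous_inv : Continuous fun x : H => x⁻¹
  smooth_inv : ∀ e ∈ atlas E H, ∀ e' ∈ atlas E H,
    LCSmoothOn (fun x : E => e' (e.symm x)⁻¹) {x | x ∈ e.target ∧ (e.symm x)⁻¹ ∈ e'.source}

/-- The tangent space `T_1 H` is identified with `E` by means of the preferred chart `φ` at `1`.
Then `br` is the bracket of the Lie algebra `L(H) = T_1 H`: if `μ` is the multiplication in the
chart `φ`, then `[x,y] = d²μ(φ(1),φ(1))((x,0),(0,y)) - d²μ(φ(1),φ(1))((y,0),(0,x))`. -/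
def IsLieBracketAtOne (br : E → E → E) : Prop :=
  ∃ d : (k : ℕ) → E × E → (Fin k → E × E) → E,
    HasSmoothDerivs
      (fun z : E × E => chartAt E (1 : H) ((chartAt E (1 : H)).symm z.1 * (chartAt E (1 : H)).symm z.2))
      {z | z.1 ∈ (chartAt E (1 : H)).target ∧ z.2 ∈ (chartAt E (1 : H)).target ∧
        (chartAt E (1 : H)).symm z.1 * (chartAt E (1 : H)).symm z.2 ∈ (chartAt E (1 : H)).source} d ∧
    ∀ x y : E, br x y =
      d 2 (chartAt E (1 : H) 1, chartAt E (1 : H) 1) ![(x, 0), (0, y)] -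
        d 2 (chartAt E (1 : H) 1, chartAt E (1 : H) 1) ![(y, 0), (0, x)]

end LieGroups

/-- A locally exponential Lie group `H` together with an isomorphism of its Lie algebra `L(H)`
with the topological Lie algebra `𝔨`, and with its exponential map, considered as a map `𝔨 → H`
by means of this isomorphism. -/
structure LocExpLieGroup (𝔨 : Type u) [LieRing 𝔨] [LieAlgebra ℝ 𝔨] [TopologicalSpace 𝔨] where
  /-- the model space -/
  E : Type u
  [addCommGroupE : AddCommGroup E]
  [moduleE : Module ℝ E]
  [topologicalSpaceE : TopologicalSpace E]
  [isTopologicalAddGroupE : IsTopologicalAddGroup E]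
  [continuousSMulE : ContinuousSMul ℝ E]
  [locallyConvexSpaceE : LocallyConvexSpace ℝ E]
  [t2SpaceE : T2Space E]
  /-- the group -/
  H : Type u
  [topologicalSpaceH : TopologicalSpace H]
  [chartedSpaceH : ChartedSpace E H]
  [groupH : Group H]
  isLCLieGroup : IsLCLieGroup E H
  /-- the identification of `T_1 H = E` with `𝔨` as topological Lie algebras -/
  iso : E ≃L[ℝ] 𝔨
  iso_bracket : IsLieBracketAtOne E H fun x y => iso.symm ⁅iso x, iso y⁆
  /-- the smooth exponential map -/
  exp : 𝔨 → H
  exp_continuous : Continuous exp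
  exp_smooth : ∀ e ∈ atlas E H, LCSmoothOn (fun x : 𝔨 => e (exp x)) {x | exp x ∈ e.source}
  exp_add : ∀ (x : 𝔨) (s t : ℝ), exp ((s + t) • x) = exp (s • x) * exp (t • x)
  /-- the one-parameter group `t ↦ exp (t x)` has velocity `x` at `t = 0` -/
  exp_deriv : ∀ x : 𝔨, Tendsto
    (fun t : ℝ => t⁻¹ • (chartAt E (1 : H) (exp (t • x)) - chartAt E (1 : H) 1))
    (𝓝[≠] 0) (𝓝 (iso.symm x))
  /-- `exp` restricts to a diffeomorphism of an open `0`-neighborhood onto an open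
  `1`-neighborhood, with inverse `log` -/
  exp_localDiffeo : ∃ (U₀ : Set 𝔨) (V₀ : Set H) (log : H → 𝔨), IsOpen U₀ ∧ 0 ∈ U₀ ∧
    IsOpen V₀ ∧ (1 : H) ∈ V₀ ∧ MapsTo exp U₀ V₀ ∧ MapsTo log V₀ U₀ ∧
    (∀ x ∈ U₀, log (exp x) = x) ∧ (∀ g ∈ V₀, exp (log g) = g) ∧
    ∀ e ∈ atlas E H, LCSmoothOn (fun x : E => log (e.symm x)) {x | x ∈ e.target ∧ e.symm x ∈ V₀}

attribute [instance] LocExpLieGroup.addCommGroupE LocExpLieGroup.moduleE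
  LocExpLieGroup.topologicalSpaceE LocExpLieGroup.isTopologicalAddGroupE
  LocExpLieGroup.continuousSMulE LocExpLieGroup.locallyConvexSpaceE LocExpLieGroup.t2SpaceE
  LocExpLieGroup.topologicalSpaceH LocExpLieGroup.chartedSpaceH LocExpLieGroup.groupH

/-! ### The nonstandard extension

The nonstandard extension of a set `X` is its ultrapower `X* = Germ 𝒰 X`; internal points of `X*`
are represented by families `ι → X`, internal subsets by families `ι → Set X`. -/

section Nonstandard

variable {ι : Type v} (𝒰 : Ultrafilter ι)

/-- The nonstandard extension given by `𝒰` is `κ⁺`-saturated: every family of at most `κ` internal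
sets with the finite intersection property has nonempty intersection. -/
def IsSaturated (κ : Cardinal.{u}) : Prop :=
  ∀ (J X : Type u), Cardinal.mk J ≤ κ → ∀ A : J → ι → Set X,
    (∀ s : Finset J, ∀ᶠ i in 𝒰, (⋂ j ∈ s, A j i).Nonempty) →
      ∃ x : ι → X, ∀ j, ∀ᶠ i in 𝒰, x i ∈ A j i

/-- The nonstandard extension `E*`. -/
abbrev NSExt (X : Type*) : Type _ := Germ (𝒰 : Filter ι) X

variable {𝒰} {E F : Type*} [AddCommGroup E] [Module ℝ E] [TopologicalSpace E]
  [AddCommGroup F] [Module ℝ F] [TopologicalSpace F]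

/-- `x ∈ E_f`: for every continuous seminorm `p`, the hyperreal `p(x)` is finite. -/
def IsFin (x : NSExt 𝒰 E) : Prop :=
  ∀ p : Seminorm ℝ E, Continuous p → ∃ C : ℝ, x.LiftPred fun a => p a ≤ C

/-- `x ∈ μ(E)`: for every continuous seminorm `p`, the hyperreal `p(x)` is infinitesimal. -/
def IsInfinitesimal (x : NSExt 𝒰 E) : Prop :=
  ∀ p : Seminorm ℝ E, Continuous p → ∀ ε : ℝ, 0 < ε → x.LiftPred fun a => p a < ε

variable (𝒰) in
/-- The internal point of `X*` represented by a family. -/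
def nsPoint {X : Type*} (x : ι → X) : NSExt 𝒰 X := (x : Germ (𝒰 : Filter ι) X)

variable (𝒰) in
/-- The internal point represented by `a` lies in `int(U*) = {a | μ(a) ⊆ U*}`. -/
def InIntStar (U : Set E) (a : ι → E) : Prop :=
  ∀ b : ι → E, IsInfinitesimal (nsPoint 𝒰 fun i => b i - a i) → ∀ᶠ i in 𝒰, b i ∈ U

variable (𝒰) in
/-- `f : U → F` is uniformly smooth at finite points: there are maps `d^k f : U → Lin^k(E, F)`,
`d^0 f = f`, such that for every `k` and every internal `a ∈ int(U*) ∩ E_f`, the internal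
multilinear map `d^{k+1} f(a)` belongs to `FLin^{k+1}(E*, F*)` (it maps finite vectors to finite
vectors), and
`(d^k f(a + δ x)(h) - d^k f(a)(h)) / δ ∼ d^{k+1} f(a)(h, x)`
for all `x ∈ E_f`, `h ∈ (E_f)^k` and all positive infinitesimal `δ`. -/
def UniformlySmoothAtFinitePoints (f : E → F) (U : Set E) : Prop :=
  ∃ d : (k : ℕ) → E → MultilinearMap ℝ (fun _ : Fin k => E) F,
    (∀ a ∈ U, ∀ h : Fin 0 → E, d 0 a h = f a) ∧
    ∀ (k : ℕ) (a : ι → E), InIntStar 𝒰 U a → IsFin (nsPoint 𝒰 a) →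
      (∀ h : Fin (k + 1) → ι → E, (∀ j, IsFin (nsPoint 𝒰 (h j))) →
        IsFin (nsPoint 𝒰 fun i => d (k + 1) (a i) fun j => h j i)) ∧
      ∀ (x : ι → E) (h : Fin k → ι → E) (δ : ι → ℝ),
        IsFin (nsPoint 𝒰 x) → (∀ j, IsFin (nsPoint 𝒰 (h j))) →
        (∀ᶠ i in 𝒰, 0 < δ i) → Tendsto δ 𝒰 (𝓝 0) →
        IsInfinitesimal (nsPoint 𝒰 fun i =>
          (δ i)⁻¹ • (d k (a i + δ i • x i) (fun j => h j i) - d k (a i) fun j => h j i) -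
            d (k + 1) (a i) (Fin.snoc (α := fun _ => E) (fun j => h j i) (x i)))

lemma IsFin.add {x y : NSExt 𝒰 E} (hx : IsFin x) (hy : IsFin y) : IsFin (x + y) := by
  induction x using Germ.inductionOn with | _ x
  induction y using Germ.inductionOn with | _ y
  intro p hp
  obtain ⟨C, hC⟩ := hx p hp
  obtain ⟨C', hC'⟩ := hy p hp
  refine ⟨C + C', ?_⟩
  change ∀ᶠ i in 𝒰, p (x i + y i) ≤ C + C'
  filter_upwards [hC, hC'] with i h1 h2
  exact (map_add_le_add p _ _).trans (add_le_add h1 h2)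

lemma IsFin.smul {x : NSExt 𝒰 E} (c : ℝ) (hx : IsFin x) : IsFin (c • x) := by
  induction x using Germ.inductionOn with | _ x
  intro p hp
  obtain ⟨C, hC⟩ := hx p hp
  refine ⟨‖c‖ * C, ?_⟩
  change ∀ᶠ i in 𝒰, p (c • x i) ≤ ‖c‖ * C
  filter_upwards [hC] with i h1
  rw [map_smul_eq_mul]
  exact mul_le_mul_of_nonneg_left h1 (norm_nonneg _)

lemma IsFin.zero : IsFin (0 : NSExt 𝒰 E) := by
  intro p hp
  refine ⟨0, ?_⟩
  change ∀ᶠ _ : ι in 𝒰, p (0 : E) ≤ 0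
  simp

lemma IsInfinitesimal.add {x y : NSExt 𝒰 E} (hx : IsInfinitesimal x) (hy : IsInfinitesimal y) :
    IsInfinitesimal (x + y) := by
  induction x using Germ.inductionOn with | _ x
  induction y using Germ.inductionOn with | _ y
  intro p hp ε hε
  have h1 := hx p hp (ε / 2) (half_pos hε)
  have h2 := hy p hp (ε / 2) (half_pos hε)
  change ∀ᶠ i in 𝒰, p (x i + y i) < ε
  filter_upwards [h1, h2] with i h1 h2
  have := map_add_le_add p (x i) (y i)
  linarith

lemma IsInfinitesimal.smul {x : NSExt 𝒰 E} (c : ℝ) (hx : IsInfinitesimal x) :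
    IsInfinitesimal (c • x) := by
  induction x using Germ.inductionOn with | _ x
  intro p hp ε hε
  have h1 := hx p hp (ε / (‖c‖ + 1)) (by positivity)
  change ∀ᶠ i in 𝒰, p (c • x i) < ε
  filter_upwards [h1] with i h1
  rw [map_smul_eq_mul]
  rw [lt_div_iff₀ (by positivity)] at h1
  have := apply_nonneg p (x i)
  nlinarith [norm_nonneg c]

lemma IsInfinitesimal.zero : IsInfinitesimal (0 : NSExt 𝒰 E) := by
  intro p hp ε hε
  change ∀ᶠ _ : ι in 𝒰, p (0 : E) < ε
  simp [hε]

/-- The standard part of a (finite) hyperreal: the limit along the ultrafilter. -/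
def standardPart (x : NSExt 𝒰 ℝ) : ℝ :=
  Germ.liftOn x (fun f => limUnder (𝒰 : Filter ι) f) fun _ _ hfg => by
    change lim (map _ _) = lim (map _ _)
    rw [map_congr hfg]

lemma tendsto_standardPart (f : ι → ℝ) (C : ℝ) (hf : ∀ᶠ i in 𝒰, |f i| ≤ C) :
    Tendsto f 𝒰 (𝓝 (standardPart (nsPoint 𝒰 f))) := by
  obtain ⟨l, -, hl⟩ := (isCompact_Icc (a := -C) (b := C)).ultrafilter_le_nhds (𝒰.map f) (by
    rw [le_principal_iff]
    change ∀ᶠ i in 𝒰, f i ∈ Icc (-C) C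
    filter_upwards [hf] with i hi
    exact abs_le.1 hi)
  exact tendsto_nhds_limUnder ⟨l, hl⟩

lemma tendsto_seminorm_standardPart {x : ι → E} (hx : IsFin (nsPoint 𝒰 x)) (p : Seminorm ℝ E)
    (hp : Continuous p) :
    Tendsto (fun i => p (x i)) 𝒰 (𝓝 (standardPart (nsPoint 𝒰 fun i => p (x i)))) := by
  obtain ⟨C, hC⟩ := hx p hp
  refine tendsto_standardPart _ C ?_
  have hC' : ∀ᶠ i in 𝒰, p (x i) ≤ C := hC
  filter_upwards [hC'] with i hi
  rwa [abs_of_nonneg (apply_nonneg p _)]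

end Nonstandard

/-! ### The nonstandard hull of an internal Lie algebra -/

section Hull

variable {ι : Type v} {𝒰 : Ultrafilter ι} {𝔤 : Type u} [LieRing 𝔤] [LieAlgebra ℝ 𝔤]

/-- The Lie algebra structure of `𝔤*`. -/
instance starLieRing : LieRing (NSExt 𝒰 𝔤) where
  bracket := Germ.map₂ fun x y => ⁅x, y⁆
  add_lie x y z := by
    induction x using Germ.inductionOn with | _ x
    induction y using Germ.inductionOn with | _ y
    induction z using Germ.inductionOn with | _ z
    exact congrArg (fun f : ι → 𝔤 => (f : NSExt 𝒰 𝔤)) (funext fun i => add_lie (x i) (y i) (z i))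
  lie_add x y z := by
    induction x using Germ.inductionOn with | _ x
    induction y using Germ.inductionOn with | _ y
    induction z using Germ.inductionOn with | _ z
    exact congrArg (fun f : ι → 𝔤 => (f : NSExt 𝒰 𝔤)) (funext fun i => lie_add (x i) (y i) (z i))
  lie_self x := by
    induction x using Germ.inductionOn with | _ x
    exact congrArg (fun f : ι → 𝔤 => (f : NSExt 𝒰 𝔤)) (funext fun i => lie_self (x i))
  leibniz_lie x y z := by
    induction x using Germ.inductionOn with | _ x
    induction y using Germ.inductionOn with | _ y
    induction z using Germ.inductionOn with | _ z
    exact congrArg (fun f : ι → 𝔤 => (f : NSExt 𝒰 𝔤))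
      (funext fun i => leibniz_lie (x i) (y i) (z i))

instance starLieAlgebra : LieAlgebra ℝ (NSExt 𝒰 𝔤) where
  lie_smul c x y := by
    induction x using Germ.inductionOn with | _ x
    induction y using Germ.inductionOn with | _ y
    exact congrArg (fun f : ι → 𝔤 => (f : NSExt 𝒰 𝔤)) (funext fun i => lie_smul c (x i) (y i))

variable [TopologicalSpace 𝔤] [LocallyConvexLieAlgebra 𝔤]

/-- Continuity of the bracket in terms of seminorms. -/
lemma exists_seminorm_lie_le (p : Seminorm ℝ 𝔤) (hp : Continuous p) :
    ∃ q : Seminorm ℝ 𝔤, Continuous q ∧ ∀ a b : 𝔤, p ⁅a, b⁆ ≤ q a * q b := by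
  have hc : Continuous fun z : 𝔤 × 𝔤 => p ⁅z.1, z.2⁆ :=
    hp.comp LocallyConvexLieAlgebra.continuous_lie
  have h0 : {z : 𝔤 × 𝔤 | p ⁅z.1, z.2⁆ < 1} ∈ 𝓝 ((0 : 𝔤), (0 : 𝔤)) :=
    (isOpen_lt hc continuous_const).mem_nhds (by simp)
  rw [nhds_prod_eq, mem_prod_same_iff] at h0
  obtain ⟨N, hN, hN'⟩ := h0
  have hw := PolynormableSpace.withSeminorms ℝ 𝔤
  obtain ⟨s, r, hr, hs⟩ := (hw.mem_nhds_iff 0 N).1 hN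
  have hq0c : Continuous (s.sup (fun p : {p : Seminorm ℝ 𝔤 // Continuous p} => p.1) : Seminorm ℝ 𝔤) := by
    refine Finset.sup_induction (p := fun q : Seminorm ℝ 𝔤 => Continuous q) ?_ ?_ ?_
    · exact continuous_zero
    · intro a ha b hb
      exact ha.sup hb
    · intro b _
      exact b.2
  set q₀ : Seminorm ℝ 𝔤 := s.sup fun p : {p : Seminorm ℝ 𝔤 // Continuous p} => p.1 with hq₀
  have key : ∀ a b : 𝔤, q₀ a < r → q₀ b < r → p ⁅a, b⁆ < 1 := fun a b ha hb =>
    hN' (show (a, b) ∈ N ×ˢ N from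
      ⟨hs ((Seminorm.mem_ball_zero q₀).2 ha), hs ((Seminorm.mem_ball_zero q₀).2 hb)⟩)
  have key2 : ∀ (a b : 𝔤) (α β : ℝ), q₀ a < α → q₀ b < β → p ⁅a, b⁆ ≤ α * r⁻¹ * (β * r⁻¹) := by
    intro a b α β ha hb
    have hα : 0 < α := (apply_nonneg q₀ a).trans_lt ha
    have hβ : 0 < β := (apply_nonneg q₀ b).trans_lt hb
    have h1 : q₀ ((r / α) • a) < r := by
      rw [map_smul_eq_mul, Real.norm_of_nonneg (by positivity), div_mul_eq_mul_div,
        div_lt_iff₀ hα]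
      exact mul_lt_mul_of_pos_left ha hr
    have h2 : q₀ ((r / β) • b) < r := by
      rw [map_smul_eq_mul, Real.norm_of_nonneg (by positivity), div_mul_eq_mul_div,
        div_lt_iff₀ hβ]
      exact mul_lt_mul_of_pos_left hb hr
    have h3 := key _ _ h1 h2
    rw [smul_lie, lie_smul, map_smul_eq_mul, map_smul_eq_mul, Real.norm_of_nonneg (by positivity),
      Real.norm_of_nonneg (by positivity)] at h3
    have h4 : p ⁅a, b⁆ = (α * r⁻¹ * (β * r⁻¹)) * (r / α * (r / β * p ⁅a, b⁆)) := by
      field_simp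
    rw [h4]
    exact mul_le_of_le_one_right (by positivity) h3.le
  refine ⟨(r⁻¹).toNNReal • q₀, ?_, ?_⟩
  · exact hq0c.const_smul (r⁻¹).toNNReal
  · intro a b
    have ht : Tendsto (fun ε : ℝ => (q₀ a + ε) * r⁻¹ * ((q₀ b + ε) * r⁻¹)) (𝓝[>] 0)
        (𝓝 ((q₀ a + 0) * r⁻¹ * ((q₀ b + 0) * r⁻¹))) := by
      refine Tendsto.mono_left (Continuous.tendsto ?_ 0) nhdsWithin_le_nhds
      fun_prop
    have h5 : p ⁅a, b⁆ ≤ (q₀ a + 0) * r⁻¹ * ((q₀ b + 0) * r⁻¹) := by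
      refine ge_of_tendsto ht ?_
      filter_upwards [self_mem_nhdsWithin] with ε hε
      have hε' : (0 : ℝ) < ε := hε
      exact key2 a b _ _ (by linarith) (by linarith)
    have h6 : ((r⁻¹).toNNReal : ℝ) = r⁻¹ := Real.coe_toNNReal _ (by positivity)
    calc p ⁅a, b⁆ ≤ _ := h5
      _ = (((r⁻¹).toNNReal : ℝ) * q₀ a) * (((r⁻¹).toNNReal : ℝ) * q₀ b) := by rw [h6]; ring

lemma IsFin.lie {x y : NSExt 𝒰 𝔤} (hx : IsFin x) (hy : IsFin y) : IsFin ⁅x, y⁆ := by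
  induction x using Germ.inductionOn with | _ x
  induction y using Germ.inductionOn with | _ y
  intro p hp
  obtain ⟨q, hq, hpq⟩ := exists_seminorm_lie_le p hp
  obtain ⟨C, hC⟩ := hx q hq
  obtain ⟨C', hC'⟩ := hy q hq
  refine ⟨C * C', ?_⟩
  change ∀ᶠ i in 𝒰, p ⁅x i, y i⁆ ≤ C * C'
  filter_upwards [hC, hC'] with i h1 h2
  exact (hpq _ _).trans (mul_le_mul h1 h2 (apply_nonneg q _) ((apply_nonneg q _).trans h1))

lemma IsInfinitesimal.lie {x y : NSExt 𝒰 𝔤} (hx : IsFin x) (hy : IsInfinitesimal y) :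
    IsInfinitesimal ⁅x, y⁆ := by
  induction x using Germ.inductionOn with | _ x
  induction y using Germ.inductionOn with | _ y
  intro p hp ε hε
  obtain ⟨q, hq, hpq⟩ := exists_seminorm_lie_le p hp
  obtain ⟨C, hC⟩ := hx q hq
  have h2 := hy q hq (ε / (|C| + 1)) (by positivity)
  change ∀ᶠ i in 𝒰, p ⁅x i, y i⁆ < ε
  filter_upwards [hC, h2] with i h1 h2
  rw [lt_div_iff₀ (by positivity)] at h2
  have h3 := hpq (x i) (y i)
  have h4 := apply_nonneg q (y i)
  have h5 := le_abs_self C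
  nlinarith

variable (𝒰) in
/-- `𝔥_f`, for the internal subalgebra `𝔥` of `𝔤*` represented by the family `h`. -/
def finitePart (h : ι → LieSubalgebra ℝ 𝔤) : LieSubalgebra ℝ (NSExt 𝒰 𝔤) where
  carrier := {x | Germ.LiftRel (fun a k => a ∈ k) x (h : NSExt 𝒰 (LieSubalgebra ℝ 𝔤)) ∧ IsFin x}
  zero_mem' := ⟨Eventually.of_forall fun i => (h i).zero_mem, IsFin.zero⟩
  add_mem' := by
    intro x y
    induction x using Germ.inductionOn with | _ x
    induction y using Germ.inductionOn with | _ y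
    rintro ⟨hx, hx'⟩ ⟨hy, hy'⟩
    refine ⟨?_, hx'.add hy'⟩
    change ∀ᶠ i in 𝒰, x i + y i ∈ h i
    filter_upwards [hx, hy] with i h1 h2
    exact (h i).add_mem h1 h2
  smul_mem' := by
    intro c x
    induction x using Germ.inductionOn with | _ x
    rintro ⟨hx, hx'⟩
    refine ⟨?_, hx'.smul c⟩
    change ∀ᶠ i in 𝒰, c • x i ∈ h i
    filter_upwards [hx] with i h1
    exact (h i).smul_mem c h1
  lie_mem' := by
    intro x y
    induction x using Germ.inductionOn with | _ x
    induction y using Germ.inductionOn with | _ y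
    rintro ⟨hx, hx'⟩ ⟨hy, hy'⟩
    refine ⟨?_, hx'.lie hy'⟩
    change ∀ᶠ i in 𝒰, ⁅x i, y i⁆ ∈ h i
    filter_upwards [hx, hy] with i h1 h2
    exact (h i).lie_mem h1 h2

variable (𝒰) in
/-- The ideal `μ_𝔥` of `𝔥_f`. -/
def infinitesimalPart (h : ι → LieSubalgebra ℝ 𝔤) : LieIdeal ℝ (finitePart 𝒰 h) where
  carrier := {x | IsInfinitesimal (x : NSExt 𝒰 𝔤)}
  zero_mem' := IsInfinitesimal.zero
  add_mem' hx hy := IsInfinitesimal.add hx hy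
  smul_mem' c _ hx := IsInfinitesimal.smul c hx
  lie_mem {x _} hm := IsInfinitesimal.lie x.2.2 hm

variable (𝒰) in
/-- The nonstandard hull `𝔥^ = 𝔥_f / μ_𝔥`. -/
def Hull (h : ι → LieSubalgebra ℝ 𝔤) : Type _ := finitePart 𝒰 h ⧸ infinitesimalPart 𝒰 h

variable {h : ι → LieSubalgebra ℝ 𝔤}

instance hullLieRing : LieRing (Hull 𝒰 h) :=
  inferInstanceAs (LieRing (finitePart 𝒰 h ⧸ infinitesimalPart 𝒰 h))

instance hullLieAlgebra : LieAlgebra ℝ (Hull 𝒰 h) :=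
  inferInstanceAs (LieAlgebra ℝ (finitePart 𝒰 h ⧸ infinitesimalPart 𝒰 h))

/-- The class `⟦x⟧ = x + μ_𝔥` of `x ∈ 𝔥_f`. -/
def hullMk (x : finitePart 𝒰 h) : Hull 𝒰 h :=
  (LieSubmodule.Quotient.mk x : finitePart 𝒰 h ⧸ infinitesimalPart 𝒰 h)

/-- The set of all continuous seminorms. -/
abbrev ContSeminorm (E : Type*) [AddCommGroup E] [Module ℝ E] [TopologicalSpace E] : Type _ :=
  {p : Seminorm ℝ E // Continuous p}

variable (𝒰) in
/-- The seminorm `p^` on the nonstandard hull, `p^⟦x⟧ = st (p x)`. -/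
def hullSeminorm (h : ι → LieSubalgebra ℝ 𝔤) (p : ContSeminorm 𝔤) : Seminorm ℝ (Hull 𝒰 h) :=
  Seminorm.of
    (fun a => Quotient.liftOn' (s₁ := (infinitesimalPart 𝒰 h).toSubmodule.quotientRel) a
      (fun x => standardPart ((x : NSExt 𝒰 𝔤).map p.1)) (by
        rintro ⟨x, hx⟩ ⟨y, hy⟩ hxy
        have hxy' := (Submodule.quotientRel_def _).1 hxy
        induction x using Germ.inductionOn with | _ x
        induction y using Germ.inductionOn with | _ y
        have h1 := tendsto_seminorm_standardPart hx.2 p.1 p.2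
        have h2 := tendsto_seminorm_standardPart hy.2 p.1 p.2
        have h3 : Tendsto (fun i => p.1 (x i) - p.1 (y i)) 𝒰 (𝓝 0) := by
          rw [Metric.tendsto_nhds]
          intro ε hε
          have h4 : ∀ᶠ i in 𝒰, p.1 (x i - y i) < ε := hxy' p.1 p.2 ε hε
          filter_upwards [h4] with i hi
          rw [Real.dist_0_eq_abs]
          exact (abs_sub_map_le_sub p.1 _ _).trans_lt hi
        exact sub_eq_zero.1 (tendsto_nhds_unique (h1.sub h2) h3)))
    (by
      intro a b
      induction a using Quotient.inductionOn' with | _ a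
      induction b using Quotient.inductionOn' with | _ b
      obtain ⟨x, hx⟩ := a
      obtain ⟨y, hy⟩ := b
      induction x using Germ.inductionOn with | _ x
      induction y using Germ.inductionOn with | _ y
      have h1 := tendsto_seminorm_standardPart hx.2 p.1 p.2
      have h2 := tendsto_seminorm_standardPart hy.2 p.1 p.2
      have h3 := tendsto_seminorm_standardPart (x := fun i => x i + y i) (hx.2.add hy.2) p.1 p.2
      exact le_of_tendsto_of_tendsto' h3 (h1.add h2) fun i => map_add_le_add p.1 _ _)
    (by
      intro c a
      induction a using Quotient.inductionOn' with | _ a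
      obtain ⟨x, hx⟩ := a
      induction x using Germ.inductionOn with | _ x
      have h1 := tendsto_seminorm_standardPart hx.2 p.1 p.2
      have h3 := tendsto_seminorm_standardPart (x := fun i => c • x i) (hx.2.smul c) p.1 p.2
      refine tendsto_nhds_unique h3 ((h1.const_mul ‖c‖).congr fun i => ?_)
      exact (map_smul_eq_mul p.1 c (x i)).symm)

lemma hullSeminorm_hullMk (p : ContSeminorm 𝔤) (x : finitePart 𝒰 h) :
    hullSeminorm 𝒰 h p (hullMk x) = standardPart ((x : NSExt 𝒰 𝔤).map p.1) := rfl

instance contSeminormNonempty : Nonempty (ContSeminorm 𝔤) := ⟨⟨0, continuous_zero⟩⟩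

/-- The locally convex topology of the nonstandard hull, defined by the seminorms `p^`. -/
instance hullTopologicalSpace : TopologicalSpace (Hull 𝒰 h) :=
  SeminormFamily.moduleFilterBasis (𝕜 := ℝ) (fun p : ContSeminorm 𝔤 => hullSeminorm 𝒰 h p)
    |>.topology

lemma hull_withSeminorms :
    WithSeminorms fun p : ContSeminorm 𝔤 => hullSeminorm 𝒰 h p :=
  ⟨rfl⟩

end Hull

end

/-!
The product of the local group is `x * y = m (x, y)`. The proof has two parts: the internal
subalgebra `𝔥` is closed under `*` on the unit ball of `p`, and the product induced on the hull is
smooth.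

**Products in `𝔥`.** Let `𝔥` be a closed subalgebra in the family, with Lie group `H`. A priori,
`x * y` need not lie in `𝔥`, and nothing relates it to `exp x · exp y`. Only differential equations
whose solutions are known to exist are used, since linear equations in locally convex spaces need
not be solvable or uniquely solvable. The adjoint action `Ad(tx)` of the local group solves
`α' = [x, α]`, and, being invertible, it forces uniqueness of the solutions (`eq_locAd`). Hence it
agrees on `𝔥` with the adjoint action of `H` (`locAd_coe`). Its primitive is the logarithmic
derivative of the exponential function (`hasSlope_leftLogDeriv`, `exists_hasVel_exp_curve`), which
therefore agrees as well.

Suppose that `exp z = exp w · exp u` with `z ∈ V ∩ 𝔥`. Then `z` and `w * u` act in the same way on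
`𝔥`, so `z * (w * u)⁻¹` commutes with `𝔥`, and a connectedness argument shows that it is just the
difference `v = z - w * u` (`eq_add_of_comm`). So `w * u` normalizes `𝔥` and acts on it like `z`,
whence the velocity of `s ↦ w * su` lies in `𝔥`, and so does the curve, which is then mapped by
`exp` to `s ↦ exp w · exp su` (`mul_smul_mem`). Thus the set of `t ∈ [0, 1]` for which `x * ty` lies
in `V ∩ 𝔥` and is a logarithm of `exp x · exp ty` is open on the right. It is closed because two
logarithms of the same element, one of them in `V`, the other a limit of elements of `V`, differ by
a central element in the kernel of `exp`, which injectivity of `exp` on `V ∩ 𝔥` excludes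
(`isGoodProduct_of_lt`). This proves `exists_coe_eq_mul`; associativity for `*` in `𝔥`, on triples
with both inner products in the ball, follows from associativity in `H` and injectivity of `exp`.

**Smoothness on the hull.** A point of the hull is written as the class of any family
infinitesimally close to an internal point of `𝔥` (`IsNear`). Uniform continuity of `m` makes
products of finite vectors finite. Finiteness of the next derivative and saturation show that every
derivative `d^k m` respects infinitesimal closeness at finite points (`UniformDerivs.near`). To see
that the derivatives take values in the hull, approximate `d^(k+1) m` by difference quotients of
`d^k m` with a standard step size, which is possible by overspill, and apply saturation to these
approximations (`isNear_hullDeriv`). Continuity of the derivatives is again a consequence of saturation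
(`IsHullProduct.hasSmoothDerivs`). The laws of the local group hold for representatives. Finally, at
the standard point `(0, 0)` the internal derivatives are the iterated directional derivatives of `m`
(`UniformDerivs.eq_of_hasSmoothDerivs`), so the second derivative gives the bracket of the hull.
-/

noncomputable section

/-! ### Differential calculus in locally convex spaces -/

section Calculus

variable {E F : Type*} [AddCommGroup E] [Module ℝ E] [TopologicalSpace E]
  [AddCommGroup F] [Module ℝ F] [TopologicalSpace F]

/-- The curve `c` has derivative `v` at the time `t`. -/
def HasSlope (c : ℝ → E) (v : E) (t : ℝ) : Prop :=
  Tendsto (fun s : ℝ => s⁻¹ • (c (t + s) - c t)) (𝓝[≠] 0) (𝓝 v)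

lemma tendsto_iff_contSeminorm [IsTopologicalAddGroup E] [ContinuousSMul ℝ E]
    [LocallyConvexSpace ℝ E] {α : Type*} {l : Filter α} {f : α → E} {y : E} :
    Tendsto f l (𝓝 y) ↔ ∀ q : ContSeminorm E, ∀ ε > 0, ∀ᶠ x in l, q.1 (f x - y) < ε := by
  rw [(PolynormableSpace.withSeminorms ℝ E).tendsto_nhds f y]

lemma isClosed_contSeminorm_le [IsTopologicalAddGroup E] (q : ContSeminorm E) (w : E) (ε : ℝ) :
    IsClosed {x | q.1 (x - w) ≤ ε} :=
  isClosed_le (q.2.comp (continuous_id.sub continuous_const)) continuous_const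

lemma convex_contSeminorm_le (q : ContSeminorm E) (w : E) (ε : ℝ) :
    Convex ℝ {x | q.1 (x - w) ≤ ε} := by
  have := q.1.convex_closedBall w ε
  rwa [Seminorm.closedBall] at this

lemma tendsto_of_hasSlope [IsTopologicalAddGroup E] [ContinuousSMul ℝ E] {c : ℝ → E} {v : E}
    {t : ℝ} (h : HasSlope c v t) : Tendsto (fun s => c (t + s)) (𝓝 0) (𝓝 (c t)) := by
  have h1 : Tendsto (fun s : ℝ => s • s⁻¹ • (c (t + s) - c t) + c t) (𝓝[≠] 0)
      (𝓝 ((0 : ℝ) • v + c t)) :=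
    ((tendsto_nhdsWithin_of_tendsto_nhds tendsto_id).smul h).add_const _
  rw [zero_smul, zero_add] at h1
  have h2 : Tendsto (fun s => c (t + s)) (𝓝[≠] 0) (𝓝 (c t)) := by
    refine h1.congr' ?_
    filter_upwards [self_mem_nhdsWithin] with s hs
    have hs' : s ≠ 0 := hs
    rw [smul_smul, mul_inv_cancel₀ hs', one_smul, sub_add_cancel]
  rw [← nhdsNE_sup_pure, tendsto_sup]
  refine ⟨h2, ?_⟩
  rw [tendsto_pure_left]
  intro s hs
  simpa using mem_of_mem_nhds hs

/-- The mean value theorem: if all derivatives of a curve lie in a closed convex set, so does its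
increment. -/
theorem HasSlope.sub_mem [IsTopologicalAddGroup E] [ContinuousSMul ℝ E] [LocallyConvexSpace ℝ E]
    {c : ℝ → E} {K : Set E} (hK : IsClosed K) (hKc : Convex ℝ K)
    (h : ∀ t ∈ Icc (0 : ℝ) 1, ∃ v ∈ K, HasSlope c v t) : c 1 - c 0 ∈ K := by
  by_contra hx
  obtain ⟨f, u, hf, hu⟩ := geometric_hahn_banach_closed_point hKc hK hx
  choose! v hv hs using h
  have hd : ∀ t ∈ Icc (0 : ℝ) 1, HasDerivAt (fun t => f (c t)) (f (v t)) t := by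
    intro t ht
    rw [hasDerivAt_iff_tendsto_slope_zero]
    refine ((f.continuous.tendsto _).comp (hs t ht)).congr fun s => ?_
    simp
  obtain ⟨t, ht, hte⟩ := exists_hasDerivAt_eq_slope (fun t => f (c t)) (fun t => f (v t))
    (zero_lt_one) (fun t ht => (hd t ht).continuousAt.continuousWithinAt)
    (fun t ht => hd t (Ioo_subset_Icc_self ht))
  have h1 := hf _ (hv t (Ioo_subset_Icc_self ht))
  rw [hte] at h1
  simp only [map_sub, sub_zero, div_one] at h1 hu
  linarith

lemma HasSlope.eq_of_zero [IsTopologicalAddGroup E] [ContinuousSMul ℝ E] [LocallyConvexSpace ℝ E]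
    [T2Space E] {c : ℝ → E} (h : ∀ t ∈ Icc (0 : ℝ) 1, HasSlope c 0 t) : c 1 = c 0 :=
  sub_eq_zero.1 (HasSlope.sub_mem (K := {0}) isClosed_singleton (convex_singleton 0)
    fun t ht => ⟨0, rfl, h t ht⟩)

lemma HasSlope.sub [IsTopologicalAddGroup E] {c c' : ℝ → E} {v v' : E} {t : ℝ}
    (h : HasSlope c v t) (h' : HasSlope c' v' t) :
    HasSlope (fun t => c t - c' t) (v - v') t := by
  refine (Tendsto.sub h h').congr fun s => ?_
  rw [← smul_sub]
  congr 1
  dsimp only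
  abel

lemma HasSlope.add [IsTopologicalAddGroup E] {c c' : ℝ → E} {v v' : E} {t : ℝ}
    (h : HasSlope c v t) (h' : HasSlope c' v' t) :
    HasSlope (fun t => c t + c' t) (v + v') t := by
  refine (Tendsto.add h h').congr fun s => ?_
  rw [← smul_add]
  congr 1
  dsimp only
  abel

lemma hasSlope_const (a : E) (t : ℝ) : HasSlope (fun _ => a) 0 t := by
  refine tendsto_const_nhds.congr fun s => ?_
  simp

lemma hasSlope_smul_const (a : E) (t : ℝ) : HasSlope (fun t => t • a) a t := by
  refine tendsto_const_nhds.congr' ?_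
  filter_upwards [self_mem_nhdsWithin] with s hs
  have hs' : s ≠ 0 := hs
  rw [add_smul, add_sub_cancel_left, smul_smul, inv_mul_cancel₀ hs', one_smul]

lemma HasSlope.map (L : E →L[ℝ] F) {c : ℝ → E} {v : E} {t : ℝ} (h : HasSlope c v t) :
    HasSlope (fun t => L (c t)) (L v) t := by
  refine ((L.continuous.tendsto _).comp h).congr fun s => ?_
  simp

lemma HasSlope.unique [T2Space E] {c : ℝ → E} {v v' : E} {t : ℝ} (h : HasSlope c v t)
    (h' : HasSlope c v' t) : v = v' :=
  tendsto_nhds_unique h h'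

lemma HasSlope.congr' {c c' : ℝ → E} {v : E} {t : ℝ} (h : HasSlope c v t)
    (hc : ∀ᶠ s in 𝓝 0, c (t + s) = c' (t + s)) : HasSlope c' v t := by
  refine Tendsto.congr' ?_ h
  filter_upwards [hc.filter_mono nhdsWithin_le_nhds] with s hs
  have h0 : c t = c' t := by simpa using hc.self_of_nhds
  rw [hs, h0]

lemma HasSlope.comp_smul [ContinuousConstSMul ℝ E] {c : ℝ → E} {v : E} {t : ℝ} (r : ℝ)
    (h : HasSlope c v (r * t)) :
    HasSlope (fun t => c (r * t)) (r • v) t := by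
  rcases eq_or_ne r 0 with rfl | hr
  · simpa using hasSlope_const (c 0) t
  have h1 : Tendsto (fun s : ℝ => r * s) (𝓝[≠] 0) (𝓝[≠] 0) := by
    refine tendsto_nhdsWithin_iff.2 ⟨?_, ?_⟩
    · refine Tendsto.mono_left ?_ nhdsWithin_le_nhds
      exact Continuous.tendsto' (by fun_prop) _ _ (by simp)
    · filter_upwards [self_mem_nhdsWithin] with s hs
      exact mul_ne_zero hr hs
  refine ((h.comp h1).const_smul r).congr fun s => ?_
  simp only [Function.comp_apply, mul_add, smul_smul, mul_inv]
  rw [← mul_assoc, mul_inv_cancel₀ hr, one_mul]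

/-! ### First and second derivatives of smooth maps -/

lemma Fin.cons_const_eq {E : Type*} (x y : E) :
    (Fin.cons (α := fun _ : Fin 2 => E) x fun _ => y) = ![x, y] := by
  ext i
  fin_cases i <;> rfl

namespace HasSmoothDerivs

variable {f : E → F} {U : Set E} {d : (k : ℕ) → E → (Fin k → E) → F}

lemma hasSlope (h : HasSmoothDerivs f U d) {a : E} (ha : a ∈ U) (hU : IsOpen U)
    [IsTopologicalAddGroup E] [ContinuousSMul ℝ E] (x : E) :
    HasSlope (fun t : ℝ => f (a + t • x)) (d 1 a fun _ => x) 0 := by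
  have h1 := h.succ 0 a ha (fun _ => 0) x
  have h2 : (Fin.snoc (α := fun _ => E) (fun _ : Fin 0 => (0 : E)) x) = fun _ => x := by
    ext i
    rw [Fin.fin_one_eq_zero i]
    rfl
  rw [h2] at h1
  refine h1.congr' ?_
  have h3 : ∀ᶠ t : ℝ in 𝓝 0, a + t • x ∈ U := by
    have : Tendsto (fun t : ℝ => a + t • x) (𝓝 0) (𝓝 a) := by
      exact Continuous.tendsto' (by fun_prop) _ _ (by simp)
    exact this.eventually (hU.mem_nhds ha)
  filter_upwards [h3.filter_mono nhdsWithin_le_nhds] with t ht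
  rw [h.zero _ ht, h.zero _ ha]
  simp

lemma continuousAt_deriv (h : HasSmoothDerivs f U d) (hU : IsOpen U) {a x : E} (ha : a ∈ U) :
    ContinuousAt (fun z : E × E => d 1 z.1 fun _ => z.2) (a, x) := by
  have h1 : ContinuousAt (fun z : E × (Fin 1 → E) => d 1 z.1 z.2) (a, fun _ => x) :=
    (h.continuousOn 1).continuousAt ((hU.prod isOpen_univ).mem_nhds ⟨ha, mem_univ _⟩)
  have h2 : ContinuousAt (fun z : E × E => ((z.1, fun _ => z.2) : E × (Fin 1 → E))) (a, x) :=
    Continuous.continuousAt (by fun_prop)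
  exact ContinuousAt.comp (f := fun z : E × E => ((z.1, fun _ => z.2) : E × (Fin 1 → E)))
    (g := fun z : E × (Fin 1 → E) => d 1 z.1 z.2) h1 h2

lemma tendsto_deriv (h : HasSmoothDerivs f U d) (hU : IsOpen U) {a x : E} (ha : a ∈ U)
    {α : Type*} {l : Filter α} {b y : α → E} (hb : Tendsto b l (𝓝 a)) (hy : Tendsto y l (𝓝 x)) :
    Tendsto (fun i => d 1 (b i) fun _ => y i) l (𝓝 (d 1 a fun _ => x)) :=
  (h.continuousAt_deriv hU (x := x) ha).tendsto.comp (hb.prodMk_nhds hy)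

lemma continuousAt (h : HasSmoothDerivs f U d) (hU : IsOpen U) {a : E} (ha : a ∈ U) :
    ContinuousAt f a := by
  have h1 : ContinuousAt (fun z : E × (Fin 0 → E) => d 0 z.1 z.2) (a, fun _ => a) :=
    (h.continuousOn 0).continuousAt ((hU.prod isOpen_univ).mem_nhds ⟨ha, mem_univ _⟩)
  have h2 : ContinuousAt (fun z : E => ((z, fun _ => z) : E × (Fin 0 → E))) a :=
    Continuous.continuousAt (by fun_prop)
  have h3 : ContinuousAt (fun z : E => d 0 z fun _ => z) a :=
    ContinuousAt.comp (f := fun z : E => ((z, fun _ => z) : E × (Fin 0 → E)))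
      (g := fun z : E × (Fin 0 → E) => d 0 z.1 z.2) h1 h2
  refine h3.congr ?_
  filter_upwards [hU.mem_nhds ha] with z hz
  exact h.zero z hz _

/-- The directional derivative of a smooth map in a fixed direction is smooth. -/
theorem shift (h : HasSmoothDerivs f U d) (x : E) :
    HasSmoothDerivs (fun a => d 1 a fun _ => x) U
      fun k a v => d (k + 1) a (Fin.cons (α := fun _ => E) x v) where
  zero a _ v := by
    congr 1
    ext i
    rw [Fin.fin_one_eq_zero i]
    rfl
  succ k a ha v y := by
    have := h.succ (k + 1) a ha (Fin.cons (α := fun _ => E) x v) y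
    rwa [← Fin.cons_snoc_eq_snoc_cons] at this
  continuousOn k := by
    refine (h.continuousOn (k + 1)).comp (f := fun z : E × (Fin k → E) =>
      ((z.1, Fin.cons (α := fun _ => E) x z.2) : E × (Fin (k + 1) → E))) ?_ ?_
    · refine Continuous.continuousOn (continuous_fst.prodMk ?_)
      refine continuous_pi fun i => ?_
      refine Fin.cases ?_ (fun j => ?_) i
      · simpa using continuous_const
      · simp only [Fin.cons_succ]
        fun_prop
    · rintro z ⟨hz, -⟩
      exact ⟨hz, mem_univ _⟩

variable [IsTopologicalAddGroup E] [ContinuousSMul ℝ E] [LocallyConvexSpace ℝ E]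
  [IsTopologicalAddGroup F] [ContinuousSMul ℝ F] [LocallyConvexSpace ℝ F]

/-- Smooth maps are strictly differentiable: the difference quotients converge to the derivative
even if base point and direction vary. This contains the chain rule along curves. -/
theorem tendsto_quotient (h : HasSmoothDerivs f U d) (hU : IsOpen U) {α : Type*} {l : Filter α}
    {s : α → ℝ} {a v : α → E} {a₀ v₀ : E} (ha₀ : a₀ ∈ U) (hs : Tendsto s l (𝓝 0))
    (hs0 : ∀ᶠ i in l, s i ≠ 0) (ha : Tendsto a l (𝓝 a₀)) (hv : Tendsto v l (𝓝 v₀)) :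
    Tendsto (fun i => (s i)⁻¹ • (f (a i + s i • v i) - f (a i))) l (𝓝 (d 1 a₀ fun _ => v₀)) := by
  rw [tendsto_iff_contSeminorm]
  intro q ε hε
  set w := d 1 a₀ fun _ => v₀ with hw
  have h1 : ∀ᶠ z : E × E in 𝓝 (a₀, v₀), z.1 ∈ U ∧ q.1 ((d 1 z.1 fun _ => z.2) - w) < ε / 2 := by
    refine Filter.Eventually.and ?_ ?_
    · exact continuous_fst.continuousAt.eventually (hU.mem_nhds ha₀)
    · have h2 := h.continuousAt_deriv hU (x := v₀) ha₀
      exact (tendsto_iff_contSeminorm.1 h2.tendsto) q _ (half_pos hε)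
  rw [nhds_prod_eq, eventually_prod_iff] at h1
  obtain ⟨pa, hpa, pv, hpv, hp⟩ := h1
  obtain ⟨N, ⟨hN, hNc⟩, hNp⟩ := (LocallyConvexSpace.convex_basis (𝕜 := ℝ) a₀).mem_iff.1 hpa
  have h3 : Tendsto (fun i => a i + s i • v i) l (𝓝 a₀) := by
    have := ha.add (hs.smul hv)
    rwa [zero_smul, add_zero] at this
  filter_upwards [ha.eventually hN, h3.eventually hN, hv.eventually hpv, hs0] with i h4 h5 h6 h7
  have h8 : ∀ t ∈ Icc (0 : ℝ) 1, a i + t • s i • v i ∈ N := by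
    intro t ht
    have h9 := hNc h4 h5 (sub_nonneg.2 ht.2) ht.1 (by ring)
    have h10 : (1 - t) • a i + t • (a i + s i • v i) = a i + t • s i • v i := by
      rw [sub_smul, one_smul, smul_add]; abel
    rwa [h10] at h9
  have h11 := HasSlope.sub_mem (c := fun t : ℝ => (s i)⁻¹ • f (a i + t • s i • v i))
    (isClosed_contSeminorm_le q w (ε / 2)) (convex_contSeminorm_le q w (ε / 2))
    (fun t ht => ⟨d 1 (a i + t • s i • v i) fun _ => v i,
      (hp (hNp (h8 t ht)) h6).2.le, by
        have h12 := h.hasSlope (hp (hNp (h8 t ht)) h6).1 hU (v i)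
        have h13 : Tendsto (fun r : ℝ => r * s i) (𝓝[≠] 0) (𝓝[≠] 0) := by
          refine tendsto_nhdsWithin_iff.2 ⟨?_, ?_⟩
          · refine Tendsto.mono_left ?_ nhdsWithin_le_nhds
            exact Continuous.tendsto' (by fun_prop) _ _ (by simp)
          · filter_upwards [self_mem_nhdsWithin] with r hr
            exact mul_ne_zero hr h7
        refine (Tendsto.comp h12 h13).congr fun r => ?_
        simp only [Function.comp_apply, zero_add, zero_smul, add_zero]
        rw [← smul_sub, smul_smul, mul_inv, add_smul, smul_smul, smul_smul, smul_smul, add_assoc]⟩)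
  simp only [one_smul, zero_smul, add_zero] at h11
  rw [smul_sub]
  have h14 : q.1 ((s i)⁻¹ • f (a i + s i • v i) - (s i)⁻¹ • f (a i) - w) ≤ ε / 2 := h11
  linarith

/-- The chain rule along curves. -/
theorem hasSlope_comp (h : HasSmoothDerivs f U d) (hU : IsOpen U) {c : ℝ → E} {v : E} {t : ℝ}
    (hc : c t ∈ U) (hv : HasSlope c v t) :
    HasSlope (fun t => f (c t)) (d 1 (c t) fun _ => v) t := by
  have h1 := h.tendsto_quotient hU (l := 𝓝[≠] (0 : ℝ)) (s := fun s => s) (a := fun _ => c t)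
    (v := fun s => s⁻¹ • (c (t + s) - c t)) hc
    (tendsto_nhdsWithin_of_tendsto_nhds tendsto_id) self_mem_nhdsWithin tendsto_const_nhds hv
  refine h1.congr' ?_
  filter_upwards [self_mem_nhdsWithin] with s hs
  have hs' : s ≠ 0 := hs
  rw [smul_smul, mul_inv_cancel₀ hs', one_smul, add_sub_cancel]

variable [T2Space F]

/-- The derivative of a smooth map at a point, as a continuous linear map. -/
def clm (h : HasSmoothDerivs f U d) (hU : IsOpen U) {a : E} (ha : a ∈ U) : E →L[ℝ] F where
  toFun x := d 1 a fun _ => x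
  map_add' x y := by
    have hlim : Tendsto (fun t : ℝ => a + t • x) (𝓝[≠] 0) (𝓝 a) :=
      Tendsto.mono_left (Continuous.tendsto' (by fun_prop) _ _ (by simp)) nhdsWithin_le_nhds
    have hid : Tendsto (fun t : ℝ => t) (𝓝[≠] 0) (𝓝 0) :=
      tendsto_nhdsWithin_of_tendsto_nhds tendsto_id
    have h1 := h.tendsto_quotient hU (l := 𝓝[≠] (0 : ℝ)) ha hid self_mem_nhdsWithin
      (tendsto_const_nhds (x := a)) (tendsto_const_nhds (x := x))
    have h2 := h.tendsto_quotient hU (l := 𝓝[≠] (0 : ℝ)) ha hid self_mem_nhdsWithin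
      hlim (tendsto_const_nhds (x := y))
    have h3 := h.tendsto_quotient hU (l := 𝓝[≠] (0 : ℝ)) ha hid self_mem_nhdsWithin
      (tendsto_const_nhds (x := a)) (tendsto_const_nhds (x := x + y))
    refine tendsto_nhds_unique h3 ((h1.add h2).congr fun t => ?_)
    rw [← smul_add, smul_add t x y, ← add_assoc]
    congr 1
    abel
  map_smul' r x := by
    rcases eq_or_ne r 0 with rfl | hr
    · have h1 := h.hasSlope ha hU (0 : E)
      have h2 : HasSlope (fun t : ℝ => f (a + t • (0 : E))) 0 0 := by
        simpa using hasSlope_const (f a) 0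
      simpa using h1.unique h2
    · have h1 := h.hasSlope ha hU x
      have h2 := h.hasSlope ha hU (r • x)
      have h3 := HasSlope.comp_smul (t := 0) r (by simpa using h1)
      refine h2.unique (h3.congr' (Eventually.of_forall fun s => ?_))
      simp only [smul_smul]
      ring_nf
  cont := by
    rw [continuous_iff_continuousAt]
    intro x
    exact h.tendsto_deriv hU ha tendsto_const_nhds tendsto_id

lemma clm_apply (h : HasSmoothDerivs f U d) (hU : IsOpen U) {a : E} (ha : a ∈ U) (x : E) :
    h.clm hU ha x = d 1 a fun _ => x := rfl

/-- The second difference quotients of a smooth map converge to the second derivative. -/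
theorem tendsto_second_difference (h : HasSmoothDerivs f U d) (hU : IsOpen U) {a : E} (ha : a ∈ U)
    (x y : E) :
    Tendsto (fun t : ℝ => t⁻¹ • t⁻¹ • ((f (a + t • x + t • y) - f (a + t • x)) -
      (f (a + t • y) - f a))) (𝓝[≠] 0) (𝓝 (d 2 a ![x, y])) := by
  rw [tendsto_iff_contSeminorm]
  intro q ε hε
  have hid : Tendsto (fun t : ℝ => t) (𝓝[≠] 0) (𝓝 0) :=
    tendsto_nhdsWithin_of_tendsto_nhds tendsto_id
  -- the points `a + r t x`, uniformly in `r ∈ [0, 1]`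
  have hb : Tendsto (fun z : ℝ × ℝ => a + z.2 • z.1 • x) (𝓝[≠] 0 ×ˢ 𝓟 (Icc 0 1)) (𝓝 a) := by
    have h1 : Tendsto (fun z : ℝ × ℝ => z.2 * z.1) (𝓝[≠] 0 ×ˢ 𝓟 (Icc 0 1)) (𝓝 0) := by
      refine squeeze_zero_norm' (a := fun z : ℝ × ℝ => |z.1|) ?_ ?_
      · rw [eventually_prod_principal_iff]
        filter_upwards with t r hr
        rw [norm_mul, Real.norm_eq_abs, Real.norm_eq_abs, abs_of_nonneg hr.1]
        exact mul_le_of_le_one_left (abs_nonneg _) hr.2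
      · have : Tendsto (fun t : ℝ => |t|) (𝓝[≠] 0) (𝓝 0) := by
          simpa using hid.abs
        exact this.comp tendsto_fst
    have h2 := (h1.smul_const x).const_add a
    simp only [zero_smul, add_zero, mul_smul] at h2
    exact h2
  have hs : Tendsto (fun z : ℝ × ℝ => z.1) (𝓝[≠] (0 : ℝ) ×ˢ 𝓟 (Icc (0 : ℝ) 1)) (𝓝 0) :=
    hid.comp tendsto_fst
  have h0 : ∀ᶠ z : ℝ × ℝ in 𝓝[≠] (0 : ℝ) ×ˢ 𝓟 (Icc (0 : ℝ) 1), z.1 ≠ 0 :=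
    tendsto_fst.eventually self_mem_nhdsWithin
  have h1 := (h.shift x).tendsto_quotient hU ha hs h0 hb (tendsto_const_nhds (x := y))
  rw [Fin.cons_const_eq, tendsto_iff_contSeminorm] at h1
  have h2 := h1 q (ε / 2) (half_pos hε)
  have h3 : Tendsto (fun z : ℝ × ℝ => a + z.2 • z.1 • x + z.1 • y)
      (𝓝[≠] (0 : ℝ) ×ˢ 𝓟 (Icc (0 : ℝ) 1)) (𝓝 a) := by
    have := hb.add (hs.smul_const y)
    simpa using this
  have h4 := (h2.and ((hb.eventually (hU.mem_nhds ha)).and (h3.eventually (hU.mem_nhds ha))))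
  rw [eventually_prod_principal_iff] at h4
  filter_upwards [h4, self_mem_nhdsWithin] with t ht ht0
  have ht0' : t ≠ 0 := ht0
  have h11 := HasSlope.sub_mem
    (c := fun r : ℝ => t⁻¹ • t⁻¹ • (f (a + r • t • x + t • y) - f (a + r • t • x)))
    (isClosed_contSeminorm_le q (d 2 a ![x, y]) (ε / 2))
    (convex_contSeminorm_le q (d 2 a ![x, y]) (ε / 2))
    (fun r hr => ⟨t⁻¹ • ((d 1 (a + r • t • x + t • y) fun _ => x) -
        d 1 (a + r • t • x) fun _ => x), (ht r hr).1.le, by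
      obtain ⟨-, h5, h6⟩ := ht r hr
      have e1 : HasSlope (fun r : ℝ => a + r • t • x) (t • x) r := by
        simpa using (hasSlope_const a r).add (hasSlope_smul_const (t • x) r)
      have e2 : HasSlope (fun r : ℝ => a + r • t • x + t • y) (t • x) r := by
        simpa using e1.add (hasSlope_const (t • y) r)
      have e3 := (h.hasSlope_comp hU h6 e2).sub (h.hasSlope_comp hU h5 e1)
      have e4 := e3.map (t⁻¹ • t⁻¹ • ContinuousLinearMap.id ℝ F)
      refine (congrArg (fun w => HasSlope _ w r) ?_).mp e4
      change t⁻¹ • t⁻¹ • ((_ : F) - _) = _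
      rw [← h.clm_apply hU h6, ← h.clm_apply hU h5, ← h.clm_apply hU h6, ← h.clm_apply hU h5,
        map_smul, map_smul, ← smul_sub, smul_smul t⁻¹ t, inv_mul_cancel₀ ht0', one_smul]⟩)
  simp only [one_smul, zero_smul, add_zero] at h11
  rw [← smul_sub, ← smul_sub] at h11
  exact lt_of_le_of_lt h11 (half_lt_self hε)

/-- Schwarz' theorem. -/
theorem deriv_two_comm (h : HasSmoothDerivs f U d) (hU : IsOpen U) {a : E} (ha : a ∈ U) (x y : E) :
    d 2 a ![x, y] = d 2 a ![y, x] := by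
  refine tendsto_nhds_unique (h.tendsto_second_difference hU ha x y)
    ((h.tendsto_second_difference hU ha y x).congr fun t => ?_)
  rw [add_right_comm]
  congr 2
  abel

lemma deriv_two_add_right (h : HasSmoothDerivs f U d) (hU : IsOpen U) {a : E} (ha : a ∈ U)
    (x y z : E) : d 2 a ![x, y + z] = d 2 a ![x, y] + d 2 a ![x, z] := by
  have := ((h.shift x).clm hU ha).map_add y z
  simpa only [clm_apply, Fin.cons_const_eq] using this

lemma deriv_two_neg_right (h : HasSmoothDerivs f U d) (hU : IsOpen U) {a : E} (ha : a ∈ U)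
    (x y : E) : d 2 a ![x, -y] = -d 2 a ![x, y] := by
  have := ((h.shift x).clm hU ha).map_neg y
  simpa only [clm_apply, Fin.cons_const_eq] using this

lemma deriv_two_add_left (h : HasSmoothDerivs f U d) (hU : IsOpen U) {a : E} (ha : a ∈ U)
    (x y z : E) : d 2 a ![x + y, z] = d 2 a ![x, z] + d 2 a ![y, z] := by
  rw [h.deriv_two_comm hU ha, h.deriv_two_add_right hU ha, h.deriv_two_comm hU ha z,
    h.deriv_two_comm hU ha z]

/-- In a local group with multiplication `μ` and unit `c`, let `a` and `b` be curves through `c`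
with opposite velocities `x` and `-x`. The derivative at `0` of the conjugation
`y ↦ a(t) y b(t)` is the Lie bracket `d²μ((x,0),(0,y)) - d²μ((y,0),(0,x))`. -/
theorem hasSlope_conj [T2Space E] {μ : E × E → E} {Ω : Set (E × E)}
    {d : (k : ℕ) → E × E → (Fin k → E × E) → E} (h : HasSmoothDerivs μ Ω d) (hΩ : IsOpen Ω) {c : E}
    (hc : (c, c) ∈ Ω) (hl : ∀ᶠ x in 𝓝 c, μ (c, x) = x) (hr : ∀ᶠ x in 𝓝 c, μ (x, c) = x)
    {a b : ℝ → E} {x : E} (ha0 : a 0 = c) (hb0 : b 0 = c) (ha : HasSlope a x 0)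
    (hb : HasSlope b (-x) 0) (y : E) :
    HasSlope (fun t => d 1 (a t, b t) fun _ => (d 1 (a t, c) fun _ => (0, y), 0))
      (d 2 (c, c) ![(x, 0), (0, y)] - d 2 (c, c) ![(y, 0), (0, x)]) 0 := by
  have line (v : E) : Tendsto (fun t : ℝ => c + t • v) (𝓝 0) (𝓝 c) :=
    Continuous.tendsto' (by fun_prop) _ _ (by simp)
  have hline (z v : E) : HasSlope (fun t : ℝ => z + t • v) v 0 := by
    simpa using (hasSlope_const z 0).add (hasSlope_smul_const v 0)
  -- the first derivatives of the multiplication at the unit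
  have hleft : ∀ k, (d 1 (c, c) fun _ => (0, k)) = k := by
    intro k
    have h1 := h.hasSlope hc hΩ (0, k)
    refine h1.unique ((hline c k).congr' ?_)
    filter_upwards [(line k).eventually hl] with t ht
    simp only [zero_add, Prod.smul_mk, smul_zero, Prod.mk_add_mk, add_zero]
    exact ht.symm
  have hright : ∀ᶠ z in 𝓝 c, ∀ k, (z, c) ∈ Ω ∧ (d 1 (z, c) fun _ => (k, 0)) = k := by
    have h2 : ∀ᶠ z in 𝓝 c, (z, c) ∈ Ω :=
      (Continuous.tendsto' (f := fun z => (z, c)) (by fun_prop) c _ rfl).eventually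
        (hΩ.mem_nhds hc)
    filter_upwards [hr.eventually_nhds, h2] with z hz hz' k
    refine ⟨hz', ?_⟩
    have h1 := h.hasSlope hz' hΩ (k, 0)
    refine h1.unique ((hline z k).congr' ?_)
    have h3 : Tendsto (fun t : ℝ => z + t • k) (𝓝 0) (𝓝 z) :=
      Continuous.tendsto' (by fun_prop) _ _ (by simp)
    filter_upwards [h3.eventually hz] with t ht
    simp only [zero_add, Prod.smul_mk, smul_zero, Prod.mk_add_mk, add_zero]
    exact ht.symm
  have hpair {p q : ℝ → E} {v w : E} (hp : HasSlope p v 0) (hq : HasSlope q w 0) :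
      HasSlope (fun t => (p t, q t)) (v, w) 0 := by
    have : Tendsto (fun s : ℝ => (s⁻¹ • (p (0 + s) - p 0), s⁻¹ • (q (0 + s) - q 0))) (𝓝[≠] 0)
        (𝓝 (v, w)) := Tendsto.prodMk_nhds hp hq
    exact this
  have hβ : HasSlope (fun t => d 1 (a t, c) fun _ => (0, y)) (d 2 (c, c) ![(0, y), (x, 0)]) 0 := by
    have h1 := (h.shift (0, y)).hasSlope_comp hΩ (c := fun t => (a t, c)) (t := 0)
      (by simpa [ha0] using hc) (hpair ha (hasSlope_const c 0))
    simpa only [Fin.cons_const_eq, ha0] using h1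
  have hγ : HasSlope (fun t => d 1 (a t, b t) fun _ => (y, 0))
      (d 2 (c, c) ![(y, 0), (x, -x)]) 0 := by
    have h1 := (h.shift (y, 0)).hasSlope_comp hΩ (c := fun t => (a t, b t)) (t := 0)
      (by simpa [ha0, hb0] using hc) (hpair ha hb)
    simpa only [Fin.cons_const_eq, ha0, hb0] using h1
  have hzero : d 2 (c, c) ![(y, 0), (x, 0)] = 0 := by
    have h1 := (h.shift (y, 0)).hasSlope hc hΩ (x, 0)
    rw [Fin.cons_const_eq] at h1
    refine h1.unique ((hasSlope_const y 0).congr' ?_)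
    filter_upwards [(line x).eventually hright] with t ht
    simp only [zero_add, Prod.smul_mk, smul_zero, Prod.mk_add_mk, add_zero]
    exact (ht y).2.symm
  have hval : d 2 (c, c) ![(x, 0), (0, y)] - d 2 (c, c) ![(y, 0), (0, x)] =
      d 2 (c, c) ![(0, y), (x, 0)] + d 2 (c, c) ![(y, 0), (x, -x)] := by
    have h1 : ((x, -x) : E × E) = (x, 0) + -(0, x) := by simp
    rw [h1, h.deriv_two_add_right hΩ hc, hzero, zero_add, h.deriv_two_neg_right hΩ hc,
      h.deriv_two_comm hΩ hc (0, y), sub_eq_add_neg]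
  rw [hval]
  have hab : Tendsto (fun t => (a (0 + t), b (0 + t))) (𝓝[≠] 0) (𝓝 (c, c)) := by
    have h1 := (tendsto_of_hasSlope ha).prodMk_nhds (tendsto_of_hasSlope hb)
    rw [ha0, hb0] at h1
    exact h1.mono_left nhdsWithin_le_nhds
  have hβ0 : (d 1 (a 0, c) fun _ => (0, y)) = y := by rw [ha0]; exact hleft y
  have hfirst := h.tendsto_deriv hΩ hc hab
    (Tendsto.prodMk_nhds hβ (tendsto_const_nhds (x := (0 : E))))
  rw [(hright.self_of_nhds _).2] at hfirst
  refine (hfirst.add hγ).congr' ?_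
  filter_upwards [hab.eventually (hΩ.mem_nhds hc)] with t ht
  rw [hβ0, ha0, hb0, (hright.self_of_nhds _).2, ← h.clm_apply hΩ ht, ← h.clm_apply hΩ ht,
    ← h.clm_apply hΩ ht]
  have h2 : ((t⁻¹ • ((d 1 (a (0 + t), c) fun _ => (0, y)) - y), 0) : E × E) =
      t⁻¹ • (((d 1 (a (0 + t), c) fun _ => (0, y)), 0) - (y, 0)) := by simp
  rw [h2, map_smul, map_sub, ← smul_add]
  congr 1
  abel

end HasSmoothDerivs
end Calculus

lemma HasSlope.prodMk {E F : Type*} [AddCommGroup E] [Module ℝ E] [TopologicalSpace E]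
    [AddCommGroup F] [Module ℝ F] [TopologicalSpace F] {p : ℝ → E} {q : ℝ → F} {v : E} {w : F}
    {t : ℝ} (hp : HasSlope p v t) (hq : HasSlope q w t) :
    HasSlope (fun t => (p t, q t)) (v, w) t := by
  have : Tendsto (fun s : ℝ => (s⁻¹ • (p (t + s) - p t), s⁻¹ • (q (t + s) - q t))) (𝓝[≠] 0)
      (𝓝 (v, w)) := Tendsto.prodMk_nhds hp hq
  exact this

lemma hasSlope_iff_zero {E : Type*} [AddCommGroup E] [Module ℝ E] [TopologicalSpace E] {c : ℝ → E}
    {v : E} {t : ℝ} : HasSlope c v t ↔ HasSlope (fun s => c (t + s)) v 0 := by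
  unfold HasSlope
  simp only [zero_add, add_zero]

lemma hasSlope_line {E : Type*} [AddCommGroup E] [Module ℝ E] [TopologicalSpace E]
    [IsTopologicalAddGroup E] (a v : E) (t : ℝ) : HasSlope (fun t : ℝ => a + t • v) v t := by
  simpa using (hasSlope_const a t).add (hasSlope_smul_const v t)

/-! ### Local groups in exponential coordinates -/

section LocalGroup

variable {𝔤 : Type*} [LieRing 𝔤] [LieAlgebra ℝ 𝔤] [TopologicalSpace 𝔤]

/-- `(U, D, m, 0)` witnesses that the Lie algebra is locally exponential, and `d` is the family of
iterated derivatives of `m`. -/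
structure IsLocExpGroup (U : Set 𝔤) (D : Set (𝔤 × 𝔤)) (m : 𝔤 × 𝔤 → 𝔤)
    (d : (k : ℕ) → 𝔤 × 𝔤 → (Fin k → 𝔤 × 𝔤) → 𝔤) : Prop extends IsLocExpWitness U D m where
  smooth : HasSmoothDerivs m D d
  bracket : ∀ x y : 𝔤, d 2 (0, 0) ![(x, y), (x, y)] = ⁅x, y⁆

lemma IsLocExpWitness.exists_isLocExpGroup {U : Set 𝔤} {D : Set (𝔤 × 𝔤)} {m : 𝔤 × 𝔤 → 𝔤}
    (h : IsLocExpWitness U D m) : ∃ d, IsLocExpGroup U D m d := by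
  obtain ⟨d, h1, h2⟩ := h.E2
  exact ⟨d, ⟨h, h1, h2⟩⟩

/-- The derivative at `0` of the left translation `y ↦ m (x, y)`. -/
def leftDeriv (d : (k : ℕ) → 𝔤 × 𝔤 → (Fin k → 𝔤 × 𝔤) → 𝔤) (x a : 𝔤) : 𝔤 :=
  d 1 (x, 0) fun _ => (0, a)

/-- The left logarithmic derivative of the exponential chart: the derivative at `x` of
`y ↦ m (-x, y)`. -/
def leftLogDeriv (d : (k : ℕ) → 𝔤 × 𝔤 → (Fin k → 𝔤 × 𝔤) → 𝔤) (x a : 𝔤) : 𝔤 :=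
  d 1 (-x, x) fun _ => (0, a)

/-- The adjoint action of `x`: the derivative at `0` of the conjugation `y ↦ x * y * (-x)`. -/
def locAd (d : (k : ℕ) → 𝔤 × 𝔤 → (Fin k → 𝔤 × 𝔤) → 𝔤) (x a : 𝔤) : 𝔤 :=
  d 1 (x, -x) fun _ => (leftDeriv d x a, 0)

namespace IsLocExpGroup

variable {U : Set 𝔤} {D : Set (𝔤 × 𝔤)} {m : 𝔤 × 𝔤 → 𝔤}
  {d : (k : ℕ) → 𝔤 × 𝔤 → (Fin k → 𝔤 × 𝔤) → 𝔤} (S : IsLocExpGroup U D m d)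
include S

lemma isOpen_U : IsOpen U := S.isLocalLieGroup.isOpen_carrier
lemma isOpen_D : IsOpen D := S.isLocalLieGroup.isOpen_domain
lemma zero_mem : (0 : 𝔤) ∈ U := S.isLocalLieGroup.one_mem
lemma fst_mem {x y : 𝔤} (h : (x, y) ∈ D) : x ∈ U := (S.isLocalLieGroup.domain_subset h).1
lemma snd_mem {x y : 𝔤} (h : (x, y) ∈ D) : y ∈ U := (S.isLocalLieGroup.domain_subset h).2
lemma mul_mem {x y : 𝔤} (h : (x, y) ∈ D) : m (x, y) ∈ U := S.isLocalLieGroup.mapsTo h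
lemma mem_zero {x : 𝔤} (h : x ∈ U) : (x, 0) ∈ D := (S.isLocalLieGroup.mul_one x h).1
lemma mul_zero {x : 𝔤} (h : x ∈ U) : m (x, 0) = x := (S.isLocalLieGroup.mul_one x h).2
lemma zero_mem' {x : 𝔤} (h : x ∈ U) : (0, x) ∈ D := (S.isLocalLieGroup.one_mul x h).1
lemma zero_mul {x : 𝔤} (h : x ∈ U) : m (0, x) = x := (S.isLocalLieGroup.one_mul x h).2

lemma smul_mem {x : 𝔤} (h : x ∈ U) {t : ℝ} (ht : |t| ≤ 1) : t • x ∈ U :=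
  S.balanced.smul_mem (by simpa using ht) h

lemma neg_mem {x : 𝔤} (h : x ∈ U) : -x ∈ U := by
  simpa using S.smul_mem h (t := -1) (by simp)

/-- The one-parameter law on the possibly larger interval `[-r, r]`. -/
lemma smul_mem_mul {r : ℝ} (hr : 0 < r) {x : 𝔤} (h : r • x ∈ U) {t s : ℝ} (ht : |t| ≤ r)
    (hs : |s| ≤ r) (hts : |t + s| ≤ r) :
    (t • x, s • x) ∈ D ∧ m (t • x, s • x) = (t + s) • x := by
  have h1 := S.E1 (r • x) h (t / r) (s / r) (by rwa [abs_div, abs_of_pos hr, div_le_one hr])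
    (by rwa [abs_div, abs_of_pos hr, div_le_one hr])
    (by rwa [← add_div, abs_div, abs_of_pos hr, div_le_one hr])
  rwa [← add_div, smul_smul, smul_smul, smul_smul, div_mul_cancel₀ _ hr.ne',
    div_mul_cancel₀ _ hr.ne', div_mul_cancel₀ _ hr.ne'] at h1

lemma mul_neg {x : 𝔤} (h : x ∈ U) : (x, -x) ∈ D ∧ m (x, -x) = 0 := by
  simpa using S.smul_mem_mul one_pos (x := x) (by simpa using h) (t := 1) (s := -1) (by simp)
    (by simp) (by simp)

lemma neg_mul {x : 𝔤} (h : x ∈ U) : (-x, x) ∈ D ∧ m (-x, x) = 0 := by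
  simpa using S.mul_neg (S.neg_mem h)

lemma assoc_left {x y z : 𝔤} (h1 : (x, y) ∈ D) (h2 : (y, z) ∈ D) (h3 : (m (x, y), z) ∈ D) :
    (x, m (y, z)) ∈ D ∧ m (m (x, y), z) = m (x, m (y, z)) :=
  ⟨(S.isLocalLieGroup.assoc x y z h1 h2).1.1 h3, (S.isLocalLieGroup.assoc x y z h1 h2).2 h3⟩

lemma assoc_right {x y z : 𝔤} (h1 : (x, y) ∈ D) (h2 : (y, z) ∈ D) (h3 : (x, m (y, z)) ∈ D) :
    (m (x, y), z) ∈ D ∧ m (m (x, y), z) = m (x, m (y, z)) := by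
  have h4 := (S.isLocalLieGroup.assoc x y z h1 h2).1.2 h3
  exact ⟨h4, (S.isLocalLieGroup.assoc x y z h1 h2).2 h4⟩

lemma neg_mul_cancel {x y : 𝔤} (h : (x, y) ∈ D) : (-x, m (x, y)) ∈ D ∧ m (-x, m (x, y)) = y := by
  have h1 := S.neg_mul (S.fst_mem h)
  have h2 := S.assoc_left h1.1 h (by rw [h1.2]; exact S.zero_mem' (S.snd_mem h))
  rw [h1.2, S.zero_mul (S.snd_mem h)] at h2
  exact ⟨h2.1, h2.2.symm⟩

lemma mul_neg_cancel {x y : 𝔤} (h : (x, y) ∈ D) : (m (x, y), -y) ∈ D ∧ m (m (x, y), -y) = x := by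
  have h1 := S.mul_neg (S.snd_mem h)
  have h2 := S.assoc_right h h1.1 (by rw [h1.2]; exact S.mem_zero (S.fst_mem h))
  rwa [h1.2, S.mul_zero (S.fst_mem h)] at h2

/-- Inversion is `x ↦ -x`, and it reverses products. -/
lemma neg_mul_rev {x y : 𝔤} (h : (x, y) ∈ D) : (-y, -x) ∈ D ∧ m (-y, -x) = -m (x, y) := by
  obtain ⟨inv, -, h1, h2⟩ := S.isLocalLieGroup.inverse
  have h3 : ∀ x ∈ U, inv x = -x := fun x hx =>
    ((h1 x hx).2.2.2 (-x) (S.neg_mem hx) (S.mul_neg hx) (S.neg_mul hx)).symm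
  have h4 := h2 x y h
  rw [h3 _ (S.fst_mem h), h3 _ (S.snd_mem h)] at h4
  refine ⟨h4, ?_⟩
  have h5 := S.mul_neg_cancel h
  have h6 := S.assoc_left h5.1 h4 (by rw [h5.2]; exact (S.mul_neg (S.fst_mem h)).1)
  rw [h5.2, (S.mul_neg (S.fst_mem h)).2] at h6
  have h7 := S.neg_mul_cancel h6.1
  rw [← h6.2, S.mul_zero (S.neg_mem (S.mul_mem h))] at h7
  exact h7.2.symm

section Limits

variable {α : Type*} {l : Filter α} {a b c : α → 𝔤} {a₀ b₀ c₀ : 𝔤}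

lemma eventually_mem (h : (a₀, b₀) ∈ D) (ha : Tendsto a l (𝓝 a₀)) (hb : Tendsto b l (𝓝 b₀)) :
    ∀ᶠ i in l, (a i, b i) ∈ D :=
  (ha.prodMk_nhds hb).eventually (S.isOpen_D.mem_nhds h)

lemma tendsto_mul (h : (a₀, b₀) ∈ D) (ha : Tendsto a l (𝓝 a₀)) (hb : Tendsto b l (𝓝 b₀)) :
    Tendsto (fun i => m (a i, b i)) l (𝓝 (m (a₀, b₀))) :=
  (S.smooth.continuousAt S.isOpen_D h).tendsto.comp (ha.prodMk_nhds hb)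

lemma eventually_assoc (h1 : (a₀, b₀) ∈ D) (h2 : (b₀, c₀) ∈ D) (h3 : (m (a₀, b₀), c₀) ∈ D)
    (ha : Tendsto a l (𝓝 a₀)) (hb : Tendsto b l (𝓝 b₀)) (hc : Tendsto c l (𝓝 c₀)) :
    ∀ᶠ i in l, m (m (a i, b i), c i) = m (a i, m (b i, c i)) := by
  filter_upwards [S.eventually_mem h1 ha hb, S.eventually_mem h2 hb hc,
    S.eventually_mem h3 (S.tendsto_mul h1 ha hb) hc] with i h4 h5 h6
  exact (S.assoc_left h4 h5 h6).2

end Limits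

variable [LocallyConvexLieAlgebra 𝔤]

omit S in
lemma _root_.continuous_lie_left (v : 𝔤) : Continuous fun x : 𝔤 => ⁅v, x⁆ :=
  LocallyConvexLieAlgebra.continuous_lie.comp (continuous_const.prodMk continuous_id)

lemma exists_smul_mem {x : 𝔤} (h : x ∈ U) : ∃ r : ℝ, 1 < r ∧ r • x ∈ U := by
  have h1 : Tendsto (fun r : ℝ => r • x) (𝓝[>] 1) (𝓝 x) :=
    Tendsto.mono_left (Continuous.tendsto' (by fun_prop) _ _ (by simp)) nhdsWithin_le_nhds
  have h2 := (h1.eventually (S.isOpen_U.mem_nhds h)).and (self_mem_nhdsWithin (a := (1 : ℝ)))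
  obtain ⟨r, hr, hr'⟩ := h2.exists
  exact ⟨r, hr', hr⟩

lemma eventually_smul_mul {x : 𝔤} (h : x ∈ U) {t : ℝ} (ht : |t| ≤ 1) :
    ∀ᶠ s : ℝ in 𝓝 0, ((t • x, s • x) ∈ D ∧ m (t • x, s • x) = (t + s) • x) ∧
      ((s • x, t • x) ∈ D ∧ m (s • x, t • x) = (t + s) • x) := by
  obtain ⟨r, hr, hrx⟩ := S.exists_smul_mem h
  have h1 : ∀ᶠ s : ℝ in 𝓝 0, |s| < r - 1 := by
    have : Tendsto (fun s : ℝ => |s|) (𝓝 0) (𝓝 0) := Continuous.tendsto' (by fun_prop) _ _ (by simp)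
    exact this.eventually (gt_mem_nhds (by linarith))
  have h2 : ∀ᶠ s : ℝ in 𝓝 0, |s| < 1 := by
    have : Tendsto (fun s : ℝ => |s|) (𝓝 0) (𝓝 0) := Continuous.tendsto' (by fun_prop) _ _ (by simp)
    exact this.eventually (gt_mem_nhds one_pos)
  filter_upwards [h1, h2] with s hs hs'
  have h3 : |t + s| ≤ r := (abs_add_le t s).trans (by linarith)
  refine ⟨S.smul_mem_mul (by linarith) hrx (by linarith) (by linarith) h3, ?_⟩
  rw [add_comm t s]
  exact S.smul_mem_mul (by linarith) hrx (by linarith) (by linarith) (by rwa [add_comm])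

/-! ### Adjoint action and logarithmic derivative of a local group -/

lemma hasSlope_mul {a b : ℝ → 𝔤} {v w : 𝔤} {t : ℝ} (h : (a t, b t) ∈ D) (ha : HasSlope a v t)
    (hb : HasSlope b w t) : HasSlope (fun t => m (a t, b t)) (d 1 (a t, b t) fun _ => (v, w)) t :=
  S.smooth.hasSlope_comp S.isOpen_D (c := fun t => (a t, b t)) h (ha.prodMk hb)

lemma hasSlope_left {x : 𝔤} (hx : x ∈ U) {c : ℝ → 𝔤} {a : 𝔤} (hc0 : c 0 = 0)
    (hc : HasSlope c a 0) : HasSlope (fun t => m (x, c t)) (leftDeriv d x a) 0 := by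
  have := S.hasSlope_mul (a := fun _ => x) (t := 0) (by rw [hc0]; exact S.mem_zero hx)
    (hasSlope_const x 0) hc
  rwa [hc0] at this

lemma hasSlope_conj {x : 𝔤} (hx : x ∈ U) {c : ℝ → 𝔤} {a : 𝔤} (hc0 : c 0 = 0)
    (hc : HasSlope c a 0) : HasSlope (fun t => m (m (x, c t), -x)) (locAd d x a) 0 := by
  have h0 : m (x, c 0) = x := by rw [hc0, S.mul_zero hx]
  have := S.hasSlope_mul (b := fun _ => -x) (t := 0) (by rw [h0]; exact (S.mul_neg hx).1)
    (S.hasSlope_left hx hc0 hc) (hasSlope_const (-x) 0)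
  rwa [h0] at this

lemma deriv_add {x y : 𝔤} (h : (x, y) ∈ D) (v w : 𝔤) :
    (d 1 (x, y) fun _ => (v, w)) = (d 1 (x, y) fun _ => (v, 0)) + d 1 (x, y) fun _ => (0, w) := by
  have := (S.smooth.clm S.isOpen_D h).map_add (v, 0) (0, w)
  simpa [HasSmoothDerivs.clm_apply] using this

lemma deriv_left_zero {x : 𝔤} (hx : x ∈ U) (v : 𝔤) : (d 1 (x, 0) fun _ => (v, 0)) = v := by
  have h1 := S.hasSlope_mul (b := fun _ => 0) (t := 0) (a := fun t => x + t • v)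
    (by simpa using S.mem_zero hx) (hasSlope_line x v 0) (hasSlope_const 0 0)
  have h2 : Tendsto (fun t : ℝ => x + (0 + t) • v) (𝓝 0) (𝓝 x) :=
    Continuous.tendsto' (by fun_prop) _ _ (by simp)
  simp only [zero_smul, add_zero] at h1
  refine h1.unique ((hasSlope_line x v 0).congr' ?_)
  filter_upwards [h2.eventually (S.isOpen_U.mem_nhds hx)] with t ht
  rw [S.mul_zero ht]

lemma deriv_right_zero {x : 𝔤} (hx : x ∈ U) (v : 𝔤) : (d 1 (0, x) fun _ => (0, v)) = v := by
  have h1 := S.hasSlope_mul (a := fun _ => 0) (t := 0) (b := fun t => x + t • v)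
    (by simpa using S.zero_mem' hx) (hasSlope_const 0 0) (hasSlope_line x v 0)
  have h2 : Tendsto (fun t : ℝ => x + (0 + t) • v) (𝓝 0) (𝓝 x) :=
    Continuous.tendsto' (by fun_prop) _ _ (by simp)
  simp only [zero_smul, add_zero] at h1
  refine h1.unique ((hasSlope_line x v 0).congr' ?_)
  filter_upwards [h2.eventually (S.isOpen_U.mem_nhds hx)] with t ht
  rw [S.zero_mul ht]

lemma leftDeriv_zero (a : 𝔤) : leftDeriv d 0 a = a := S.deriv_right_zero S.zero_mem a

lemma locAd_zero (a : 𝔤) : locAd d 0 a = a := by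
  rw [locAd, S.leftDeriv_zero, neg_zero, S.deriv_left_zero S.zero_mem]

/-- The logarithmic derivative as a continuous linear map. -/
def leftLogDerivCLM {x : 𝔤} (hx : x ∈ U) : 𝔤 →L[ℝ] 𝔤 :=
  (S.smooth.clm S.isOpen_D (S.neg_mul hx).1).comp (ContinuousLinearMap.inr ℝ 𝔤 𝔤)

lemma leftLogDerivCLM_apply {x : 𝔤} (hx : x ∈ U) (a : 𝔤) :
    S.leftLogDerivCLM hx a = leftLogDeriv d x a := rfl

/-- The derivative of the left translation as a continuous linear map. -/
def leftDerivCLM {x : 𝔤} (hx : x ∈ U) : 𝔤 →L[ℝ] 𝔤 :=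
  (S.smooth.clm S.isOpen_D (S.mem_zero hx)).comp (ContinuousLinearMap.inr ℝ 𝔤 𝔤)

lemma leftDerivCLM_apply {x : 𝔤} (hx : x ∈ U) (a : 𝔤) : S.leftDerivCLM hx a = leftDeriv d x a := rfl

/-- The adjoint action as a continuous linear map. -/
def locAdCLM {x : 𝔤} (hx : x ∈ U) : 𝔤 →L[ℝ] 𝔤 :=
  ((S.smooth.clm S.isOpen_D (S.mul_neg hx).1).comp (ContinuousLinearMap.inl ℝ 𝔤 𝔤)).comp
    (S.leftDerivCLM hx)

lemma locAdCLM_apply {x : 𝔤} (hx : x ∈ U) (a : 𝔤) : S.locAdCLM hx a = locAd d x a := rfl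

lemma leftLogDeriv_leftDeriv {x : 𝔤} (hx : x ∈ U) (a : 𝔤) :
    leftLogDeriv d x (leftDeriv d x a) = a := by
  have h1 := S.hasSlope_mul (a := fun _ => -x) (t := 0)
    (by simpa [S.mul_zero hx] using (S.neg_mul hx).1) (hasSlope_const (-x) 0)
    (S.hasSlope_left hx (by simp) (hasSlope_smul_const a 0))
  simp only [zero_smul, S.mul_zero hx] at h1
  refine HasSlope.unique h1 ((hasSlope_smul_const a 0).congr' ?_)
  have h2 : Tendsto (fun t : ℝ => (0 + t) • a) (𝓝 0) (𝓝 0) :=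
    Continuous.tendsto' (by fun_prop) _ _ (by simp)
  filter_upwards [S.eventually_mem (S.mem_zero hx) tendsto_const_nhds h2] with t ht
  rw [(S.neg_mul_cancel ht).2]

lemma leftDeriv_leftLogDeriv {x : 𝔤} (hx : x ∈ U) (a : 𝔤) :
    leftDeriv d x (leftLogDeriv d x a) = a := by
  have h1 := S.hasSlope_mul (a := fun _ => -x) (b := fun t => x + t • a) (t := 0)
    (by simpa using (S.neg_mul hx).1) (hasSlope_const (-x) 0) (hasSlope_line x a 0)
  simp only [zero_smul, add_zero] at h1
  have h3 := S.hasSlope_left hx (by simpa using (S.neg_mul hx).2) h1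
  refine HasSlope.unique h3 ((hasSlope_line x a 0).congr' ?_)
  have h2 : Tendsto (fun t : ℝ => x + (0 + t) • a) (𝓝 0) (𝓝 x) :=
    Continuous.tendsto' (by fun_prop) _ _ (by simp)
  filter_upwards [S.eventually_mem (S.neg_mul hx).1 tendsto_const_nhds h2] with t ht
  have := S.neg_mul_cancel ht
  rw [neg_neg] at this
  rw [this.2]

lemma leftLogDeriv_injective {x : 𝔤} (hx : x ∈ U) {a : 𝔤} (h : leftLogDeriv d x a = 0) : a = 0 := by
  rw [← S.leftDeriv_leftLogDeriv hx a, h, ← S.leftDerivCLM_apply hx, map_zero]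

lemma locAd_mul {x y : 𝔤} (h : (x, y) ∈ D) (a : 𝔤) :
    locAd d (m (x, y)) a = locAd d x (locAd d y a) := by
  have hx := S.fst_mem h
  have hy := S.snd_mem h
  have ha := hasSlope_smul_const a (0 : ℝ)
  have h1 := S.hasSlope_conj (S.mul_mem h) (by simp) ha
  have h2 := S.hasSlope_conj hy (by simp) ha
  have h3 := S.hasSlope_conj hx (by simp [S.mul_zero hy, (S.mul_neg hy).2]) h2
  refine h1.unique (h3.congr' ?_)
  have h4 : Tendsto (fun t : ℝ => (0 + t) • a) (𝓝 0) (𝓝 0) :=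
    Continuous.tendsto' (by fun_prop) _ _ (by simp)
  have hb : Tendsto (fun t : ℝ => m (y, (0 + t) • a)) (𝓝 0) (𝓝 y) := by
    have := S.tendsto_mul (S.mem_zero hy) tendsto_const_nhds h4
    rwa [S.mul_zero hy] at this
  have he : Tendsto (fun t : ℝ => m (m (x, y), (0 + t) • a)) (𝓝 0) (𝓝 (m (x, y))) := by
    have := S.tendsto_mul (S.mem_zero (S.mul_mem h)) tendsto_const_nhds h4
    rwa [S.mul_zero (S.mul_mem h)] at this
  have h5 := S.mul_neg_cancel h
  have h6 := S.neg_mul_rev h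
  have e1 := S.eventually_assoc h (S.mem_zero hy) (S.mem_zero (S.mul_mem h))
    (tendsto_const_nhds (x := x)) (tendsto_const_nhds (x := y)) h4
  have e2 := S.eventually_assoc h (S.mul_neg hy).1 h5.1 (tendsto_const_nhds (x := x)) hb
    (tendsto_const_nhds (x := -y))
  have e3 := S.eventually_assoc h5.1 h6.1 (by rw [h5.2]; exact (S.mul_neg hx).1) he
    (tendsto_const_nhds (x := -y)) (tendsto_const_nhds (x := -x))
  filter_upwards [e1, e2, e3] with t e1 e2 e3
  rw [← e2, ← e1, e3, h6.2]

lemma locAd_neg_locAd {x : 𝔤} (hx : x ∈ U) (a : 𝔤) : locAd d (-x) (locAd d x a) = a := by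
  rw [← S.locAd_mul (S.neg_mul hx).1, (S.neg_mul hx).2, S.locAd_zero]

lemma locAd_locAd_neg {x : 𝔤} (hx : x ∈ U) (a : 𝔤) : locAd d x (locAd d (-x) a) = a := by
  rw [← S.locAd_mul (S.mul_neg hx).1, (S.mul_neg hx).2, S.locAd_zero]

lemma deriv_two_eq (x y : 𝔤) :
    d 2 (0, 0) ![(x, 0), (0, y)] - d 2 (0, 0) ![(y, 0), (0, x)] = ⁅x, y⁆ := by
  have h0 := S.mem_zero S.zero_mem
  have h1 (x y : 𝔤) : d 2 (0, 0) ![(x, 0), (0, y)] = (2⁻¹ : ℝ) • ⁅x, y⁆ := by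
    have e1 := S.bracket x y
    have e2 : ((x, y) : 𝔤 × 𝔤) = (x, 0) + (0, y) := by simp
    rw [e2, S.smooth.deriv_two_add_left S.isOpen_D h0, S.smooth.deriv_two_add_right S.isOpen_D h0,
      S.smooth.deriv_two_add_right S.isOpen_D h0, S.bracket, S.bracket, lie_zero, zero_lie,
      zero_add, add_zero, S.smooth.deriv_two_comm S.isOpen_D h0 (0, y), ← two_smul ℝ] at e1
    rw [← e1, smul_smul, inv_mul_cancel₀ two_ne_zero, one_smul]
  rw [h1, h1, ← lie_skew x y, smul_neg, ← neg_add', ← add_smul]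
  norm_num

/-- The bracket is the derivative of the adjoint action: only here its description by the second
derivative of `m` enters. -/
lemma hasSlope_locAd_zero (x a : 𝔤) : HasSlope (fun t : ℝ => locAd d (t • x) a) ⁅x, a⁆ 0 := by
  have h0 := S.mem_zero S.zero_mem
  have hn := S.isOpen_U.mem_nhds S.zero_mem
  have h1 := S.smooth.hasSlope_conj S.isOpen_D h0
    (by filter_upwards [hn] with z hz using S.zero_mul hz)
    (by filter_upwards [hn] with z hz using S.mul_zero hz) (a := fun t : ℝ => t • x)
    (b := fun t : ℝ => t • -x) (zero_smul ℝ x) (zero_smul ℝ _) (hasSlope_smul_const x 0)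
    (hasSlope_smul_const (-x) 0) a
  rw [S.deriv_two_eq] at h1
  simp only [smul_neg] at h1
  exact h1

lemma tendsto_locAd {α : Type*} {l : Filter α} {x a : α → 𝔤} {x₀ a₀ : 𝔤} (h : x₀ ∈ U)
    (hx : Tendsto x l (𝓝 x₀)) (ha : Tendsto a l (𝓝 a₀)) :
    Tendsto (fun i => locAd d (x i) (a i)) l (𝓝 (locAd d x₀ a₀)) := by
  refine S.smooth.tendsto_deriv S.isOpen_D (S.mul_neg h).1 (hx.prodMk_nhds hx.neg) ?_
  refine Tendsto.prodMk_nhds ?_ tendsto_const_nhds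
  exact S.smooth.tendsto_deriv S.isOpen_D (S.mem_zero h) (hx.prodMk_nhds tendsto_const_nhds)
    (tendsto_const_nhds.prodMk_nhds ha)

/-- The adjoint action solves the differential equation `α' = [x, α]`. -/
lemma hasSlope_locAd {x : 𝔤} (hx : x ∈ U) (a : 𝔤) {t : ℝ} (ht : |t| ≤ 1) :
    HasSlope (fun t : ℝ => locAd d (t • x) a) ⁅x, locAd d (t • x) a⁆ t := by
  rw [hasSlope_iff_zero]
  refine (S.hasSlope_locAd_zero x (locAd d (t • x) a)).congr' ?_
  filter_upwards [S.eventually_smul_mul hx ht] with s hs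
  rw [zero_add, ← S.locAd_mul hs.2.1, hs.2.2]

lemma lie_locAd {x : 𝔤} (hx : x ∈ U) (a : 𝔤) {t : ℝ} (ht : |t| ≤ 1) :
    ⁅x, locAd d (t • x) a⁆ = locAd d (t • x) ⁅x, a⁆ := by
  refine (S.hasSlope_locAd hx a ht).unique ?_
  rw [hasSlope_iff_zero]
  refine ((S.hasSlope_locAd_zero x a).map (S.locAdCLM (S.smul_mem hx ht))).congr' ?_
  filter_upwards [S.eventually_smul_mul hx ht] with s hs
  rw [zero_add, S.locAdCLM_apply, ← S.locAd_mul hs.1.1, hs.1.2]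

lemma hasSlope_locAd_curve {x : 𝔤} (hx : x ∈ U) {α : ℝ → 𝔤} {a : 𝔤} {t : ℝ} (ht : |t| ≤ 1)
    (hα : HasSlope α a t) :
    HasSlope (fun t : ℝ => locAd d (t • x) (α t)) (locAd d (t • x) (⁅x, α t⁆ + a)) t := by
  have h1 := S.hasSlope_locAd hx (α t) ht
  rw [S.lie_locAd hx _ ht] at h1
  have h2 : Tendsto (fun s : ℝ => (t + s) • x) (𝓝[≠] 0) (𝓝 (t • x)) :=
    Tendsto.mono_left (Continuous.tendsto' (by fun_prop) _ _ (by simp)) nhdsWithin_le_nhds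
  have h3 := S.tendsto_locAd (S.smul_mem hx ht) h2 hα
  have h4 := Tendsto.add h1 h3
  rw [← S.locAdCLM_apply (S.smul_mem hx ht), ← S.locAdCLM_apply (S.smul_mem hx ht), ← map_add,
    S.locAdCLM_apply] at h4
  refine h4.congr' ?_
  filter_upwards [h2.eventually (S.isOpen_U.mem_nhds (S.smul_mem hx ht))] with s hs
  rw [← S.locAdCLM_apply hs, ← S.locAdCLM_apply hs, ← S.locAdCLM_apply hs, map_smul, map_sub,
    ← smul_add]
  congr 1
  abel

/-- The adjoint flow is the only solution of the linear differential equation `α' = [x, α]`. -/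
theorem eq_locAd {x : 𝔤} (hx : x ∈ U) {α : ℝ → 𝔤}
    (hα : ∀ t ∈ Icc (0 : ℝ) 1, HasSlope α ⁅x, α t⁆ t) : α 1 = locAd d x (α 0) := by
  have h1 : ∀ t ∈ Icc (0 : ℝ) 1, HasSlope (fun t : ℝ => locAd d (t • -x) (α t)) 0 t := by
    intro t ht
    have ht' : |t| ≤ 1 := by rw [abs_of_nonneg ht.1]; exact ht.2
    have h2 := S.hasSlope_locAd_curve (S.neg_mem hx) ht' (hα t ht)
    rwa [neg_lie, neg_add_cancel, ← S.locAdCLM_apply (S.smul_mem (S.neg_mem hx) ht'),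
      map_zero] at h2
  have h3 := HasSlope.eq_of_zero h1
  simp only [one_smul, zero_smul, S.locAd_zero] at h3
  rw [← h3, S.locAd_locAd_neg hx]

/-- `t ↦ t κ(tx) a`, with `κ` the logarithmic derivative, is a primitive of `t ↦ Ad(-tx) a`. This
rests on the cocycle identity `(t+s) κ((t+s)x) = Ad(-tx) (s κ(sx)) + t κ(tx)`. -/
theorem hasSlope_leftLogDeriv {x : 𝔤} (hx : x ∈ U) (a : 𝔤) {t : ℝ} (ht : |t| ≤ 1) :
    HasSlope (fun t : ℝ => t • leftLogDeriv d (t • x) a) (locAd d (-(t • x)) a) t := by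
  obtain ⟨r, hr, hrx⟩ := S.exists_smul_mem hx
  have hr0 : 0 < r := by linarith
  have key : ∀ s : ℝ, |s| ≤ r → |t + s| ≤ r → (t + s) • leftLogDeriv d ((t + s) • x) a =
      locAd d (-(t • x)) (s • leftLogDeriv d (s • x) a) + t • leftLogDeriv d (t • x) a := by
    intro s hs hts
    have htr : |t| ≤ r := by linarith
    have E (p q : ℝ) (hp : |p| ≤ r) (hq : |q| ≤ r) (hpq : |p + q| ≤ r) :=
      S.smul_mem_mul hr0 hrx hp hq hpq
    -- velocity of `σ ↦ (-px) * p(x + σa)`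
    have vel (p : ℝ) (hp : |p| ≤ r) : HasSlope (fun σ : ℝ => m (-(p • x), p • (x + σ • a)))
        (p • leftLogDeriv d (p • x) a) 0 := by
      have h0 := (E (-p) p (by rwa [abs_neg]) hp (by simpa using hr0.le))
      have hpx : p • x ∈ U := S.snd_mem h0.1
      have h1 : HasSlope (fun σ : ℝ => p • (x + σ • a)) (p • a) 0 :=
        (hasSlope_line x a 0).map (p • ContinuousLinearMap.id ℝ 𝔤)
      have h2 := S.hasSlope_mul (a := fun _ => -(p • x)) (t := 0)
        (by simpa using h0.1) (hasSlope_const _ 0) h1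
      simp only [zero_smul, add_zero] at h2
      rw [← S.leftLogDerivCLM_apply hpx, ← map_smul]
      exact h2
    have hlim (p : ℝ) : Tendsto (fun σ : ℝ => p • (x + (0 + σ) • a)) (𝓝 0) (𝓝 (p • x)) :=
      Continuous.tendsto' (by fun_prop) _ _ (by simp)
    have hr' : ∀ᶠ σ : ℝ in 𝓝 0, r • (x + (0 + σ) • a) ∈ U :=
      (hlim r).eventually (S.isOpen_U.mem_nhds hrx)
    have d1 := E (-t) t (by rwa [abs_neg]) htr (by simpa using hr0.le)
    have d2 := E (-(t + s)) s (by rwa [abs_neg]) hs (by simpa using htr)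
    have d3 := E s t hs htr (by rwa [add_comm])
    have d4 := E (-t) (-s) (by rwa [abs_neg]) (by rwa [abs_neg])
      (by rw [← neg_add, abs_neg]; exact hts)
    have d5 := E (-s) s (by rwa [abs_neg]) hs (by simpa using hr0.le)
    have e2 : -(t + s) + s = -t := by ring
    have e4 : -t + -s = -(t + s) := by ring
    rw [e2] at d2
    rw [e4] at d4
    have h6 : HasSlope
        (fun σ : ℝ => m (m (-(t • x), m (-(s • x), s • (x + σ • a))), t • (x + σ • a)))
        (locAd d (-(t • x)) (s • leftLogDeriv d (s • x) a) + t • leftLogDeriv d (t • x) a) 0 := by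
      have htx : -(t • x) ∈ U := by rw [← neg_smul]; exact S.fst_mem d1.1
      have hs0 : m (-(s • x), s • (x + (0 : ℝ) • a)) = 0 := by
        rw [zero_smul, add_zero, ← neg_smul, d5.2, neg_add_cancel, zero_smul]
      have h7 := S.hasSlope_left htx hs0 (vel s hs)
      have h8 : HasSlope (fun σ : ℝ => t • (x + σ • a)) (t • a) 0 :=
        (hasSlope_line x a 0).map (t • ContinuousLinearMap.id ℝ 𝔤)
      have h9 : (-(t • x), t • x) ∈ D := by simpa using d1.1
      have h10 := S.hasSlope_mul (t := 0) (by
        rw [hs0, S.mul_zero htx, zero_smul, add_zero]; exact h9) h7 h8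
      rw [hs0, S.mul_zero htx, zero_smul, add_zero, S.deriv_add h9] at h10
      have h11 : (d 1 (-(t • x), t • x) fun _ => (0, t • a)) = t • leftLogDeriv d (t • x) a := by
        rw [← S.leftLogDerivCLM_apply (S.snd_mem h9), ← map_smul]
        rfl
      rw [h11] at h10
      rw [locAd, neg_neg]
      exact h10
    refine (vel (t + s) hts).unique (h6.congr' ?_)
    have a1 := S.eventually_assoc d2.1 d3.1 (by rw [d2.2]; exact d1.1)
      (tendsto_const_nhds (x := -(t + s) • x)) (hlim s) (hlim t)
    have a2 := S.eventually_assoc d4.1 d5.1 (by rw [d4.2]; exact d2.1)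
      (tendsto_const_nhds (x := -t • x)) (tendsto_const_nhds (x := -s • x)) (hlim s)
    filter_upwards [hr', a1, a2] with σ h12 a1 a2
    rw [d4.2] at a2
    have h13 := (S.smul_mem_mul hr0 h12 hs htr (by rwa [add_comm])).2
    rw [← neg_smul, ← neg_smul, ← a2, a1, h13, ← neg_smul, add_comm s t]
  have h1 : ∀ᶠ s : ℝ in 𝓝 0, |s| < r - 1 ∧ |s| < r := by
    have : Tendsto (fun s : ℝ => |s|) (𝓝 0) (𝓝 0) := Continuous.tendsto' (by fun_prop) _ _ (by simp)
    exact (this.eventually (gt_mem_nhds (by linarith))).and (this.eventually (gt_mem_nhds hr0))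
  have htx : -(t • x) ∈ U := S.neg_mem (S.smul_mem hx ht)
  have h2 : Tendsto (fun s : ℝ => leftLogDeriv d (s • x) a) (𝓝[≠] 0) (𝓝 a) := by
    have h3 : Tendsto (fun s : ℝ => s • x) (𝓝[≠] 0) (𝓝 0) :=
      Tendsto.mono_left (Continuous.tendsto' (by fun_prop) _ _ (by simp)) nhdsWithin_le_nhds
    have h4 := S.smooth.tendsto_deriv S.isOpen_D (S.neg_mul S.zero_mem).1
      (h3.neg.prodMk_nhds h3) (tendsto_const_nhds (x := ((0 : 𝔤), a)))
    rw [neg_zero] at h4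
    rwa [S.deriv_right_zero S.zero_mem] at h4
  have h5 := ((S.locAdCLM htx).continuous.tendsto a).comp h2
  refine h5.congr' ?_
  filter_upwards [h1.filter_mono nhdsWithin_le_nhds, self_mem_nhdsWithin] with s hs hs0
  have hs0' : s ≠ 0 := hs0
  have h6 := key s hs.2.le ((abs_add_le t s).trans (by linarith))
  rw [h6, add_sub_cancel_right, ← S.locAdCLM_apply htx, map_smul, smul_smul,
    inv_mul_cancel₀ hs0', one_smul]
  rfl

end IsLocExpGroup
end LocalGroup

/-! ### Commuting elements of a local group -/

lemma abs_le_one_of_mem_Icc {t : ℝ} (ht : t ∈ Icc (0 : ℝ) 1) : |t| ≤ 1 := by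
  rw [abs_of_nonneg ht.1]; exact ht.2

section LocalGroup

variable {𝔤 : Type*} [LieRing 𝔤] [LieAlgebra ℝ 𝔤] [TopologicalSpace 𝔤] [LocallyConvexLieAlgebra 𝔤]

/-- The continuous linear map `ad v`. -/
def adCLM (v : 𝔤) : 𝔤 →L[ℝ] 𝔤 where
  toFun x := ⁅v, x⁆
  map_add' := lie_add v
  map_smul' c x := lie_smul c v x
  cont := continuous_lie_left v

namespace IsLocExpGroup

variable {U : Set 𝔤} {D : Set (𝔤 × 𝔤)} {m : 𝔤 × 𝔤 → 𝔤}
  {d : (k : ℕ) → 𝔤 × 𝔤 → (Fin k → 𝔤 × 𝔤) → 𝔤} (S : IsLocExpGroup U D m d)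
include S

/-- Together with the injectivity of `leftLogDeriv d x`, this shows that the kernel of
`Ad(x) - 1` is not larger than the kernel of `ad x`. -/
lemma leftLogDeriv_lie {x : 𝔤} (hx : x ∈ U) (a : 𝔤) :
    leftLogDeriv d x ⁅x, a⁆ = a - locAd d (-x) a := by
  have h1 : ∀ t ∈ Icc (0 : ℝ) 1, HasSlope
      (fun t : ℝ => t • leftLogDeriv d (t • x) ⁅x, a⁆ + locAd d (t • -x) a) 0 t := by
    intro t ht
    have ht' : |t| ≤ 1 := by rw [abs_of_nonneg ht.1]; exact ht.2
    have h2 := (S.hasSlope_leftLogDeriv hx ⁅x, a⁆ ht').add (S.hasSlope_locAd (S.neg_mem hx) a ht')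
    rwa [S.lie_locAd (S.neg_mem hx) a ht', neg_lie, smul_neg,
      ← S.locAdCLM_apply (S.neg_mem (S.smul_mem hx ht')),
      ← S.locAdCLM_apply (S.neg_mem (S.smul_mem hx ht')), map_neg, add_neg_cancel] at h2
  have h2 := HasSlope.eq_of_zero h1
  simp only [one_smul, zero_smul, zero_add, S.locAd_zero] at h2
  exact eq_sub_of_add_eq h2

/-- On the domain of exponential coordinates the group element `x` commutes only with the elements
with which the vector `x` commutes. -/
lemma lie_eq_zero_of_locAd {x a : 𝔤} (hx : x ∈ U) (h : locAd d x a = a) : ⁅x, a⁆ = 0 := by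
  refine S.leftLogDeriv_injective hx ?_
  have h1 := S.locAd_neg_locAd hx a
  rw [h] at h1
  rw [S.leftLogDeriv_lie hx, h1, sub_self]

lemma locAd_eq_self {x a : 𝔤} (hx : x ∈ U) (h : ⁅x, a⁆ = 0) : locAd d x a = a := by
  refine (S.eq_locAd hx (α := fun _ => a) fun t _ => ?_).symm
  rw [h]
  exact hasSlope_const a t

lemma lie_locAd_of_comm {v k : 𝔤} (hk : k ∈ U) (h : ⁅v, k⁆ = 0) (a : 𝔤) :
    ⁅v, locAd d k a⁆ = locAd d k ⁅v, a⁆ := by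
  have h1 := S.eq_locAd hk (α := fun t => ⁅v, locAd d (t • k) a⁆) fun t ht => by
    have h2 := (S.hasSlope_locAd hk a (abs_le_one_of_mem_Icc ht)).map (adCLM v)
    have h3 : ⁅k, ⁅v, locAd d (t • k) a⁆⁆ = ⁅v, ⁅k, locAd d (t • k) a⁆⁆ := by
      rw [leibniz_lie v k, h, zero_lie, zero_add]
    rw [h3]
    exact h2
  simpa [S.locAd_zero] using h1

lemma lie_leftLogDeriv {v k : 𝔤} (hk : k ∈ U) (h : ⁅v, k⁆ = 0) (a : 𝔤) :
    ⁅v, leftLogDeriv d k a⁆ = leftLogDeriv d k ⁅v, a⁆ := by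
  have h1 := HasSlope.eq_of_zero (c := fun t : ℝ => ⁅v, t • leftLogDeriv d (t • k) a⁆ -
      t • leftLogDeriv d (t • k) ⁅v, a⁆) fun t ht => by
    have h2 := ((S.hasSlope_leftLogDeriv hk a (abs_le_one_of_mem_Icc ht)).map (adCLM v)).sub
      (S.hasSlope_leftLogDeriv hk ⁅v, a⁆ (abs_le_one_of_mem_Icc ht))
    have h3 : adCLM v (locAd d (-(t • k)) a) - locAd d (-(t • k)) ⁅v, a⁆ = 0 := by
      have h4 := S.lie_locAd_of_comm (v := v) (S.neg_mem (S.smul_mem hk (abs_le_one_of_mem_Icc ht)))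
        (by rw [lie_neg, lie_smul, h, smul_zero, neg_zero]) a
      rw [← h4]
      exact sub_self _
    rwa [h3] at h2
  simpa [sub_eq_zero] using h1

/-- Elements which commute with `v` have commuting left translates. -/
lemma lie_leftDeriv_eq_zero {v k a : 𝔤} (hk : k ∈ U) (h : ⁅v, k⁆ = 0) (ha : ⁅v, a⁆ = 0) :
    ⁅v, leftDeriv d k a⁆ = 0 := by
  refine S.leftLogDeriv_injective hk ?_
  rw [← S.lie_leftLogDeriv hk h, S.leftLogDeriv_leftDeriv hk, ha]

lemma locAd_add {v k a : 𝔤} (hk : k ∈ U) (hvk : v + k ∈ U) (h : ⁅v, k⁆ = 0) (ha : ⁅v, a⁆ = 0) :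
    locAd d (v + k) a = locAd d k a := by
  have h1 := S.eq_locAd hvk (α := fun t => locAd d (t • k) a) fun t ht => by
    have h2 := S.lie_locAd_of_comm (v := v) (S.smul_mem hk (abs_le_one_of_mem_Icc ht))
      (by rw [lie_smul, h, smul_zero]) a
    rw [ha, ← S.locAdCLM_apply (S.smul_mem hk (abs_le_one_of_mem_Icc ht)) 0, map_zero] at h2
    rw [add_lie, h2, zero_add]
    exact S.hasSlope_locAd hk a (abs_le_one_of_mem_Icc ht)
  simpa [S.locAd_zero] using h1.symm

lemma leftLogDeriv_add {v k a : 𝔤} (hk : k ∈ U) (hvk : v + k ∈ U) (h : ⁅v, k⁆ = 0)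
    (ha : ⁅v, a⁆ = 0) : leftLogDeriv d (v + k) a = leftLogDeriv d k a := by
  have h1 := HasSlope.eq_of_zero (c := fun t : ℝ => t • leftLogDeriv d (t • (v + k)) a -
      t • leftLogDeriv d (t • k) a) fun t ht => by
    have h2 := (S.hasSlope_leftLogDeriv hvk a (abs_le_one_of_mem_Icc ht)).sub
      (S.hasSlope_leftLogDeriv hk a (abs_le_one_of_mem_Icc ht))
    have h3 := S.smul_mem hvk (abs_le_one_of_mem_Icc ht)
    rw [smul_add] at h3
    have h4 := S.locAd_add (S.neg_mem (S.smul_mem hk (abs_le_one_of_mem_Icc ht)))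
      (v := -(t • v)) (a := a) (by rw [← neg_add]; exact S.neg_mem h3)
      (by simp [h]) (by simp [ha])
    rwa [smul_add, neg_add, h4, sub_self] at h2
  simpa [sub_eq_zero] using h1

lemma lie_mul_eq_zero {v x y : 𝔤} (h : (x, y) ∈ D) (hx : ⁅v, x⁆ = 0) (hy : ⁅v, y⁆ = 0) :
    ⁅v, m (x, y)⁆ = 0 := by
  rw [← lie_skew, neg_eq_zero]
  refine S.lie_eq_zero_of_locAd (S.mul_mem h) ?_
  rw [S.locAd_mul h, S.locAd_eq_self (S.snd_mem h), S.locAd_eq_self (S.fst_mem h)]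
  · rw [← lie_skew, hx, neg_zero]
  · rw [← lie_skew, hy, neg_zero]

/-- A curve with constant left logarithmic derivative `η` is a translate of the one-parameter group
of `η`. -/
theorem eq_mul_of_leftLogDeriv {g g' : ℝ → 𝔤} {η : 𝔤} (hη : η ∈ U)
    (hD : ∀ t ∈ Icc (0 : ℝ) 1, (g t, -(t • η)) ∈ D)
    (hg : ∀ t ∈ Icc (0 : ℝ) 1, HasSlope g (g' t) t)
    (hlog : ∀ t ∈ Icc (0 : ℝ) 1, leftLogDeriv d (g t) (g' t) = η) : g 1 = m (g 0, η) := by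
  have h1 := HasSlope.eq_of_zero (c := fun t : ℝ => m (g t, -(t • η))) fun t ht => by
    have hgt : g t ∈ U := S.fst_mem (hD t ht)
    have ht' := abs_le_one_of_mem_Icc ht
    have hn := S.neg_mul hgt
    rw [hasSlope_iff_zero]
    have hgs : HasSlope (fun s => g (t + s)) (g' t) 0 := hasSlope_iff_zero.1 (hg t ht)
    have hk0 : m (-g t, g (t + 0)) = 0 := by rw [add_zero, hn.2]
    have hk : HasSlope (fun s => m (-g t, g (t + s))) η 0 := by
      have := S.hasSlope_mul (t := 0) (by rw [add_zero]; exact hn.1) (hasSlope_const (-g t) 0) hgs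
      rw [add_zero] at this
      rwa [← hlog t ht]
    have hneg : HasSlope (fun s : ℝ => -(s • η)) (-η) 0 := by
      simpa using (hasSlope_smul_const η 0).map (-ContinuousLinearMap.id ℝ 𝔤)
    have hl : HasSlope (fun s => m (m (-g t, g (t + s)), -(s • η))) 0 0 := by
      have := S.hasSlope_mul (t := 0) (by rw [hk0]; simpa using S.mem_zero S.zero_mem) hk hneg
      rw [hk0, zero_smul, neg_zero, S.deriv_add (S.mem_zero S.zero_mem),
        S.deriv_left_zero S.zero_mem, S.deriv_right_zero S.zero_mem, add_neg_cancel] at this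
      exact this
    have hl0 : m (m (-g t, g (t + 0)), -((0 : ℝ) • η)) = 0 := by
      rw [hk0, zero_smul, neg_zero, S.mul_zero S.zero_mem]
    have hgl := S.hasSlope_left hgt hl0 hl
    rw [← S.leftDerivCLM_apply hgt, map_zero] at hgl
    have hfin := S.hasSlope_mul (b := fun _ => -(t • η)) (t := 0)
      (by rw [hl0, S.mul_zero hgt]; exact hD t ht) hgl (hasSlope_const _ 0)
    rw [← Prod.zero_eq_mk, hl0, S.mul_zero hgt, ← S.smooth.clm_apply S.isOpen_D (hD t ht),
      map_zero] at hfin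
    refine hfin.congr' ?_
    have l0 : Tendsto (fun s : ℝ => 0 + s) (𝓝 0) (𝓝 0) :=
      Continuous.tendsto' (by fun_prop) _ _ (by simp)
    have l1 : Tendsto (fun s => g (t + (0 + s))) (𝓝 0) (𝓝 (g t)) :=
      (tendsto_of_hasSlope (hg t ht)).comp l0
    have l2 : Tendsto (fun s => m (-g t, g (t + (0 + s)))) (𝓝 0) (𝓝 0) := by
      have := S.tendsto_mul hn.1 (tendsto_const_nhds (x := -g t)) l1
      rwa [hn.2] at this
    have l3 : Tendsto (fun s : ℝ => -((0 + s) • η)) (𝓝 0) (𝓝 0) :=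
      Continuous.tendsto' (by fun_prop) _ _ (by simp)
    have e1 := S.eventually_assoc (S.mul_neg hgt).1 hn.1
      (by rw [(S.mul_neg hgt).2]; exact S.zero_mem' hgt)
      (tendsto_const_nhds (x := g t)) (tendsto_const_nhds (x := -g t)) l1
    have e2 := S.eventually_assoc (S.mem_zero hgt) (S.mem_zero S.zero_mem)
      (by rw [S.mul_zero hgt]; exact S.mem_zero hgt) (tendsto_const_nhds (x := g t)) l2 l3
    have htη : -(t • η) ∈ U := S.snd_mem (hD t ht)
    have e3 := S.eventually_assoc (S.mem_zero hgt) (S.zero_mem' htη)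
      (by rw [S.mul_zero hgt]; exact hD t ht) l1 l3 (tendsto_const_nhds (x := -(t • η)))
    have e4 := l0.eventually (S.eventually_smul_mul (S.neg_mem hη) ht')
    have e5 := l1.eventually (S.isOpen_U.mem_nhds hgt)
    filter_upwards [e1, e2, e3, e4, e5] with s e1 e2 e3 e4 e5
    have e6 := e4.2.2
    rw [smul_neg, smul_neg, smul_neg] at e6
    rw [(S.mul_neg hgt).2, S.zero_mul e5] at e1
    rw [← e2, ← e1, e3, e6]
  simp only [one_smul, zero_smul, neg_zero] at h1
  have h0 := hD 0 ⟨le_rfl, zero_le_one⟩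
  have h2 := hD 1 ⟨zero_le_one, le_rfl⟩
  rw [zero_smul, neg_zero] at h0
  rw [one_smul] at h2
  rw [S.mul_zero (S.fst_mem h0)] at h1
  have h3 := (S.mul_neg_cancel h2).2
  rw [neg_neg, h1] at h3
  exact h3.symm

/-- The curve `t ↦ f * (t η)` is an integral curve of the left invariant vector field of `η`. -/
lemma hasSlope_mul_smul {f η : 𝔤} (hη : η ∈ U) {t : ℝ} (ht : |t| ≤ 1) (h : (f, t • η) ∈ D) :
    HasSlope (fun t : ℝ => m (f, t • η)) (leftDeriv d (m (f, t • η)) η) t := by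
  rw [hasSlope_iff_zero]
  have hm := S.mul_mem h
  refine (S.hasSlope_left hm (zero_smul ℝ η) (hasSlope_smul_const η 0)).congr' ?_
  have l4 : Tendsto (fun s : ℝ => (0 + s) • η) (𝓝 0) (𝓝 0) :=
    Continuous.tendsto' (by fun_prop) _ _ (by simp)
  have l0 : Tendsto (fun s : ℝ => 0 + s) (𝓝 0) (𝓝 0) :=
    Continuous.tendsto' (by fun_prop) _ _ (by simp)
  filter_upwards [S.eventually_assoc h (S.mem_zero (S.snd_mem h)) (S.mem_zero hm)
    tendsto_const_nhds tendsto_const_nhds l4,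
    l0.eventually (S.eventually_smul_mul hη ht)] with s e1 e2
  rw [e1, e2.1.2]

/-- If `v` commutes with `f`, then addition of `v` commutes with the right translation by small `η`
commuting with `v`: both curves `t ↦ v + f * tη` and `t ↦ (v + f) * tη` have the logarithmic
derivative `η`. -/
lemma eventually_mul_add {v f : 𝔤} (hf : f ∈ U) (hvf : v + f ∈ U) (h : ⁅v, f⁆ = 0) :
    ∀ᶠ η in 𝓝 (0 : 𝔤), ⁅v, η⁆ = 0 → m (v + f, η) = v + m (f, η) := by
  have l1 : Tendsto (fun η : 𝔤 => m (f, η)) (𝓝 0) (𝓝 f) := by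
    have := S.tendsto_mul (S.mem_zero hf) tendsto_const_nhds (tendsto_id (x := 𝓝 (0 : 𝔤)))
    rwa [S.mul_zero hf] at this
  have l2 : Tendsto (fun η : 𝔤 => v + m (f, η)) (𝓝 0) (𝓝 (v + f)) := l1.const_add v
  have l3 : Tendsto (fun η : 𝔤 => -η) (𝓝 0) (𝓝 0) :=
    Continuous.tendsto' (by fun_prop) _ _ (by simp)
  have e : ∀ᶠ η in 𝓝 (0 : 𝔤), η ∈ U ∧ (f, η) ∈ D ∧ (v + m (f, η), -η) ∈ D :=
    (S.isOpen_U.eventually_mem S.zero_mem).and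
      ((S.eventually_mem (S.mem_zero hf) tendsto_const_nhds tendsto_id).and
        (S.eventually_mem (S.mem_zero hvf) l2 l3))
  obtain ⟨N, ⟨hN, hNb⟩, hNe⟩ := (nhds_basis_balanced ℝ 𝔤).mem_iff.1 e
  filter_upwards [hN] with η hη hvη
  have hb : ∀ t ∈ Icc (0 : ℝ) 1, t • η ∈ U ∧ (f, t • η) ∈ D ∧ (v + m (f, t • η), -(t • η)) ∈ D :=
    fun t ht => hNe (hNb.smul_mem (by simpa using abs_le_one_of_mem_Icc ht) hη)
  have h1 := S.eq_mul_of_leftLogDeriv (g := fun t => v + m (f, t • η))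
    (g' := fun t => leftDeriv d (m (f, t • η)) η) (η := η) (hNe hη).1
    (fun t ht => (hb t ht).2.2) (fun t ht => by
      have h2 := S.hasSlope_mul_smul (hNe hη).1 (abs_le_one_of_mem_Icc ht) (hb t ht).2.1
      simpa using (hasSlope_const v t).add h2)
    (fun t ht => by
      have hm := S.mul_mem (hb t ht).2.1
      have hvm : ⁅v, m (f, t • η)⁆ = 0 :=
        S.lie_mul_eq_zero (hb t ht).2.1 h (by rw [lie_smul, hvη, smul_zero])
      rw [S.leftLogDeriv_add hm (S.fst_mem (hb t ht).2.2) hvm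
        (S.lie_leftDeriv_eq_zero hm hvm hvη), S.leftLogDeriv_leftDeriv hm])
  simp only [one_smul, zero_smul, S.mul_zero hf] at h1
  exact h1.symm

/-- If `v = a * b⁻¹` commutes with all points of a connected set containing `0` and `b`, on which
the right translations of `a` and `b` are defined, then `a = v + b`. Indeed, the set of points `ρ`
for which `a * ρ⁻¹ = v + b * ρ⁻¹` is open, closed and contains `b`. -/
theorem eq_add_of_comm {a b : 𝔤} {C : Set 𝔤} (hC : IsPreconnected C) (h0 : (0 : 𝔤) ∈ C) (hb : b ∈ C)
    (haD : ∀ ρ ∈ C, (a, -ρ) ∈ D) (hbD : ∀ ρ ∈ C, (b, -ρ) ∈ D)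
    (hD : ∀ ρ ∈ C, ∀ σ ∈ C, (ρ, -σ) ∈ D)
    (hv : ∀ ρ ∈ C, ⁅m (a, -b), ρ⁆ = 0) : a = m (a, -b) + b := by
  set v := m (a, -b) with hvdef
  have hbU : b ∈ U := S.fst_mem (hbD b hb)
  set A : Set C := {ρ | m (a, -ρ.1) = v + m (b, -ρ.1)} with hA
  have hcont (x : 𝔤) (hx : ∀ ρ ∈ C, (x, -ρ) ∈ D) : Continuous fun ρ : C => m (x, -ρ.1) := by
    rw [continuous_iff_continuousAt]
    intro ρ
    exact S.tendsto_mul (hx ρ.1 ρ.2) tendsto_const_nhds (continuous_subtype_val.neg.tendsto ρ)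
  have hclosed : IsClosed A := isClosed_eq (hcont a haD) (continuous_const.add (hcont b hbD))
  have hopen : IsOpen A := by
    rw [isOpen_iff_mem_nhds]
    intro ρ₀ hρ₀
    have hρ₀' : m (a, -ρ₀.1) = v + m (b, -ρ₀.1) := hρ₀
    have hρU : ρ₀.1 ∈ U := S.fst_mem (hD _ ρ₀.2 _ ρ₀.2)
    have h1 : Tendsto (fun ρ : C => m (ρ₀.1, -ρ.1)) (𝓝 ρ₀) (𝓝 0) := by
      have := (hcont ρ₀.1 (hD _ ρ₀.2)).tendsto ρ₀
      rwa [(S.mul_neg hρU).2] at this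
    have hvf : ⁅v, m (b, -ρ₀.1)⁆ = 0 :=
      S.lie_mul_eq_zero (hbD _ ρ₀.2) (hv b hb) (by rw [lie_neg, hv _ ρ₀.2, neg_zero])
    have h2 := h1.eventually (S.eventually_mul_add (S.mul_mem (hbD _ ρ₀.2))
      (by rw [← hρ₀']; exact S.mul_mem (haD _ ρ₀.2)) hvf)
    filter_upwards [h2] with ρ h3
    have h4 := h3 (S.lie_mul_eq_zero (hD _ ρ₀.2 _ ρ.2) (hv _ ρ₀.2) (by
      rw [lie_neg, hv _ ρ.2, neg_zero]))
    have h5 := S.neg_mul_cancel (hD _ ρ₀.2 _ ρ.2)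
    have key (x : 𝔤) (hx : ∀ ρ ∈ C, (x, -ρ) ∈ D) :
        m (m (x, -ρ₀.1), m (ρ₀.1, -ρ.1)) = m (x, -ρ.1) := by
      have h6 := S.assoc_right (hx _ ρ₀.2) h5.1 (by rw [h5.2]; exact hx _ ρ.2)
      rw [h6.2, h5.2]
    rw [← hρ₀', key a haD, key b hbD] at h4
    exact h4
  have : PreconnectedSpace C := isPreconnected_iff_preconnectedSpace.1 hC
  have huniv : A = univ := IsClopen.eq_univ ⟨hclosed, hopen⟩
    ⟨⟨b, hb⟩, by
      change m (a, -b) = v + m (b, -b)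
      rw [(S.mul_neg hbU).2, add_zero]⟩
  have h7 : (⟨0, h0⟩ : C) ∈ A := huniv ▸ mem_univ _
  have h8 : m (a, -(0 : 𝔤)) = v + m (b, -(0 : 𝔤)) := h7
  rwa [neg_zero, S.mul_zero (S.fst_mem (haD b hb)), S.mul_zero hbU] at h8

end IsLocExpGroup
end LocalGroup

/-! ### The adjoint action of a locally exponential Lie group -/

namespace HasSmoothDerivs

variable {E : Type*} [AddCommGroup E] [Module ℝ E] [TopologicalSpace E] [IsTopologicalAddGroup E]
  [ContinuousSMul ℝ E] [LocallyConvexSpace ℝ E] [T2Space E] {μ : E × E → E} {Ω : Set (E × E)}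
  {d : (k : ℕ) → E × E → (Fin k → E × E) → E}

/-- The derivative of a local group multiplication at the unit is the addition. -/
lemma deriv_unit (h : HasSmoothDerivs μ Ω d) (hΩ : IsOpen Ω) {c : E} (hc : (c, c) ∈ Ω)
    (hl : ∀ᶠ x in 𝓝 c, μ (c, x) = x) (hr : ∀ᶠ x in 𝓝 c, μ (x, c) = x) (v w : E) :
    (d 1 (c, c) fun _ => (v, w)) = v + w := by
  have line (v : E) : Tendsto (fun t : ℝ => c + (0 + t) • v) (𝓝 0) (𝓝 c) :=
    Continuous.tendsto' (by fun_prop) _ _ (by simp)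
  have h1 := h.hasSlope_comp hΩ (c := fun t : ℝ => (c + t • v, c)) (t := 0) (by simpa using hc)
    ((hasSlope_line c v 0).prodMk (hasSlope_const c 0))
  have h2 := h.hasSlope_comp hΩ (c := fun t : ℝ => (c, c + t • w)) (t := 0) (by simpa using hc)
    ((hasSlope_const c 0).prodMk (hasSlope_line c w 0))
  simp only [zero_smul, add_zero] at h1 h2
  have h3 := h1.unique ((hasSlope_line c v 0).congr' (by
    filter_upwards [(line v).eventually hr] with t ht using ht.symm))
  have h4 := h2.unique ((hasSlope_line c w 0).congr' (by
    filter_upwards [(line w).eventually hl] with t ht using ht.symm))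
  have h5 := (h.clm hΩ hc).map_add (v, 0) (0, w)
  simp only [clm_apply, Prod.mk_add_mk, add_zero, zero_add] at h5
  rw [h5, h3, h4]

end HasSmoothDerivs

namespace LocExpLieGroup

variable {𝔨 : Type u} [LieRing 𝔨] [LieAlgebra ℝ 𝔨] [TopologicalSpace 𝔨]
  (G : LocExpLieGroup 𝔨)

/-- The chart at the identity. -/
abbrev chart : OpenPartialHomeomorph G.H G.E := chartAt G.E (1 : G.H)

/-- The multiplication in the chart at the identity. -/
def chartMul (z : G.E × G.E) : G.E := G.chart (G.chart.symm z.1 * G.chart.symm z.2)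

/-- The domain of `chartMul`. -/
def chartDomain : Set (G.E × G.E) :=
  {z | z.1 ∈ G.chart.target ∧ z.2 ∈ G.chart.target ∧
    G.chart.symm z.1 * G.chart.symm z.2 ∈ G.chart.source}

lemma continuous_mul : Continuous fun z : G.H × G.H => z.1 * z.2 := G.isLCLieGroup.continuous_mul

lemma isOpen_chartDomain : IsOpen G.chartDomain := by
  have h1 : ContinuousOn (fun z : G.E × G.E => G.chart.symm z.1 * G.chart.symm z.2)
      (G.chart.target ×ˢ G.chart.target) := by
    refine G.isLCLieGroup.continuous_mul.comp_continuousOn (ContinuousOn.prodMk ?_ ?_)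
    · exact G.chart.continuousOn_symm.comp continuousOn_fst fun z hz => hz.1
    · exact G.chart.continuousOn_symm.comp continuousOn_snd fun z hz => hz.2
  have h2 := h1.isOpen_inter_preimage (G.chart.open_target.prod G.chart.open_target)
    G.chart.open_source
  convert h2 using 1
  ext z
  simp [chartDomain, and_assoc]

lemma one_mem_source : (1 : G.H) ∈ G.chart.source := mem_chart_source _ _

lemma mem_chartDomain {g k : G.H} (hg : g ∈ G.chart.source) (hk : k ∈ G.chart.source)
    (hgk : g * k ∈ G.chart.source) : (G.chart g, G.chart k) ∈ G.chartDomain :=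
  ⟨G.chart.map_source hg, G.chart.map_source hk, by
    simpa [G.chart.left_inv hg, G.chart.left_inv hk] using hgk⟩

lemma chartMul_chart {g k : G.H} (hg : g ∈ G.chart.source) (hk : k ∈ G.chart.source) :
    G.chartMul (G.chart g, G.chart k) = G.chart (g * k) := by
  simp [chartMul, G.chart.left_inv hg, G.chart.left_inv hk]

lemma exists_chartMul_derivs : ∃ d : (k : ℕ) → G.E × G.E → (Fin k → G.E × G.E) → G.E,
    HasSmoothDerivs G.chartMul G.chartDomain d ∧ ∀ x y : G.E, G.iso.symm ⁅G.iso x, G.iso y⁆ =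
      d 2 (G.chart 1, G.chart 1) ![(x, 0), (0, y)] - d 2 (G.chart 1, G.chart 1) ![(y, 0), (0, x)] :=
  G.iso_bracket

/-- The iterated derivatives of the multiplication in the chart at the identity. -/
def chartDerivs : (k : ℕ) → G.E × G.E → (Fin k → G.E × G.E) → G.E :=
  G.exists_chartMul_derivs.choose

lemma smooth_chartMul : HasSmoothDerivs G.chartMul G.chartDomain G.chartDerivs :=
  G.exists_chartMul_derivs.choose_spec.1

lemma lie_eq (x y : G.E) : G.iso.symm ⁅G.iso x, G.iso y⁆ =
    G.chartDerivs 2 (G.chart 1, G.chart 1) ![(x, 0), (0, y)] -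
      G.chartDerivs 2 (G.chart 1, G.chart 1) ![(y, 0), (0, x)] :=
  G.exists_chartMul_derivs.choose_spec.2 x y

lemma one_mem_chartDomain : (G.chart 1, G.chart 1) ∈ G.chartDomain :=
  G.mem_chartDomain G.one_mem_source G.one_mem_source (by simp [G.one_mem_source])

lemma chartMul_one_left : ∀ᶠ x in 𝓝 (G.chart 1), G.chartMul (G.chart 1, x) = x := by
  filter_upwards [G.chart.open_target.mem_nhds (G.chart.map_source G.one_mem_source)] with x hx
  simp [chartMul, G.chart.left_inv G.one_mem_source, G.chart.right_inv hx]

lemma chartMul_one_right : ∀ᶠ x in 𝓝 (G.chart 1), G.chartMul (x, G.chart 1) = x := by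
  filter_upwards [G.chart.open_target.mem_nhds (G.chart.map_source G.one_mem_source)] with x hx
  simp [chartMul, G.chart.left_inv G.one_mem_source, G.chart.right_inv hx]

lemma eventually_source {g : ℝ → G.H} (h : Tendsto g (𝓝 0) (𝓝 1)) :
    ∀ᶠ s in 𝓝 0, g s ∈ G.chart.source :=
  h.eventually (G.chart.open_source.mem_nhds G.one_mem_source)

/-- The curve `g` passes through the identity at time `0` with velocity `a`. -/
structure HasVel (g : ℝ → G.H) (a : 𝔨) : Prop where
  zero : g 0 = 1
  tendsto : Tendsto g (𝓝 0) (𝓝 1)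
  slope : HasSlope (fun s => G.chart (g s)) (G.iso.symm a) 0

lemma HasVel.unique {g : ℝ → G.H} {a b : 𝔨} (ha : G.HasVel g a) (hb : G.HasVel g b) : a = b :=
  G.iso.symm.injective (ha.slope.unique hb.slope)

lemma HasVel.congr {g k : ℝ → G.H} {a : 𝔨} (h : G.HasVel g a) (hgk : g =ᶠ[𝓝 0] k) :
    G.HasVel k a where
  zero := by rw [← hgk.self_of_nhds, h.zero]
  tendsto := h.tendsto.congr' hgk
  slope := h.slope.congr' (by
    filter_upwards [hgk] with s hs
    simp only [zero_add, hs])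

/-- Velocities add under products. -/
lemma HasVel.mul {g k : ℝ → G.H} {a b : 𝔨} (hg : G.HasVel g a) (hk : G.HasVel k b) :
    G.HasVel (fun s => g s * k s) (a + b) where
  zero := by simp [hg.zero, hk.zero]
  tendsto := by
    have := (G.isLCLieGroup.continuous_mul.tendsto (1, 1)).comp (hg.tendsto.prodMk_nhds hk.tendsto)
    simpa [Function.comp_def] using this
  slope := by
    have h1 := G.smooth_chartMul.hasSlope_comp G.isOpen_chartDomain
      (c := fun s => (G.chart (g s), G.chart (k s))) (t := 0)
      (by simpa [hg.zero, hk.zero] using G.one_mem_chartDomain) (hg.slope.prodMk hk.slope)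
    rw [hg.zero, hk.zero, G.smooth_chartMul.deriv_unit G.isOpen_chartDomain G.one_mem_chartDomain
      G.chartMul_one_left G.chartMul_one_right, ← map_add] at h1
    refine h1.congr' ?_
    filter_upwards [G.eventually_source hg.tendsto, G.eventually_source hk.tendsto] with s h2 h3
    rw [zero_add, G.chartMul_chart h2 h3]

/-- Conjugation by `g₀` acts on velocities by `L`. -/
def HasAd (g₀ : G.H) (L : 𝔨 →L[ℝ] 𝔨) : Prop :=
  ∀ g a, G.HasVel g a → G.HasVel (fun s => g₀ * g s * g₀⁻¹) (L a)

variable {G}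

lemma HasAd.mul {g₀ g₁ : G.H} {L M : 𝔨 →L[ℝ] 𝔨} (h₀ : G.HasAd g₀ L) (h₁ : G.HasAd g₁ M) :
    G.HasAd (g₀ * g₁) (L.comp M) := by
  intro g a h
  have := h₀ _ _ (h₁ g a h)
  simpa [mul_assoc] using this

variable (G) in
lemma hasAd_one : G.HasAd 1 (ContinuousLinearMap.id ℝ 𝔨) := by
  intro g a h
  simpa using h

variable (G) in
lemma exp_zero : G.exp 0 = 1 := by
  have := G.exp_add 0 0 0
  simpa using this

variable (G) in
lemma exp_neg (x : 𝔨) : G.exp (-x) = (G.exp x)⁻¹ := by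
  have := G.exp_add x 1 (-1)
  rw [add_neg_cancel, zero_smul, G.exp_zero, one_smul, neg_smul, one_smul] at this
  exact eq_inv_of_mul_eq_one_right this.symm

variable [LocallyConvexLieAlgebra 𝔨]

variable (G) in
lemma hasVel_exp (x : 𝔨) : G.HasVel (fun s => G.exp (s • x)) x where
  zero := by simp [G.exp_zero]
  tendsto := by
    have : Continuous fun s : ℝ => G.exp (s • x) := G.exp_continuous.comp (by fun_prop)
    simpa [G.exp_zero] using this.tendsto 0
  slope := by
    have := G.exp_deriv x
    simpa [HasSlope, G.exp_zero] using this

lemma HasAd.unique {g₀ : G.H} {L M : 𝔨 →L[ℝ] 𝔨} (h : G.HasAd g₀ L) (h' : G.HasAd g₀ M) : L = M := by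
  ext a
  exact HasVel.unique G (h _ a (G.hasVel_exp a)) (h' _ a (G.hasVel_exp a))

omit [LocallyConvexLieAlgebra 𝔨] in
variable (G) in
/-- The adjoint action, in the chart, of an element for which the element itself and its inverse
lie in the domain of the chart at the identity. -/
lemma hasAd_of_mem_source {g₀ : G.H} (h : g₀ ∈ G.chart.source) (h' : g₀⁻¹ ∈ G.chart.source) :
    ∃ L : 𝔨 →L[ℝ] 𝔨, G.HasAd g₀ L ∧ ∀ a, G.iso.symm (L a) =
      G.chartDerivs 1 (G.chart g₀, G.chart g₀⁻¹) fun _ =>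
        (G.chartDerivs 1 (G.chart g₀, G.chart 1) fun _ => (0, G.iso.symm a), 0) := by
  have m1 : (G.chart g₀, G.chart 1) ∈ G.chartDomain :=
    G.mem_chartDomain h G.one_mem_source (by simpa using h)
  have m2 : (G.chart g₀, G.chart g₀⁻¹) ∈ G.chartDomain :=
    G.mem_chartDomain h h' (by simp)
  set A := G.smooth_chartMul.clm G.isOpen_chartDomain m1
  set B := G.smooth_chartMul.clm G.isOpen_chartDomain m2
  let L : 𝔨 →L[ℝ] 𝔨 := (G.iso : G.E →L[ℝ] 𝔨).comp ((B.comp (ContinuousLinearMap.inl ℝ G.E G.E)).comp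
    ((A.comp (ContinuousLinearMap.inr ℝ G.E G.E)).comp (G.iso.symm : 𝔨 →L[ℝ] G.E)))
  have hL : ∀ a, G.iso.symm (L a) =
      G.chartDerivs 1 (G.chart g₀, G.chart g₀⁻¹) fun _ =>
        (G.chartDerivs 1 (G.chart g₀, G.chart 1) fun _ => (0, G.iso.symm a), 0) := fun a =>
    G.iso.symm_apply_apply _
  refine ⟨L, fun g a hg => ⟨by simp [hg.zero], ?_, ?_⟩, hL⟩
  · have : Continuous fun k : G.H => g₀ * k * g₀⁻¹ := by
      have c1 : Continuous fun k : G.H => g₀ * k :=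
        G.isLCLieGroup.continuous_mul.comp (continuous_const.prodMk continuous_id)
      exact G.isLCLieGroup.continuous_mul.comp (c1.prodMk continuous_const)
    have h1 := (this.tendsto 1).comp hg.tendsto
    simpa [Function.comp_def] using h1
  · have h1 := G.smooth_chartMul.hasSlope_comp G.isOpen_chartDomain
      (c := fun s => (G.chart g₀, G.chart (g s))) (t := 0)
      (by simpa [hg.zero] using m1) ((hasSlope_const _ 0).prodMk hg.slope)
    rw [hg.zero] at h1
    have h0 : G.chartMul (G.chart g₀, G.chart (g 0)) = G.chart g₀ := by
      rw [hg.zero, G.chartMul_chart h G.one_mem_source, mul_one]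
    have h2 := G.smooth_chartMul.hasSlope_comp G.isOpen_chartDomain
      (c := fun s => (G.chartMul (G.chart g₀, G.chart (g s)), G.chart g₀⁻¹)) (t := 0)
      (by rw [h0]; exact m2) (h1.prodMk (hasSlope_const _ 0))
    rw [h0, ← hL a] at h2
    refine h2.congr' ?_
    have c1 : Continuous fun k : G.H => g₀ * k :=
      G.isLCLieGroup.continuous_mul.comp (continuous_const.prodMk continuous_id)
    have c2 : Tendsto (fun s => g₀ * g s) (𝓝 0) (𝓝 g₀) := by
      simpa [Function.comp_def] using (c1.tendsto 1).comp hg.tendsto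
    filter_upwards [G.eventually_source hg.tendsto,
      c2.eventually (G.chart.open_source.mem_nhds h)] with s e1 e2
    rw [zero_add, G.chartMul_chart h e1, G.chartMul_chart e2 h']

variable (G) in
lemma eventually_exp_mem (x : 𝔨) :
    ∀ᶠ t : ℝ in 𝓝 0, G.exp (t • x) ∈ G.chart.source ∧ (G.exp (t • x))⁻¹ ∈ G.chart.source := by
  have h1 : Continuous fun s : ℝ => G.exp (s • x) := G.exp_continuous.comp (by fun_prop)
  have h2 := G.isLCLieGroup.continuous_inv.comp h1
  exact (G.eventually_source (by simpa [G.exp_zero] using h1.tendsto 0)).and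
    (G.eventually_source (by simpa [Function.comp_def, G.exp_zero] using h2.tendsto 0))

variable (G) in
/-- Every exponential is a power of an exponential in the domain of the chart, so it has an adjoint
action. -/
lemma exists_hasAd_exp (x : 𝔨) : ∃ L, G.HasAd (G.exp x) L := by
  let P : Submonoid G.H :=
    { carrier := {g | ∃ L, G.HasAd g L}
      one_mem' := ⟨_, G.hasAd_one⟩
      mul_mem' := fun ⟨_, h⟩ ⟨_, h'⟩ => ⟨_, h.mul h'⟩ }
  have h1 : ∀ n : ℕ, ∀ y : 𝔨, G.exp ((n : ℝ) • y) = G.exp y ^ n := by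
    intro n y
    induction n with
    | zero => simp [G.exp_zero]
    | succ n ih => rw [Nat.cast_succ, G.exp_add, ih, one_smul, pow_succ]
  have h2 : Tendsto (fun n : ℕ => ((n : ℝ) + 1)⁻¹) atTop (𝓝 0) := by
    simpa using tendsto_one_div_add_atTop_nhds_zero_nat (𝕜 := ℝ)
  obtain ⟨n, hn⟩ := (h2.eventually (G.eventually_exp_mem x)).exists
  have h3 : G.exp (((n : ℝ) + 1)⁻¹ • x) ∈ P := by
    obtain ⟨L, hL, -⟩ := G.hasAd_of_mem_source hn.1 hn.2
    exact ⟨L, hL⟩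
  have h4 := P.pow_mem h3 (n + 1)
  have hn1 : (n : ℝ) + 1 ≠ 0 := by positivity
  rw [← h1, smul_smul, Nat.cast_succ, mul_inv_cancel₀ hn1, one_smul] at h4
  exact h4

open Classical in
variable (G) in
/-- The adjoint action of a group element (`0` by convention if it does not exist; it does for
products of exponentials). -/
def Ad (g : G.H) : 𝔨 →L[ℝ] 𝔨 := if h : ∃ L, G.HasAd g L then h.choose else 0

lemma HasAd.eq {g : G.H} {L : 𝔨 →L[ℝ] 𝔨} (h : G.HasAd g L) : G.Ad g = L := by
  have h' : ∃ L, G.HasAd g L := ⟨L, h⟩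
  rw [Ad, dif_pos h']
  exact h'.choose_spec.unique h

variable (G)

lemma hasAd_exp (x : 𝔨) : G.HasAd (G.exp x) (G.Ad (G.exp x)) := by
  obtain ⟨L, hL⟩ := G.exists_hasAd_exp x
  rwa [hL.eq]

lemma Ad_exp_mul (x y : 𝔨) (a : 𝔨) :
    G.Ad (G.exp x * G.exp y) a = G.Ad (G.exp x) (G.Ad (G.exp y) a) := by
  rw [((G.hasAd_exp x).mul (G.hasAd_exp y)).eq]
  rfl

lemma Ad_exp_zero (a : 𝔨) : G.Ad (G.exp 0) a = a := by
  rw [G.exp_zero, G.hasAd_one.eq]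
  rfl

lemma hasSlope_chart_exp (x : 𝔨) :
    HasSlope (fun t : ℝ => G.chart (G.exp (t • x))) (G.iso.symm x) 0 :=
  (G.hasVel_exp x).slope

/-- The adjoint action solves the differential equation `α' = [x, α]`. -/
theorem hasSlope_Ad (x a : 𝔨) (t : ℝ) :
    HasSlope (fun t : ℝ => G.Ad (G.exp (t • x)) a) ⁅x, G.Ad (G.exp (t • x)) a⁆ t := by
  have key (b : 𝔨) : HasSlope (fun t : ℝ => G.Ad (G.exp (t • x)) b) ⁅x, b⁆ 0 := by
    have h1 := G.smooth_chartMul.hasSlope_conj G.isOpen_chartDomain G.one_mem_chartDomain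
      G.chartMul_one_left G.chartMul_one_right (a := fun t => G.chart (G.exp (t • x)))
      (b := fun t => G.chart (G.exp (t • -x))) (by simp [G.exp_zero]) (by simp [G.exp_zero])
      (G.hasSlope_chart_exp x) (by simpa using G.hasSlope_chart_exp (-x)) (G.iso.symm b)
    rw [← G.lie_eq, G.iso.apply_symm_apply, G.iso.apply_symm_apply] at h1
    have h2 := h1.map (G.iso : G.E →L[ℝ] 𝔨)
    have h3 : (G.iso : G.E →L[ℝ] 𝔨) (G.iso.symm ⁅x, b⁆) = ⁅x, b⁆ := G.iso.apply_symm_apply _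
    rw [h3] at h2
    refine h2.congr' ?_
    filter_upwards [G.eventually_exp_mem x] with t ht
    obtain ⟨L, hL, hL'⟩ := G.hasAd_of_mem_source ht.1 ht.2
    rw [zero_add, hL.eq, smul_neg, G.exp_neg, ← hL']
    exact G.iso.apply_symm_apply _
  rw [hasSlope_iff_zero]
  refine (key (G.Ad (G.exp (t • x)) a)).congr' (Eventually.of_forall fun s => ?_)
  rw [zero_add, ← G.Ad_exp_mul, ← G.exp_add, add_comm]

/-! ### The logarithmic derivative of the exponential function -/

/-- The primitive `K` of `t ↦ Ad(exp(-tx)) h` gives the logarithmic derivative of the exponential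
function: it is the velocity of `exp(-x) exp(y(s))` for every curve `y` through `x` with
derivative `h`. -/
theorem exists_hasVel_exp_curve (x h : 𝔨) : ∃ K : ℝ → 𝔨, K 0 = 0 ∧
    (∀ t : ℝ, HasSlope K (G.Ad (G.exp (-(t • x))) h) t) ∧
    ∀ y : ℝ → 𝔨, y 0 = x → HasSlope y h 0 →
      G.HasVel (fun s => G.exp (-x) * G.exp (y s)) (K 1) := by
  let V (t : ℝ) (a : 𝔨) : Prop := ∀ y : ℝ → 𝔨, y 0 = x → HasSlope y h 0 →
    G.HasVel (fun s => G.exp (-(t • x)) * G.exp (t • y s)) a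
  have Vuniq {t : ℝ} {a b : 𝔨} (ha : V t a) (hb : V t b) : a = b := by
    have h0 : x + (0 : ℝ) • h = x := by simp
    exact HasVel.unique G (ha _ h0 (hasSlope_line x h 0)) (hb _ h0 (hasSlope_line x h 0))
  have Vadd {t s : ℝ} {a b : 𝔨} (ha : V t a) (hb : V s b) :
      V (t + s) (G.Ad (G.exp (-(t • x))) b + a) := by
    intro y hy0 hy
    refine HasVel.congr G ((G.hasAd_exp (-(t • x)) _ _ (hb y hy0 hy)).mul G (ha y hy0 hy))
      (Eventually.of_forall fun σ => ?_)
    have e1 : G.exp ((t + s) • y σ) = G.exp (s • y σ) * G.exp (t • y σ) := by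
      rw [add_comm, G.exp_add]
    have e2 : G.exp (-((t + s) • x)) = G.exp (-(t • x)) * G.exp (-(s • x)) := by
      rw [← smul_neg, ← smul_neg, ← smul_neg, G.exp_add]
    dsimp only
    rw [e1, e2]
    group
  obtain ⟨dΦ, hΦ⟩ := G.exp_smooth G.chart (chart_mem_atlas G.E (1 : G.H))
  have hopen : IsOpen {x : 𝔨 | G.exp x ∈ G.chart.source} :=
    G.chart.open_source.preimage G.exp_continuous
  -- the velocity for small `t`
  let k (t : ℝ) (v : 𝔨) : G.E :=
    G.chartDerivs 1 (G.chart (G.exp (-(t • x))), G.chart (G.exp (t • x)))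
    fun _ => (0, dΦ 1 (t • x) fun _ => v)
  have hnear : ∀ᶠ t : ℝ in 𝓝 0, V t (G.iso (k t (t • h))) ∧ k t (t • h) = t • k t h := by
    filter_upwards [G.eventually_exp_mem x] with t ht
    have ht' : G.exp (-(t • x)) ∈ G.chart.source := by rw [G.exp_neg]; exact ht.2
    have m2 : (G.chart (G.exp (-(t • x))), G.chart (G.exp (t • x))) ∈ G.chartDomain :=
      G.mem_chartDomain ht' ht.1 (by simp [G.exp_neg])
    refine ⟨fun y hy0 hy => ⟨?_, ?_, ?_⟩, ?_⟩
    · simp [hy0, G.exp_neg]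
    · have h1 : Tendsto y (𝓝 0) (𝓝 x) := by simpa [hy0] using tendsto_of_hasSlope hy
      have h2 : Tendsto (fun s => G.exp (t • y s)) (𝓝 0) (𝓝 (G.exp (t • x))) :=
        (G.exp_continuous.tendsto _).comp (h1.const_smul t)
      have h3 := (G.continuous_mul.tendsto _).comp
        ((tendsto_const_nhds (x := G.exp (-(t • x)))).prodMk_nhds h2)
      simpa [Function.comp_def, G.exp_neg] using h3
    · have h1 : HasSlope (fun s => t • y s) (t • h) 0 := hy.map (t • ContinuousLinearMap.id ℝ 𝔨)
      have h2 := hΦ.hasSlope_comp hopen (t := 0) (by rw [hy0]; exact ht.1) h1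
      have h3 := G.smooth_chartMul.hasSlope_comp G.isOpen_chartDomain (t := 0)
        (c := fun s => (G.chart (G.exp (-(t • x))), G.chart (G.exp (t • y s))))
        (by rw [hy0]; exact m2) ((hasSlope_const _ 0).prodMk h2)
      rw [hy0] at h3
      rw [G.iso.symm_apply_apply]
      refine h3.congr' ?_
      have h4 : Tendsto (fun s => t • y (0 + s)) (𝓝 0) (𝓝 (t • x)) := by
        simpa [hy0] using tendsto_of_hasSlope h1
      filter_upwards [h4.eventually (hopen.mem_nhds ht.1)] with s hs
      rw [G.chartMul_chart ht' hs]
    · change (G.smooth_chartMul.clm G.isOpen_chartDomain m2)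
        (0, (hΦ.clm hopen (show t • x ∈ _ from ht.1)) (t • h)) =
        t • (G.smooth_chartMul.clm G.isOpen_chartDomain m2)
        (0, (hΦ.clm hopen (show t • x ∈ _ from ht.1)) h)
      rw [map_smul, ← map_smul (G.smooth_chartMul.clm G.isOpen_chartDomain m2), Prod.smul_mk,
        smul_zero]
  have Vex : ∀ t, ∃ a, V t a := by
    intro t
    have h2 : Tendsto (fun n : ℕ => t / ((n : ℝ) + 1)) atTop (𝓝 0) := by
      simpa [div_eq_mul_inv] using
        (tendsto_one_div_add_atTop_nhds_zero_nat (𝕜 := ℝ)).const_mul t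
    obtain ⟨n, hn⟩ := (h2.eventually hnear).exists
    have h3 : ∀ j : ℕ, ∃ a, V (((j : ℝ) + 1) * (t / ((n : ℝ) + 1))) a := by
      intro j
      induction j with
      | zero => exact ⟨_, by simpa using hn.1⟩
      | succ j ih =>
        obtain ⟨a, ha⟩ := ih
        have := Vadd ha hn.1
        rw [← add_one_mul] at this
        push_cast
        exact ⟨_, this⟩
    have hn1 : (n : ℝ) + 1 ≠ 0 := by positivity
    have h4 := h3 n
    rwa [mul_div_cancel₀ _ hn1] at h4
  choose K hK using Vex
  have hKadd (t s : ℝ) : K (t + s) = G.Ad (G.exp (-(t • x))) (K s) + K t :=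
    Vuniq (hK _) (Vadd (hK t) (hK s))
  have hKsmall : ∀ᶠ t : ℝ in 𝓝 0, K t = t • G.iso (k t h) := by
    filter_upwards [hnear] with t ht
    rw [Vuniq (hK t) ht.1, ht.2, map_smul]
  have hΦ0 : (dΦ 1 0 fun _ => h) = G.iso.symm h := by
    have h0 : (0 : 𝔨) ∈ {x : 𝔨 | G.exp x ∈ G.chart.source} := by
      simp [G.exp_zero]
    have h1 := hΦ.hasSlope h0 hopen h
    simp only [zero_add] at h1
    exact h1.unique (G.hasSlope_chart_exp h)
  have hklim : Tendsto (fun t : ℝ => G.iso (k t h)) (𝓝 0) (𝓝 h) := by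
    have h0 : (0 : 𝔨) ∈ {x : 𝔨 | G.exp x ∈ G.chart.source} := by
      simp [G.exp_zero]
    have l1 : Tendsto (fun t : ℝ => t • x) (𝓝 0) (𝓝 0) :=
      Continuous.tendsto' (by fun_prop) _ _ (by simp)
    have l2 := hΦ.tendsto_deriv hopen h0 l1 (tendsto_const_nhds (x := h))
    rw [hΦ0] at l2
    have l3 : Tendsto (fun t : ℝ => G.chart (G.exp (t • x))) (𝓝 0) (𝓝 (G.chart 1)) := by
      simpa [G.exp_zero] using tendsto_of_hasSlope (G.hasSlope_chart_exp x)
    have l4 : Tendsto (fun t : ℝ => G.chart (G.exp (-(t • x)))) (𝓝 0) (𝓝 (G.chart 1)) := by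
      simpa [G.exp_zero] using tendsto_of_hasSlope (G.hasSlope_chart_exp (-x))
    have l5 := G.smooth_chartMul.tendsto_deriv G.isOpen_chartDomain G.one_mem_chartDomain
      (l4.prodMk_nhds l3) ((tendsto_const_nhds (x := (0 : G.E))).prodMk_nhds l2)
    rw [G.smooth_chartMul.deriv_unit G.isOpen_chartDomain G.one_mem_chartDomain
      G.chartMul_one_left G.chartMul_one_right, zero_add] at l5
    have l6 := (G.iso.continuous.tendsto _).comp l5
    rw [G.iso.apply_symm_apply] at l6
    exact l6
  refine ⟨K, ?_, ?_, ?_⟩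
  · simpa using hKsmall.self_of_nhds
  · intro t
    have h1 := ((G.Ad (G.exp (-(t • x)))).continuous.tendsto h).comp
      (hklim.mono_left (nhdsWithin_le_nhds (s := {0}ᶜ)))
    refine h1.congr' ?_
    filter_upwards [hKsmall.filter_mono nhdsWithin_le_nhds, self_mem_nhdsWithin] with s hs hs0
    have hs0' : s ≠ 0 := hs0
    rw [hKadd, add_sub_cancel_right, hs, map_smul, smul_smul, inv_mul_cancel₀ hs0', one_smul]
    rfl
  · intro y hy0 hy
    simpa using hK 1 y hy0 hy

omit [LocallyConvexLieAlgebra 𝔨] in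
/-- A curve in a Lie group with vanishing left logarithmic derivative is constant. -/
theorem eq_of_hasVel_zero {γ : ℝ → G.H}
    (h : ∀ t ∈ Icc (0 : ℝ) 1, G.HasVel (fun s => (γ t)⁻¹ * γ (t + s)) 0) : γ 1 = γ 0 := by
  have hcont : ∀ t ∈ Icc (0 : ℝ) 1, Tendsto (fun s => γ (t + s)) (𝓝 0) (𝓝 (γ t)) := by
    intro t ht
    have h1 := (G.continuous_mul.tendsto (γ t, 1)).comp
      ((tendsto_const_nhds (x := γ t)).prodMk_nhds (h t ht).tendsto)
    simpa [Function.comp_def] using h1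
  have hloc : ∀ t ∈ Icc (0 : ℝ) 1, ∀ᶠ s in 𝓝 (0 : ℝ), t + s ∈ Icc (0 : ℝ) 1 → γ (t + s) = γ t := by
    intro t ht
    obtain ⟨ε, hε, hball⟩ :=
      Metric.eventually_nhds_iff_ball.1 (G.eventually_source (h t ht).tendsto)
    filter_upwards [Metric.ball_mem_nhds (0 : ℝ) hε] with s hs hts
    have hr : ∀ r ∈ Icc (0 : ℝ) 1, r * s ∈ Metric.ball (0 : ℝ) ε ∧ t + r * s ∈ Icc (0 : ℝ) 1 := by
      intro r hr
      constructor
      · rw [mem_ball_zero_iff] at hs ⊢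
        rw [norm_mul]
        refine lt_of_le_of_lt (mul_le_of_le_one_left (norm_nonneg _) ?_) hs
        rw [Real.norm_eq_abs]
        exact abs_le_one_of_mem_Icc hr
      · have h2 := (convex_Icc (0 : ℝ) 1) ht hts (sub_nonneg.2 hr.2) hr.1 (by ring)
        simp only [smul_eq_mul] at h2
        convert h2 using 1
        ring
    have h1 := HasSlope.eq_of_zero
        (c := fun r : ℝ => G.chart ((γ t)⁻¹ * γ (t + r * s))) fun r hr' => by
      obtain ⟨hr1, hr2⟩ := hr r hr'
      have hsrc := hball _ hr1
      have h3 := h _ hr2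
      have m1 : (G.chart ((γ t)⁻¹ * γ (t + r * s)), G.chart 1) ∈ G.chartDomain :=
        G.mem_chartDomain hsrc G.one_mem_source (by simpa using hsrc)
      have h4 := G.smooth_chartMul.hasSlope_comp G.isOpen_chartDomain (t := 0)
        (c := fun σ => (G.chart ((γ t)⁻¹ * γ (t + r * s)),
          G.chart ((γ (t + r * s))⁻¹ * γ (t + r * s + σ))))
        (by simpa using m1) ((hasSlope_const _ 0).prodMk h3.slope)
      have h5 : G.chart ((γ (t + r * s))⁻¹ * γ (t + r * s + 0)) = G.chart 1 := by simp
      rw [h5, map_zero, ← Prod.zero_eq_mk,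
        ← G.smooth_chartMul.clm_apply G.isOpen_chartDomain m1, map_zero] at h4
      have h6 : HasSlope (fun σ => G.chart ((γ t)⁻¹ * γ (t + r * s + σ))) 0 0 := by
        refine h4.congr' ?_
        filter_upwards [G.eventually_source h3.tendsto] with σ hσ
        rw [zero_add, G.chartMul_chart hsrc hσ]
        group
      rw [hasSlope_iff_zero]
      have h7 : HasSlope (fun σ => G.chart ((γ t)⁻¹ * γ (t + r * s + s * σ))) (s • 0) 0 :=
        HasSlope.comp_smul (c := fun σ => G.chart ((γ t)⁻¹ * γ (t + r * s + σ))) s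
          (by simpa using h6)
      rw [smul_zero] at h7
      refine h7.congr' (Eventually.of_forall fun σ => ?_)
      rw [add_mul, mul_comm s, add_assoc, zero_add]
    simp only [one_mul, zero_mul, add_zero, inv_mul_cancel] at h1
    have h2 := G.chart.injOn (hball s hs) G.one_mem_source h1
    exact (eq_of_inv_mul_eq_one h2).symm
  have hconst : IsLocallyConstant fun t : Icc (0 : ℝ) 1 => γ t := by
    rw [IsLocallyConstant.iff_eventually_eq]
    intro t
    have h1 := hloc t t.2
    have h2 : Tendsto (fun r : Icc (0 : ℝ) 1 => (r : ℝ) - t) (𝓝 t) (𝓝 0) :=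
      Continuous.tendsto' (by fun_prop) _ _ (by simp)
    filter_upwards [h2.eventually h1] with r hr
    have h3 : (t : ℝ) + (r - t) = r := by ring
    rw [h3] at hr
    exact hr r.2
  exact hconst.apply_eq_of_preconnectedSpace ⟨1, by simp⟩ ⟨0, by simp⟩

end LocExpLieGroup

/-! ### Exponentials in a closed subalgebra -/

namespace LocExpLieGroup

section

variable {𝔨 : Type u} [LieRing 𝔨] [LieAlgebra ℝ 𝔨] [TopologicalSpace 𝔨]
  [LocallyConvexLieAlgebra 𝔨] (G : LocExpLieGroup 𝔨)

lemma Ad_exp_smul_self (u : 𝔨) (t : ℝ) : G.Ad (G.exp (t • u)) u = u := by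
  refine HasVel.unique G (G.hasAd_exp (t • u) _ _ (G.hasVel_exp u))
    ((G.hasVel_exp u).congr G (Eventually.of_forall fun s => ?_))
  dsimp only
  rw [← G.exp_add, add_comm, G.exp_add, mul_inv_cancel_right]

/-- A curve `exp (y t)` with constant left logarithmic derivative `u` is a left translate of
`exp (t u)`. -/
theorem exp_eq_mul_exp {y : ℝ → 𝔨} {u : 𝔨}
    (h : ∀ t ∈ Icc (0 : ℝ) 1, G.HasVel (fun s => G.exp (-y t) * G.exp (y (t + s))) u) :
    G.exp (y 1) = G.exp (y 0) * G.exp u := by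
  have h1 := G.eq_of_hasVel_zero (γ := fun t => G.exp (y t) * G.exp (t • -u)) fun t ht => by
    have h2 := (G.hasAd_exp (t • u) _ _ (h t ht)).mul G (G.hasVel_exp (-u))
    rw [G.Ad_exp_smul_self, add_neg_cancel] at h2
    refine h2.congr G (Eventually.of_forall fun s => ?_)
    dsimp only
    rw [G.exp_add, G.exp_neg, smul_neg, smul_neg, G.exp_neg, G.exp_neg]
    group
  simp only [one_smul, zero_smul, G.exp_zero, mul_one, G.exp_neg] at h1
  rw [← h1, inv_mul_cancel_right]

lemma Ad_exp_eq_self {x δ : 𝔨} (h : ⁅x, δ⁆ = 0) : G.Ad (G.exp x) δ = δ := by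
  have h1 := HasSlope.eq_of_zero (c := fun t : ℝ => G.Ad (G.exp (t • x)) δ) fun t _ => by
    have h2 := (G.hasSlope_Ad x δ 0).map (G.Ad (G.exp (t • x)))
    rw [zero_smul, G.Ad_exp_zero, h, map_zero] at h2
    rw [hasSlope_iff_zero]
    refine h2.congr' (Eventually.of_forall fun s => ?_)
    rw [zero_add, ← G.Ad_exp_mul, ← G.exp_add, add_comm]
  simpa [G.Ad_exp_zero] using h1

/-- Central elements split off from the exponential. -/
theorem exp_add_of_central {c δ : 𝔨} (hδ : ∀ x : 𝔨, ⁅δ, x⁆ = 0) :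
    G.exp (c + δ) = G.exp c * G.exp δ := by
  have h1 := G.exp_eq_mul_exp (y := fun t => c + t • δ) (u := δ) fun t _ => by
    obtain ⟨K, hK0, hK, hy⟩ := G.exists_hasVel_exp_curve (c + t • δ) δ
    have h0 : HasSlope (fun s => c + (t + s) • δ) δ 0 := by
      have := hasSlope_line c δ t
      rwa [hasSlope_iff_zero] at this
    have h2 := hy (fun s => c + (t + s) • δ) (by rw [add_zero]) h0
    have h3 := HasSlope.eq_of_zero (c := fun r : ℝ => K r - r • δ) fun s _ => by
      have h4 := (hK s).sub (hasSlope_smul_const δ s)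
      have h6 : ⁅-(s • (c + t • δ)), δ⁆ = 0 := by rw [← lie_skew, hδ, neg_zero]
      rwa [G.Ad_exp_eq_self h6, sub_self] at h4
    have h5 : K 1 = δ := by simpa [hK0, sub_eq_zero] using h3
    rw [h5] at h2
    exact h2
  simpa using h1

end

end LocExpLieGroup

section Subalgebra

variable {𝔤 : Type u} [LieRing 𝔤] [LieAlgebra ℝ 𝔤] [TopologicalSpace 𝔤] [LocallyConvexLieAlgebra 𝔤]
  (𝔥 : LieSubalgebra ℝ 𝔤)

/-- The inclusion of a subalgebra. -/
def inclCLM : 𝔥 →L[ℝ] 𝔤 where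
  toFun x := x
  map_add' _ _ := rfl
  map_smul' _ _ := rfl
  cont := continuous_subtype_val

instance subalgebraLocallyConvex : LocallyConvexLieAlgebra 𝔥 :=
  have h1 : IsTopologicalAddGroup 𝔥 := inferInstanceAs (IsTopologicalAddGroup 𝔥.toSubmodule)
  have h2 : ContinuousSMul ℝ 𝔥 := inferInstanceAs (ContinuousSMul ℝ 𝔥.toSubmodule)
  have h3 : LocallyConvexSpace ℝ 𝔥 :=
    Topology.IsInducing.locallyConvexSpace (f := (inclCLM 𝔥).toLinearMap) ⟨rfl⟩
  { h1, h2, h3, (inferInstance : T2Space 𝔥) with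
    continuous_lie := by
      rw [continuous_induced_rng]
      exact LocallyConvexLieAlgebra.continuous_lie.comp
        ((continuous_subtype_val.comp continuous_fst).prodMk
          (continuous_subtype_val.comp continuous_snd)) }

variable {𝔥}

omit [LocallyConvexLieAlgebra 𝔤] in
lemma hasSlope_of_coe {c : ℝ → 𝔥} {v : 𝔥} {t : ℝ} (h : HasSlope (fun t => (c t : 𝔤)) v t) :
    HasSlope c v t :=
  tendsto_subtype_rng.2 h

variable {U : Set 𝔤} {D : Set (𝔤 × 𝔤)} {m : 𝔤 × 𝔤 → 𝔤}
  {d : (k : ℕ) → 𝔤 × 𝔤 → (Fin k → 𝔤 × 𝔤) → 𝔤} (S : IsLocExpGroup U D m d)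
  (G : LocExpLieGroup 𝔥)

namespace IsLocExpGroup
include S

/-- On `𝔥`, the adjoint actions of the local group and of the Lie group of `𝔥` agree. -/
lemma locAd_coe {x : 𝔥} (hx : (x : 𝔤) ∈ U) (a : 𝔥) :
    locAd d (x : 𝔤) a = G.Ad (G.exp x) a := by
  have h1 := S.eq_locAd hx (α := fun t => (G.Ad (G.exp (t • x)) a : 𝔤)) fun t _ =>
    (G.hasSlope_Ad x a t).map (inclCLM 𝔥)
  simp only [one_smul, zero_smul, G.Ad_exp_zero] at h1
  exact h1.symm

/-- On `𝔥`, the logarithmic derivatives of the local group and of the Lie group of `𝔥` agree. -/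
lemma hasVel_exp_curve {y : ℝ → 𝔥} {x a u : 𝔥} (hx : (x : 𝔤) ∈ U) (hy0 : y 0 = x)
    (hy : HasSlope y a 0) (hu : leftLogDeriv d (x : 𝔤) a = u) :
    G.HasVel (fun s => G.exp (-x) * G.exp (y s)) u := by
  obtain ⟨K, hK0, hK, hK1⟩ := G.exists_hasVel_exp_curve x a
  have h1 := HasSlope.eq_of_zero
    (c := fun t : ℝ => t • leftLogDeriv d (t • (x : 𝔤)) a - inclCLM 𝔥 (K t)) fun t ht => by
    have ht' := abs_le_one_of_mem_Icc ht
    have h2 := (S.hasSlope_leftLogDeriv hx a ht').sub ((hK t).map (inclCLM 𝔥))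
    have h3 := S.locAd_coe G (x := -(t • x)) (S.neg_mem (S.smul_mem hx ht')) a
    have h4 : locAd d (-(t • (x : 𝔤))) a - inclCLM 𝔥 (G.Ad (G.exp (-(t • x))) a) = 0 :=
      sub_eq_zero.2 h3
    rwa [h4] at h2
  have h2 : (K 1 : 𝔤) = u := by
    rw [← hu]
    simp only [one_smul, zero_smul, hK0, map_zero, sub_zero, sub_eq_zero] at h1
    exact h1.symm
  rw [← Subtype.ext h2]
  exact hK1 y hy0 hy

/-- Two elements with the same adjoint action on `𝔥` differ by an element commuting with `𝔥`. -/
lemma lie_mul_neg_eq_zero {a b : 𝔤} (hab : (a, -b) ∈ D)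
    (h : ∀ k ∈ 𝔥, locAd d a k = locAd d b k) (hb : ∀ k ∈ 𝔥, ∃ k' ∈ 𝔥, locAd d b k' = k)
    {k : 𝔤} (hk : k ∈ 𝔥) : ⁅m (a, -b), k⁆ = 0 := by
  obtain ⟨k', hk', rfl⟩ := hb k hk
  have hbU : b ∈ U := by simpa using S.neg_mem (S.snd_mem hab)
  refine S.lie_eq_zero_of_locAd (S.mul_mem hab) ?_
  rw [S.locAd_mul hab, S.locAd_neg_locAd hbU, h k' hk']

include G in
lemma exists_locAd_eq {z : 𝔥} (hz : (z : 𝔤) ∈ U) {k : 𝔤} (hk : k ∈ 𝔥) :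
    ∃ k' ∈ 𝔥, locAd d (z : 𝔤) k' = k := by
  refine ⟨locAd d (-(z : 𝔤)) k, ?_, S.locAd_locAd_neg hz k⟩
  have := S.locAd_coe G (x := -z) (S.neg_mem hz) ⟨k, hk⟩
  change locAd d (-(z : 𝔤)) k = _ at this
  rw [this]
  exact Subtype.property _

end IsLocExpGroup

end Subalgebra

/-! ### Products in a closed subalgebra -/

section Subalgebra

variable {𝔤 : Type u} [LieRing 𝔤] [LieAlgebra ℝ 𝔤] [TopologicalSpace 𝔤] [LocallyConvexLieAlgebra 𝔤]
  {𝔥 : LieSubalgebra ℝ 𝔤} {U : Set 𝔤} {D : Set (𝔤 × 𝔤)} {m : 𝔤 × 𝔤 → 𝔤}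
  {d : (k : ℕ) → 𝔤 × 𝔤 → (Fin k → 𝔤 × 𝔤) → 𝔤} (S : IsLocExpGroup U D m d)
  (G : LocExpLieGroup 𝔥)

/-- A symmetric open neighborhood of zero on which the product is defined. -/
structure IsSymmNhd (U : Set 𝔤) (D : Set (𝔤 × 𝔤)) (V : Set 𝔤) : Prop where
  isOpen : IsOpen V
  symm : ∀ x ∈ V, -x ∈ V
  subset : V ⊆ U
  prod_subset : V ×ˢ V ⊆ D

variable {V : Set 𝔤}

namespace IsLocExpGroup
include S

/-- If `y = w * u` for `w, u ∈ 𝔥` and if `z ∈ 𝔥` has `exp z = exp w * exp u`, then `z` and `y`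
differ by an element which commutes with `𝔥` and with `y`. -/
lemma exists_add_eq (hV : IsSymmNhd U D V) {C : Set 𝔤} (hC : IsPreconnected C) (hCV : C ⊆ V)
    (hC𝔥 : C ⊆ 𝔥) (h0 : (0 : 𝔤) ∈ C) {w u z : 𝔥} (hw : (w : 𝔤) ∈ C)
    (hwu : ∀ r ∈ Icc (0 : ℝ) 1, ((w : 𝔤), r • (u : 𝔤)) ∈ D ∧ m (w, r • (u : 𝔤)) ∈ V)
    (hz : (z : 𝔤) ∈ V) (hexp : G.exp z = G.exp w * G.exp u) :
    ∃ v : 𝔤, (z : 𝔤) = v + m (w, (u : 𝔤)) ∧ (∀ k ∈ 𝔥, ⁅v, k⁆ = 0) ∧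
      ⁅v, m (w, (u : 𝔤))⁆ = 0 := by
  have h1 := hwu 1 ⟨zero_le_one, le_rfl⟩
  rw [one_smul] at h1
  obtain ⟨hD1, hyV⟩ := h1
  set y := m ((w : 𝔤), (u : 𝔤)) with hy
  have hVD {a b : 𝔤} (ha : a ∈ V) (hb : b ∈ V) : (a, -b) ∈ D := hV.prod_subset ⟨ha, hV.symm b hb⟩
  have hwU := S.fst_mem hD1
  have huU := S.snd_mem hD1
  have hzU := hV.subset hz
  have heq : ∀ k ∈ 𝔥, locAd d (z : 𝔤) k = locAd d y k := by
    intro k hk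
    have e1 := S.locAd_coe G hzU ⟨k, hk⟩
    have e2 := S.locAd_coe G huU ⟨k, hk⟩
    have e3 := S.locAd_coe G hwU (G.Ad (G.exp u) ⟨k, hk⟩)
    rw [hexp, G.Ad_exp_mul, ← e3, ← e2] at e1
    rw [hy, S.locAd_mul hD1, ← e1]
  have hcomm : ∀ k ∈ 𝔥, ⁅m ((z : 𝔤), -y), k⁆ = 0 := by
    intro k hk
    refine S.lie_mul_neg_eq_zero (hVD hz hyV) heq (fun k hk => ?_) hk
    obtain ⟨k', hk', h2⟩ := S.exists_locAd_eq G hzU hk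
    exact ⟨k', hk', by rw [← heq k' hk', h2]⟩
  have hcomm' : ∀ r ∈ Icc (0 : ℝ) 1, ⁅m ((z : 𝔤), -y), m ((w : 𝔤), r • (u : 𝔤))⁆ = 0 := fun r hr =>
    S.lie_mul_eq_zero (hwu r hr).1 (hcomm _ w.2) (hcomm _ (𝔥.smul_mem r u.2))
  have hy1 : y = m ((w : 𝔤), (1 : ℝ) • (u : 𝔤)) := by rw [one_smul]
  have hyC : y ∈ (fun r : ℝ => m ((w : 𝔤), r • (u : 𝔤))) '' Icc 0 1 :=
    ⟨1, ⟨zero_le_one, le_rfl⟩, hy1.symm⟩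
  have hwC : (w : 𝔤) ∈ (fun r : ℝ => m ((w : 𝔤), r • (u : 𝔤))) '' Icc 0 1 :=
    ⟨0, ⟨le_rfl, zero_le_one⟩, by simp only [zero_smul, S.mul_zero hwU]⟩
  have hpath : IsPreconnected ((fun r : ℝ => m ((w : 𝔤), r • (u : 𝔤))) '' Icc 0 1) := by
    refine isPreconnected_Icc.image _ fun r hr => ContinuousAt.continuousWithinAt ?_
    exact S.tendsto_mul (hwu r hr).1 tendsto_const_nhds
      (Continuous.tendsto (by fun_prop : Continuous fun r : ℝ => r • (u : 𝔤)) r)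
  have hC' := hC.union (w : 𝔤) hw hwC hpath
  have hC'V : C ∪ (fun r : ℝ => m ((w : 𝔤), r • (u : 𝔤))) '' Icc 0 1 ⊆ V := by
    rintro ρ (hρ | ⟨r, hr, rfl⟩)
    · exact hCV hρ
    · exact (hwu r hr).2
  refine ⟨m ((z : 𝔤), -y), S.eq_add_of_comm hC' (Or.inl h0) (Or.inr hyC)
    (fun ρ hρ => hVD hz (hC'V hρ)) (fun ρ hρ => hVD hyV (hC'V hρ))
    (fun ρ hρ σ hσ => hVD (hC'V hρ) (hC'V hσ)) ?_, hcomm, ?_⟩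
  · rintro ρ (hρ | ⟨r, hr, rfl⟩)
    · exact hcomm ρ (hC𝔥 hρ)
    · exact hcomm' r hr
  · have := hcomm' 1 ⟨zero_le_one, le_rfl⟩
    rwa [← hy1] at this

include G in
/-- The logarithmic derivative of `y` is the identity modulo the subalgebra `𝔥` on vectors which
normalize `𝔥`, if `y` is the sum of an element of `𝔥` and an element commuting with `𝔥`. -/
lemma leftLogDeriv_sub_mem (h𝔥 : IsClosed (𝔥 : Set 𝔤)) {z : 𝔥} {y v e : 𝔤} (hz : (z : 𝔤) ∈ U)
    (hy : y ∈ U) (hzy : (z : 𝔤) = v + y) (hv : ∀ k ∈ 𝔥, ⁅v, k⁆ = 0) (hvy : ⁅v, y⁆ = 0)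
    (hye : ⁅y, e⁆ ∈ 𝔥) : leftLogDeriv d y e - e ∈ 𝔥 := by
  have hK : Convex ℝ (𝔥 : Set 𝔤) := 𝔥.toSubmodule.convex
  -- `exp(-ry)` preserves `𝔥`, since it acts there like `exp(-rz)`
  have h1 : ∀ r : ℝ, |r| ≤ 1 → ∀ k ∈ 𝔥, locAd d (r • y) k ∈ 𝔥 := by
    intro r hr k hk
    have hrz := S.smul_mem hz hr
    have e1 := S.locAd_coe G (x := r • z) hrz ⟨k, hk⟩
    change locAd d (r • (z : 𝔤)) k = _ at e1
    rw [hzy, smul_add] at hrz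
    rw [hzy, smul_add, S.locAd_add (S.smul_mem hy hr) hrz (by simp [hvy])
      (by rw [smul_lie, hv k hk, smul_zero])] at e1
    rw [e1]
    exact Subtype.property _
  have h2 : ∀ r : ℝ, |r| ≤ 1 → locAd d (r • y) e - e ∈ 𝔥 := by
    intro r hr
    have h3 := HasSlope.sub_mem (K := (𝔥 : Set 𝔤)) h𝔥 hK (c := fun q : ℝ => locAd d (q • r • y) e)
      fun q hq => ?_
    · simpa [S.locAd_zero] using h3
    · have hq' := abs_le_one_of_mem_Icc hq
      refine ⟨⁅r • y, locAd d (q • r • y) e⁆, ?_, S.hasSlope_locAd (S.smul_mem hy hr) e hq'⟩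
      rw [S.lie_locAd (S.smul_mem hy hr) e hq', smul_smul]
      refine h1 _ ?_ _ ?_
      · rw [abs_mul]
        exact mul_le_one₀ hq' (abs_nonneg _) hr
      · rw [smul_lie]
        exact 𝔥.smul_mem r hye
  have h4 := HasSlope.sub_mem (K := (𝔥 : Set 𝔤)) h𝔥 hK
    (c := fun r : ℝ => r • leftLogDeriv d (r • y) e - r • e) fun r hr => ?_
  · simpa using h4
  · have hr' := abs_le_one_of_mem_Icc hr
    refine ⟨_, ?_, (S.hasSlope_leftLogDeriv hy e hr').sub (hasSlope_smul_const e r)⟩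
    rw [← neg_smul]
    exact h2 _ (by rwa [abs_neg])

/-- A product `w * su` of elements of `𝔥` stays in `𝔥` as long as the corresponding group elements
have logarithms in `V`. -/
theorem mul_smul_mem (hV : IsSymmNhd U D V) (h𝔥 : IsClosed (𝔥 : Set 𝔤)) {C : Set 𝔤}
    (hC : IsPreconnected C) (hCV : C ⊆ V) (hC𝔥 : C ⊆ 𝔥) (h0 : (0 : 𝔤) ∈ C) {w u : 𝔥}
    (hw : (w : 𝔤) ∈ C)
    (hwu : ∀ s : ℝ, |s| ≤ 1 → ((w : 𝔤), s • (u : 𝔤)) ∈ D ∧ m (w, s • (u : 𝔤)) ∈ V ∧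
      ∃ z : 𝔥, (z : 𝔤) ∈ V ∧ G.exp z = G.exp w * G.exp (s • u)) {s : ℝ} (hs : |s| < 1) :
    ∃ y : 𝔥, (y : 𝔤) = m (w, s • (u : 𝔤)) ∧ G.exp y = G.exp w * G.exp (s • u) := by
  have hmul {r s : ℝ} (hr : r ∈ Icc (0 : ℝ) 1) (hs : |s| ≤ 1) : |r * s| ≤ 1 := by
    rw [abs_mul]
    exact mul_le_one₀ (abs_le_one_of_mem_Icc hr) (abs_nonneg _) hs
  have hmul' {r s : ℝ} (hr : r ∈ Icc (0 : ℝ) 1) (hs : |s| < 1) : |r * s| < 1 := by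
    rw [abs_mul]
    exact (mul_le_of_le_one_left (abs_nonneg _) (abs_le_one_of_mem_Icc hr)).trans_lt hs
  have huU : (u : 𝔤) ∈ U := by simpa using S.snd_mem (hwu 1 (by simp)).1
  have hsplit : ∀ s : ℝ, |s| ≤ 1 → ∃ (z : 𝔥) (v : 𝔤), (z : 𝔤) ∈ V ∧
      (z : 𝔤) = v + m (w, s • (u : 𝔤)) ∧ (∀ k ∈ 𝔥, ⁅v, k⁆ = 0) ∧ ⁅v, m (w, s • (u : 𝔤))⁆ = 0 := by
    intro s hs
    obtain ⟨-, -, z, hz, hexp⟩ := hwu s hs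
    obtain ⟨v, h1, h2, h3⟩ := S.exists_add_eq G hV hC hCV hC𝔥 h0 (u := s • u) hw
      (fun r hr => by
        have := hwu (r * s) (hmul hr hs)
        rw [mul_smul] at this
        exact ⟨this.1, this.2.1⟩) hz hexp
    exact ⟨z, v, hz, h1, h2, h3⟩
  have hnormal : ∀ s : ℝ, |s| ≤ 1 → ∀ k ∈ 𝔥, ⁅m (w, s • (u : 𝔤)), k⁆ ∈ 𝔥 := by
    intro s hs k hk
    obtain ⟨z, v, -, h1, h2, -⟩ := hsplit s hs
    have h3 : ⁅m (w, s • (u : 𝔤)), k⁆ = ⁅(z : 𝔤), k⁆ := by rw [h1, add_lie, h2 k hk, zero_add]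
    rw [h3]
    exact 𝔥.lie_mem z.2 hk
  -- the velocity of `s ↦ w * su` lies in `𝔥`
  have hvel : ∀ s : ℝ, |s| < 1 → leftDeriv d (m (w, s • (u : 𝔤))) u ∈ 𝔥 := by
    intro s hs
    obtain ⟨hD, hyV, -⟩ := hwu s hs.le
    have hyU := hV.subset hyV
    obtain ⟨z, v, hz, h1, h2, h3⟩ := hsplit s hs.le
    set e := leftDeriv d (m (w, s • (u : 𝔤))) u with he
    have hslope := S.hasSlope_mul_smul huU hs.le hD
    have hze : ⁅(z : 𝔤), e⁆ ∈ 𝔥 := by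
      have h4 : Tendsto (fun σ : ℝ => adCLM (z : 𝔤)
          (σ⁻¹ • (m (w, (s + σ) • (u : 𝔤)) - m (w, s • (u : 𝔤))))) (𝓝[≠] 0)
          (𝓝 (adCLM (z : 𝔤) e)) := ((adCLM (z : 𝔤)).continuous.tendsto _).comp hslope
      refine h𝔥.mem_of_tendsto h4 ?_
      have h5 : Tendsto (fun σ : ℝ => |s + σ|) (𝓝[≠] 0) (𝓝 |s|) :=
        Tendsto.mono_left (Continuous.tendsto' (by fun_prop) _ _ (by simp)) nhdsWithin_le_nhds
      filter_upwards [h5.eventually (gt_mem_nhds hs)] with σ hσ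
      change ⁅(z : 𝔤), σ⁻¹ • (m (w, (s + σ) • (u : 𝔤)) - m (w, s • (u : 𝔤)))⁆ ∈ 𝔥
      rw [lie_smul, lie_sub, ← lie_skew (z : 𝔤), ← lie_skew (z : 𝔤) (m (w, s • (u : 𝔤)))]
      exact 𝔥.smul_mem _ (𝔥.sub_mem (𝔥.neg_mem (hnormal _ hσ.le _ z.2))
        (𝔥.neg_mem (hnormal _ hs.le _ z.2)))
    have hve : ⁅v, e⁆ = 0 := S.lie_leftDeriv_eq_zero hyU h3 (h2 u u.2)
    have hye : ⁅m (w, s • (u : 𝔤)), e⁆ ∈ 𝔥 := by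
      rw [h1, add_lie, hve, zero_add] at hze
      exact hze
    have h6 := S.leftLogDeriv_sub_mem G h𝔥 (hV.subset hz) hyU h1 h2 h3 hye
    rw [he, S.leftLogDeriv_leftDeriv hyU, ← he] at h6
    simpa using 𝔥.sub_mem u.2 h6
  have hmem : ∀ s : ℝ, |s| < 1 → m (w, s • (u : 𝔤)) ∈ 𝔥 := by
    intro s hs
    have h1 := HasSlope.sub_mem (K := (𝔥 : Set 𝔤)) h𝔥 𝔥.toSubmodule.convex
      (c := fun r : ℝ => m ((w : 𝔤), r • s • (u : 𝔤))) fun r hr => ?_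
    · simp only [one_smul, zero_smul, S.mul_zero (S.fst_mem (hwu s hs.le).1)] at h1
      simpa using 𝔥.add_mem h1 w.2
    · have h2 := hwu (r * s) (hmul hr hs.le)
      have h3 := hvel (r * s) (hmul' hr hs)
      rw [mul_smul] at h2 h3
      refine ⟨_, ?_, S.hasSlope_mul_smul (S.smul_mem huU hs.le) (abs_le_one_of_mem_Icc hr) h2.1⟩
      rw [← S.leftDerivCLM_apply (hV.subset h2.2.1), map_smul]
      exact 𝔥.smul_mem s h3
  classical
  let y (r : ℝ) : 𝔥 := if h : m ((w : 𝔤), r • s • (u : 𝔤)) ∈ 𝔥 then ⟨_, h⟩ else 0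
  have hy (r : ℝ) (hr : |r * s| < 1) : (y r : 𝔤) = m ((w : 𝔤), r • s • (u : 𝔤)) := by
    have h1 := hmem _ hr
    rw [mul_smul] at h1
    simp only [y, dif_pos h1]
  have h1 := G.exp_eq_mul_exp (y := y) (u := s • u) fun t ht => by
    have h2 := hwu (t * s) (hmul ht hs.le)
    have h3 := hvel (t * s) (hmul' ht hs)
    rw [mul_smul] at h2 h3
    have hyU := hV.subset h2.2.1
    have h4 := S.hasSlope_mul_smul (S.smul_mem huU hs.le) (abs_le_one_of_mem_Icc ht) h2.1
    have h5 : leftDeriv d (m ((w : 𝔤), t • s • (u : 𝔤))) (s • (u : 𝔤)) =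
        s • leftDeriv d (m ((w : 𝔤), t • s • (u : 𝔤))) u := by
      rw [← S.leftDerivCLM_apply hyU, map_smul, S.leftDerivCLM_apply]
    have h6 : leftDeriv d (m ((w : 𝔤), t • s • (u : 𝔤))) (s • (u : 𝔤)) ∈ 𝔥 := by
      rw [h5]
      exact 𝔥.smul_mem s h3
    refine S.hasVel_exp_curve G (y := fun σ => y (t + σ))
      (a := ⟨leftDeriv d (m ((w : 𝔤), t • s • (u : 𝔤))) (s • (u : 𝔤)), h6⟩) ?_
      (by rw [add_zero]) ?_ ?_
    · rw [hy t (hmul' ht hs)]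
      exact hyU
    · refine hasSlope_of_coe ?_
      rw [hasSlope_iff_zero] at h4
      refine h4.congr' ?_
      have h7 : Tendsto (fun σ : ℝ => |(t + (0 + σ)) * s|) (𝓝 0) (𝓝 |t * s|) :=
        Continuous.tendsto' (by fun_prop) _ _ (by simp)
      filter_upwards [h7.eventually (gt_mem_nhds (hmul' ht hs))] with σ hσ
      rw [hy _ hσ]
    · rw [hy t (hmul' ht hs), S.leftLogDeriv_leftDeriv hyU]
      rfl
  refine ⟨y 1, ?_, ?_⟩
  · rw [hy 1 (by rwa [one_mul]), one_smul]
  · rw [h1]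
    congr 2
    refine Subtype.ext ?_
    rw [hy 0 (by simp), zero_smul, S.mul_zero (S.fst_mem (hwu s hs.le).1)]

end IsLocExpGroup
end Subalgebra

section Subalgebra

variable {𝔤 : Type u} [LieRing 𝔤] [LieAlgebra ℝ 𝔤] [TopologicalSpace 𝔤] [LocallyConvexLieAlgebra 𝔤]
  {𝔥 : LieSubalgebra ℝ 𝔤} {U : Set 𝔤} {D : Set (𝔤 × 𝔤)} {m : 𝔤 × 𝔤 → 𝔤}
  {d : (k : ℕ) → 𝔤 × 𝔤 → (Fin k → 𝔤 × 𝔤) → 𝔤} (S : IsLocExpGroup U D m d)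
  (G : LocExpLieGroup 𝔥) {V : Set 𝔤}

/-- The product `x * ty` lies in `V ∩ 𝔥` and corresponds to the product in the Lie group of `𝔥`. -/
def IsGoodProduct (m : 𝔤 × 𝔤 → 𝔤) (G : LocExpLieGroup 𝔥) (V : Set 𝔤) (x y : 𝔥) (t : ℝ) : Prop :=
  ∃ c : 𝔥, (c : 𝔤) = m (x, t • (y : 𝔤)) ∧ (c : 𝔤) ∈ V ∧ G.exp c = G.exp x * G.exp (t • y)

namespace IsLocExpGroup
include S

variable {G}

/-- The path from `0` to `x * ty` obtained by moving inside `C` from `0` to `x`, and then along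
`r ↦ x * ry`. -/
lemma isPreconnected_path {C : Set 𝔤} (hC : IsPreconnected C) {x y : 𝔥} (hx : (x : 𝔤) ∈ C)
    (hxU : (x : 𝔤) ∈ U) (hD : ∀ r ∈ Icc (0 : ℝ) 1, ((x : 𝔤), r • (y : 𝔤)) ∈ D) {t : ℝ}
    (ht : t ∈ Icc (0 : ℝ) 1) :
    IsPreconnected (C ∪ (fun r : ℝ => m ((x : 𝔤), r • (y : 𝔤))) '' Icc 0 t) := by
  refine hC.union (x : 𝔤) hx ⟨0, ⟨le_rfl, ht.1⟩, by simp only [zero_smul, S.mul_zero hxU]⟩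
    (isPreconnected_Icc.image _ fun r hr => ContinuousAt.continuousWithinAt ?_)
  exact S.tendsto_mul (hD r ⟨hr.1, hr.2.trans ht.2⟩) tendsto_const_nhds
    (Continuous.tendsto (by fun_prop : Continuous fun r : ℝ => r • (y : 𝔤)) r)

/-- The set of good parameters is open on the right: continue the path from `0` to `x * ty` by
`s ↦ (x * ty) * sy`. -/
lemma exists_gt_isGoodProduct (hV : IsSymmNhd U D V) (h𝔥 : IsClosed (𝔥 : Set 𝔤)) {C : Set 𝔤}
    (hC : IsPreconnected C) (hCV : C ⊆ V) (hC𝔥 : C ⊆ 𝔥) (h0 : (0 : 𝔤) ∈ C) {x y : 𝔥}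
    (hx : (x : 𝔤) ∈ C) (hyU : (y : 𝔤) ∈ U)
    (hxy : ∀ r : ℝ, |r| ≤ 1 → ((x : 𝔤), r • (y : 𝔤)) ∈ D ∧
      ∃ z : 𝔥, (z : 𝔤) ∈ V ∧ G.exp z = G.exp x * G.exp (r • y)) {t : ℝ} (ht : t ∈ Ico (0 : ℝ) 1)
    (hgood : ∀ r ∈ Icc 0 t, IsGoodProduct m G V x y r) :
    ∃ t' ∈ Ioc t 1, ∀ r ∈ Icc 0 t', IsGoodProduct m G V x y r := by
  obtain ⟨w, hw, hwV, hwexp⟩ := hgood t ⟨ht.1, le_rfl⟩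
  have hwU := hV.subset hwV
  have ht1 : |t| ≤ 1 := abs_le_one_of_mem_Icc ⟨ht.1, ht.2.le⟩
  have hD := (hxy t ht1).1
  have hline : Tendsto (fun s : ℝ => s • (y : 𝔤)) (𝓝 0) (𝓝 0) :=
    Continuous.tendsto' (by fun_prop) _ _ (by simp)
  have e : ∀ᶠ s : ℝ in 𝓝 0, ((w : 𝔤), s • (y : 𝔤)) ∈ D ∧ m ((w : 𝔤), s • (y : 𝔤)) ∈ V ∧
      m ((w : 𝔤), s • (y : 𝔤)) = m ((x : 𝔤), (t + s) • (y : 𝔤)) := by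
    have e1 := S.eventually_mem (S.mem_zero hwU) tendsto_const_nhds hline
    have e2 := S.tendsto_mul (S.mem_zero hwU) tendsto_const_nhds hline
    rw [S.mul_zero hwU] at e2
    have e3 := S.eventually_assoc hD (S.mem_zero (S.snd_mem hD))
      (by rw [← hw]; exact S.mem_zero hwU) tendsto_const_nhds tendsto_const_nhds hline
    filter_upwards [e1, e2.eventually (hV.isOpen.mem_nhds hwV), e3,
      S.eventually_smul_mul hyU ht1] with s e1 e2 e3 e4
    refine ⟨e1, e2, ?_⟩
    rw [hw, e3, e4.1.2]
  obtain ⟨ε₀, hε₀, hball⟩ := Metric.eventually_nhds_iff.1 e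
  set ε := min (ε₀ / 2) (1 - t) with hε
  have hεpos : 0 < ε := lt_min (half_pos hε₀) (sub_pos.2 ht.2)
  have hε1 : ε ≤ 1 - t := min_le_right _ _
  have hsε {s : ℝ} (hs : |s| ≤ 1) : |s * ε| ≤ ε := by
    rw [abs_mul, abs_of_pos hεpos]
    exact mul_le_of_le_one_left hεpos.le hs
  have hb {s : ℝ} (hs : |s| ≤ 1) := hball (y := s * ε) (by
    rw [Real.dist_0_eq_abs]
    exact (hsε hs).trans_lt ((min_le_left _ _).trans_lt (half_lt_self hε₀)))
  have hC' := S.isPreconnected_path hC hx (hV.subset (hCV hx))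
    (fun r hr => (hxy r (abs_le_one_of_mem_Icc hr)).1) ⟨ht.1, ht.2.le⟩ (y := y)
  have key {s : ℝ} (hs : |s| < 1) := S.mul_smul_mem G hV h𝔥 hC' (w := w) (u := ε • y)
    (by
      rintro ρ (hρ | ⟨r, hr, rfl⟩)
      · exact hCV hρ
      · obtain ⟨c, hc, hcV, -⟩ := hgood r hr
        simp only [← hc, hcV])
    (by
      rintro ρ (hρ | ⟨r, hr, rfl⟩)
      · exact hC𝔥 hρ
      · obtain ⟨c, hc, -, -⟩ := hgood r hr
        simp only [← hc, SetLike.mem_coe, SetLike.coe_mem])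
    (Or.inl h0) (Or.inr ⟨t, ⟨ht.1, le_rfl⟩, hw.symm⟩)
    (fun s hs => by
      have e1 : s • ((ε • y : 𝔥) : 𝔤) = (s * ε) • (y : 𝔤) := (mul_smul s ε (y : 𝔤)).symm
      have e2 := abs_le.1 (hsε hs)
      have e3 : |t + s * ε| ≤ 1 := abs_le.2 ⟨by linarith [ht.1, ht.2], by linarith⟩
      obtain ⟨-, z, hzV, hz⟩ := hxy _ e3
      rw [e1]
      refine ⟨(hb hs).1, (hb hs).2.1, z, hzV, ?_⟩
      rw [hz, hwexp, smul_smul, mul_assoc, ← G.exp_add]) hs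
  refine ⟨t + ε / 2, ⟨by linarith, by linarith⟩, fun r hr => ?_⟩
  by_cases hrt : r ≤ t
  · exact hgood r ⟨hr.1, hrt⟩
  · set s := (r - t) / ε with hs
    have hsr : t + s * ε = r := by
      rw [hs, div_mul_cancel₀ _ hεpos.ne']
      ring
    have hs0 : 0 ≤ s := div_nonneg (by linarith) hεpos.le
    have hs1 : |s| < 1 := by
      rw [abs_of_nonneg hs0, hs, div_lt_one hεpos]
      linarith [hr.2]
    obtain ⟨c, hc, hcexp⟩ := key hs1
    have e1 : s • ((ε • y : 𝔥) : 𝔤) = (s * ε) • (y : 𝔤) := (mul_smul s ε (y : 𝔤)).symm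
    rw [e1] at hc
    refine ⟨c, ?_, ?_, ?_⟩
    · rw [hc, (hb hs1.le).2.2, hsr]
    · rw [hc]
      exact (hb hs1.le).2.1
    · rw [hcexp, hwexp, smul_smul, mul_assoc, ← G.exp_add, hsr]

/-- The set of good parameters is closed. The limit `c₀ = x * ty` of good products lies in `𝔥`, but
might have left `V`; it has the same exponential as the logarithm `z ∈ V` of `exp x * exp ty`. By
uniqueness of logarithms up to commuting elements, `z - c₀` is central in `𝔥` and is annihilated by
`exp`, so injectivity of `exp` on `V ∩ 𝔥`, applied near `z`, gives `z = c₀`. -/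
lemma isGoodProduct_of_lt (hV : IsSymmNhd U D V) (h𝔥 : IsClosed (𝔥 : Set 𝔤))
    (hinj : InjOn G.exp {x | (x : 𝔤) ∈ V}) {C : Set 𝔤}
    (hC : IsPreconnected C) (hCV : C ⊆ V) (hC𝔥 : C ⊆ 𝔥) (h0 : (0 : 𝔤) ∈ C) {x y : 𝔥}
    (hx : (x : 𝔤) ∈ C)
    (hxy : ∀ r : ℝ, |r| ≤ 1 → ((x : 𝔤), r • (y : 𝔤)) ∈ D ∧
      ∃ z : 𝔥, (z : 𝔤) ∈ V ∧ G.exp z = G.exp x * G.exp (r • y)) {t : ℝ} (ht : t ∈ Ioc (0 : ℝ) 1)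
    (hgood : ∀ r ∈ Ico 0 t, IsGoodProduct m G V x y r) : IsGoodProduct m G V x y t := by
  have ht1 : |t| ≤ 1 := abs_le_one_of_mem_Icc ⟨ht.1.le, ht.2⟩
  obtain ⟨hD, z, hzV, hzexp⟩ := hxy t ht1
  have hzU := hV.subset hzV
  have hVD {a b : 𝔤} (ha : a ∈ V) (hb : b ∈ V) : (a, -b) ∈ D := hV.prod_subset ⟨ha, hV.symm b hb⟩
  -- `c τ = x * (t - τ) y`
  have hc (τ : ℝ) : ∃ c : 𝔥, τ ∈ Ioc 0 t → (c : 𝔤) = m ((x : 𝔤), (t - τ) • (y : 𝔤)) ∧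
      (c : 𝔤) ∈ V ∧ G.exp c = G.exp x * G.exp ((t - τ) • y) := by
    by_cases hτ : τ ∈ Ioc 0 t
    · obtain ⟨c, hc⟩ := hgood (t - τ) ⟨by linarith [hτ.2], by linarith [hτ.1]⟩
      exact ⟨c, fun _ => hc⟩
    · exact ⟨0, fun h => absurd h hτ⟩
  choose c hc using hc
  have hτ : ∀ᶠ τ : ℝ in 𝓝[>] 0, τ ∈ Ioc 0 t := Ioc_mem_nhdsGT ht.1
  have hlim : Tendsto (fun τ : ℝ => (t - τ) • (y : 𝔤)) (𝓝[>] 0) (𝓝 (t • (y : 𝔤))) :=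
    Tendsto.mono_left (Continuous.tendsto' (by fun_prop) _ _ (by simp)) nhdsWithin_le_nhds
  have hclim : Tendsto (fun τ => (c τ : 𝔤)) (𝓝[>] 0) (𝓝 (m ((x : 𝔤), t • (y : 𝔤)))) := by
    refine (S.tendsto_mul hD tendsto_const_nhds hlim).congr' ?_
    filter_upwards [hτ] with τ hτ using (hc τ hτ).1.symm
  obtain ⟨c₀, hc₀⟩ : ∃ c₀ : 𝔥, (c₀ : 𝔤) = m ((x : 𝔤), t • (y : 𝔤)) :=
    ⟨⟨_, h𝔥.mem_of_tendsto hclim (Eventually.of_forall fun τ => (c τ).2)⟩, rfl⟩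
  have hclim' : Tendsto c (𝓝[>] 0) (𝓝 c₀) := by
    rw [tendsto_subtype_rng, hc₀]
    exact hclim
  have hnlim : Tendsto (fun τ : ℝ => -τ • (y : 𝔤)) (𝓝[>] 0) (𝓝 0) :=
    Tendsto.mono_left (Continuous.tendsto' (by fun_prop) _ _ (by simp)) nhdsWithin_le_nhds
  have hzlim : Tendsto (fun τ : ℝ => m ((z : 𝔤), -τ • (y : 𝔤))) (𝓝[>] 0) (𝓝 z) := by
    have := S.tendsto_mul (S.mem_zero hzU) tendsto_const_nhds hnlim
    rwa [S.mul_zero hzU] at this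
  have hcexp : G.exp c₀ = G.exp z := by
    have := G.isLCLieGroup.hausdorff
    have l1 : Tendsto (fun τ => G.exp (c τ)) (𝓝[>] 0) (𝓝 (G.exp c₀)) :=
      (G.exp_continuous.tendsto _).comp hclim'
    have l2 : Tendsto (fun τ : ℝ => G.exp x * G.exp ((t - τ) • y)) (𝓝[>] 0)
        (𝓝 (G.exp x * G.exp (t • y))) := by
      have l3 : Continuous fun τ : ℝ => G.exp ((t - τ) • y) := G.exp_continuous.comp (by fun_prop)
      have l4 : Continuous fun τ : ℝ => G.exp x * G.exp ((t - τ) • y) :=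
        G.continuous_mul.comp (continuous_const.prodMk l3)
      exact Tendsto.mono_left (l4.tendsto' _ _ (by rw [sub_zero])) nhdsWithin_le_nhds
    rw [hzexp]
    refine tendsto_nhds_unique l1 (l2.congr' ?_)
    filter_upwards [hτ] with τ hτ using (hc τ hτ).2.2.symm
  -- `z * (-τ) y` and `c τ` differ by an element which commutes with `𝔥`
  have hcentral : ∀ k : 𝔥, ⁅z - c₀, k⁆ = 0 := by
    intro k
    refine Subtype.ext ?_
    change ⁅(z : 𝔤) - c₀, (k : 𝔤)⁆ = 0
    have l1 : Tendsto (fun τ : ℝ => ⁅m ((z : 𝔤), -τ • (y : 𝔤)) - c τ, (k : 𝔤)⁆) (𝓝[>] 0)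
        (𝓝 ⁅(z : 𝔤) - c₀, (k : 𝔤)⁆) := by
      rw [hc₀]
      have l2 := (hzlim.sub hclim).prodMk_nhds (tendsto_const_nhds (x := (k : 𝔤)))
      exact (LocallyConvexLieAlgebra.continuous_lie.tendsto _).comp l2
    refine tendsto_nhds_unique l1 (tendsto_const_nhds.congr' ?_)
    filter_upwards [hτ, hzlim.eventually (hV.isOpen.mem_nhds hzV),
      S.eventually_mem (S.mem_zero hzU) tendsto_const_nhds hnlim] with τ hτ hzτ hzD
    obtain ⟨h1, hcV, h3⟩ := hc τ hτ
    have hcU := hV.subset hcV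
    have heq : ∀ k ∈ 𝔥, locAd d (m ((z : 𝔤), -τ • (y : 𝔤))) k = locAd d (c τ : 𝔤) k := by
      intro k hk
      have e1 := S.locAd_coe G hcU ⟨k, hk⟩
      have e2 := S.locAd_coe G (x := -τ • y) (S.snd_mem hzD) ⟨k, hk⟩
      have e3 := S.locAd_coe G hzU (G.Ad (G.exp (-τ • y)) ⟨k, hk⟩)
      have e4 : G.exp (c τ) = G.exp z * G.exp (-τ • y) := by
        rw [h3, hzexp, mul_assoc, ← G.exp_add, sub_eq_add_neg]
      rw [e4, G.Ad_exp_mul, ← e3, ← e2] at e1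
      rw [S.locAd_mul hzD, e1]
      rfl
    have hcomm {k : 𝔤} (hk : k ∈ 𝔥) : ⁅m (m ((z : 𝔤), -τ • (y : 𝔤)), -(c τ : 𝔤)), k⁆ = 0 :=
      S.lie_mul_neg_eq_zero (hVD hzτ hcV) heq (fun k hk => S.exists_locAd_eq G hcU hk) hk
    have hC' := S.isPreconnected_path hC hx (hV.subset (hCV hx))
      (fun r hr => (hxy r (abs_le_one_of_mem_Icc hr)).1) (y := y) (t := t - τ)
      ⟨by linarith [hτ.2], by linarith [hτ.1, ht.2]⟩
    have hC'V : C ∪ (fun r : ℝ => m ((x : 𝔤), r • (y : 𝔤))) '' Icc 0 (t - τ) ⊆ V := by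
      rintro ρ (hρ | ⟨r, hr, rfl⟩)
      · exact hCV hρ
      · obtain ⟨c, hc, hcV, -⟩ := hgood r ⟨hr.1, by linarith [hr.2, hτ.1]⟩
        simp only [← hc, hcV]
    have hC'𝔥 : C ∪ (fun r : ℝ => m ((x : 𝔤), r • (y : 𝔤))) '' Icc 0 (t - τ) ⊆ 𝔥 := by
      rintro ρ (hρ | ⟨r, hr, rfl⟩)
      · exact hC𝔥 hρ
      · obtain ⟨c, hc, -, -⟩ := hgood r ⟨hr.1, by linarith [hr.2, hτ.1]⟩
        simp only [← hc, SetLike.mem_coe, SetLike.coe_mem]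
    have h5 := S.eq_add_of_comm hC' (Or.inl h0)
      (Or.inr ⟨t - τ, ⟨by linarith [hτ.2], le_rfl⟩, h1.symm⟩)
      (fun ρ hρ => hVD hzτ (hC'V hρ)) (fun ρ hρ => hVD hcV (hC'V hρ))
      (fun ρ hρ σ hσ => hVD (hC'V hρ) (hC'V hσ)) (fun ρ hρ => hcomm (hC'𝔥 hρ))
    have h6 : m ((z : 𝔤), -τ • (y : 𝔤)) - c τ = m (m ((z : 𝔤), -τ • (y : 𝔤)), -(c τ : 𝔤)) :=
      sub_eq_iff_eq_add.2 h5
    rw [h6, hcomm k.2]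
  -- so `z - c₀` lies in the kernel of `exp`, and injectivity shows that it vanishes
  have hker : G.exp (z - c₀) = 1 := by
    have h1 := G.exp_add_of_central (c := c₀) hcentral
    rwa [add_sub_cancel, hcexp, left_eq_mul] at h1
  have hzc : z - c₀ = 0 := by
    have l1 : Tendsto (fun τ => ((c τ + (z - c₀) : 𝔥) : 𝔤)) (𝓝[>] 0) (𝓝 z) := by
      have l2 := hclim'.add_const (z - c₀)
      rw [add_sub_cancel, tendsto_subtype_rng] at l2
      exact l2
    obtain ⟨τ, hτ, hV'⟩ := (hτ.and (l1.eventually (hV.isOpen.mem_nhds hzV))).exists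
    have h1 := hinj (show c τ + (z - c₀) ∈ {x : 𝔥 | (x : 𝔤) ∈ V} from hV') (hc τ hτ).2.1 (by
      rw [G.exp_add_of_central hcentral, hker, mul_one])
    simpa using h1
  have hzc' : z = c₀ := sub_eq_zero.1 hzc
  exact ⟨z, by rw [hzc', hc₀], hzV, hzexp⟩

lemma isGoodProduct_one (hV : IsSymmNhd U D V) (h𝔥 : IsClosed (𝔥 : Set 𝔤))
    (hinj : InjOn G.exp {x | (x : 𝔤) ∈ V}) {C : Set 𝔤}
    (hC : IsPreconnected C) (hCV : C ⊆ V) (hC𝔥 : C ⊆ 𝔥) (h0 : (0 : 𝔤) ∈ C) {x y : 𝔥}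
    (hx : (x : 𝔤) ∈ C) (hyU : (y : 𝔤) ∈ U)
    (hxy : ∀ r : ℝ, |r| ≤ 1 → ((x : 𝔤), r • (y : 𝔤)) ∈ D ∧
      ∃ z : 𝔥, (z : 𝔤) ∈ V ∧ G.exp z = G.exp x * G.exp (r • y)) :
    ∀ t ∈ Icc (0 : ℝ) 1, IsGoodProduct m G V x y t := by
  have hgood0 : IsGoodProduct m G V x y 0 :=
    ⟨x, by rw [zero_smul, S.mul_zero (hV.subset (hCV hx))], hCV hx, by
      rw [zero_smul, G.exp_zero, mul_one]⟩
  set T : Set ℝ := {t | ∀ r ∈ Icc 0 t, IsGoodProduct m G V x y r} with hT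
  have hclosed : IsClosed (T ∩ Icc 0 1) := by
    refine isClosed_of_closure_subset fun t ht => ?_
    have ht1 : t ∈ Icc (0 : ℝ) 1 := closure_minimal inter_subset_right isClosed_Icc ht
    have hlt : ∀ r ∈ Ico 0 t, IsGoodProduct m G V x y r := by
      intro r hr
      obtain ⟨t', ht', hT', -⟩ := mem_closure_iff.1 ht (Ioi r) isOpen_Ioi hr.2
      exact hT' r ⟨hr.1, (le_of_lt ht')⟩
    refine ⟨fun r hr => ?_, ht1⟩
    rcases hr.2.lt_or_eq with h | rfl
    · exact hlt r ⟨hr.1, h⟩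
    · rcases hr.1.lt_or_eq with h | rfl
      · exact S.isGoodProduct_of_lt hV h𝔥 hinj hC hCV hC𝔥 h0 hx hxy ⟨h, ht1.2⟩ hlt
      · exact hgood0
  have h1 : (1 : ℝ) ∈ T := by
    refine hclosed.mem_of_ge_of_forall_exists_gt (fun r hr => ?_) zero_le_one fun t ht => ?_
    · rw [le_antisymm hr.2 hr.1]
      exact hgood0
    · obtain ⟨t', ht', h⟩ := S.exists_gt_isGoodProduct hV h𝔥 hC hCV hC𝔥 h0 hx hyU hxy ht.2 ht.1
      exact ⟨t', h, ht'⟩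
  exact h1

/-- If all products of exponentials of a `p`-ball in `𝔥` have logarithms in `V`, then these
logarithms are given by the product of the local group. -/
theorem exists_coe_eq_mul (hV : IsSymmNhd U D V) (hV0 : (0 : 𝔤) ∈ V) (h𝔥 : IsClosed (𝔥 : Set 𝔤))
    (hinj : InjOn G.exp {x | (x : 𝔤) ∈ V}) (p : Seminorm ℝ 𝔤)
    (hD : ∀ x y : 𝔤, p x < 1 → p y < 1 → (x, y) ∈ D)
    (hexp : ∀ x y : 𝔥, p x < 1 → p y < 1 → ∃ z : 𝔥, (z : 𝔤) ∈ V ∧ G.exp z = G.exp x * G.exp y)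
    {x y : 𝔥} (hx : p x < 1) (hy : p y < 1) :
    ∃ z : 𝔥, (z : 𝔤) = m (x, y) ∧ (z : 𝔤) ∈ V ∧ G.exp z = G.exp x * G.exp y := by
  have hp {y : 𝔥} (hy : p y < 1) {r : ℝ} (hr : |r| ≤ 1) : p (r • y : 𝔥) < 1 := by
    change p (r • (y : 𝔤)) < 1
    rw [map_smul_eq_mul]
    exact (mul_le_of_le_one_left (apply_nonneg p _) hr).trans_lt hy
  have hU {y : 𝔥} (hy : p y < 1) : (y : 𝔤) ∈ U := S.snd_mem (hD y y hy hy)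
  have hp0 : p ((0 : 𝔥) : 𝔤) < 1 := by simp
  -- the ball itself lies in `V`: use that `0 * y = y`
  have hball {y : 𝔥} (hy : p y < 1) : ∀ t ∈ Icc (0 : ℝ) 1, t • (y : 𝔤) ∈ V := by
    intro t ht
    obtain ⟨c, hc, hcV, -⟩ := S.isGoodProduct_one (C := {0}) (x := 0) hV h𝔥 hinj
      isPreconnected_singleton (by simpa using hV0) (by simp) rfl rfl (hU hy)
      (fun r hr => ⟨hD _ _ hp0 (hp hy hr), hexp 0 (r • y) hp0 (hp hy hr)⟩) t ht
    have h1 : m (((0 : 𝔥) : 𝔤), t • (y : 𝔤)) = t • (y : 𝔤) :=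
      S.zero_mul (S.smul_mem (hU hy) (abs_le_one_of_mem_Icc ht))
    rwa [hc, h1] at hcV
  have h1 := S.isGoodProduct_one (C := (fun r : ℝ => r • (x : 𝔤)) '' Icc 0 1) (x := x) hV h𝔥 hinj
    (isPreconnected_Icc.image _ (by fun_prop)) (by rintro _ ⟨r, hr, rfl⟩; exact hball hx r hr)
    (by rintro _ ⟨r, hr, rfl⟩; exact 𝔥.smul_mem r x.2) ⟨0, by simp⟩ ⟨1, by simp⟩ (hU hy)
    (fun r hr => ⟨hD _ _ hx (hp hy hr), hexp x (r • y) hx (hp hy hr)⟩) 1 (by simp)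
  simpa only [IsGoodProduct, one_smul] using h1

end IsLocExpGroup
end Subalgebra

/-! ### Finite and infinitesimal vectors -/

section Nonstandard

variable {ι : Type v} {𝒰 : Ultrafilter ι} {E F : Type*}
  [AddCommGroup E] [Module ℝ E] [TopologicalSpace E]
  [AddCommGroup F] [Module ℝ F] [TopologicalSpace F]

lemma isFin_iff {x : ι → E} : IsFin (nsPoint 𝒰 x) ↔
    ∀ p : Seminorm ℝ E, Continuous p → ∃ C : ℝ, ∀ᶠ i in 𝒰, p (x i) ≤ C := Iff.rfl

lemma isInfinitesimal_iff {x : ι → E} : IsInfinitesimal (nsPoint 𝒰 x) ↔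
    ∀ p : Seminorm ℝ E, Continuous p → ∀ ε : ℝ, 0 < ε → ∀ᶠ i in 𝒰, p (x i) < ε := Iff.rfl

lemma isInfinitesimal_iff_tendsto {x : ι → E} : IsInfinitesimal (nsPoint 𝒰 x) ↔
    ∀ p : Seminorm ℝ E, Continuous p → Tendsto (fun i => p (x i)) 𝒰 (𝓝 0) := by
  refine ⟨fun h p hp => ?_, fun h p hp ε hε => (h p hp).eventually (gt_mem_nhds hε)⟩
  rw [Metric.tendsto_nhds]
  intro ε hε
  filter_upwards [isInfinitesimal_iff.1 h p hp ε hε] with i hi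
  rwa [Real.dist_0_eq_abs, abs_of_nonneg (apply_nonneg p _)]

lemma isFin_add {x y : ι → E} (hx : IsFin (nsPoint 𝒰 x)) (hy : IsFin (nsPoint 𝒰 y)) :
    IsFin (nsPoint 𝒰 fun i => x i + y i) := hx.add hy

lemma isFin_const (x : E) : IsFin (nsPoint 𝒰 fun _ => x) := fun p _ =>
  ⟨p x, Eventually.of_forall fun _ => le_rfl⟩

lemma isInfinitesimal_zero : IsInfinitesimal (nsPoint 𝒰 fun _ : ι => (0 : E)) :=
  IsInfinitesimal.zero

lemma isInfinitesimal_add {x y : ι → E} (hx : IsInfinitesimal (nsPoint 𝒰 x))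
    (hy : IsInfinitesimal (nsPoint 𝒰 y)) : IsInfinitesimal (nsPoint 𝒰 fun i => x i + y i) :=
  hx.add hy

lemma isInfinitesimal_neg {x : ι → E} (hx : IsInfinitesimal (nsPoint 𝒰 x)) :
    IsInfinitesimal (nsPoint 𝒰 fun i => -x i) := by
  have := hx.smul (-1)
  change IsInfinitesimal (nsPoint 𝒰 fun i => (-1 : ℝ) • x i) at this
  simpa using this

lemma isInfinitesimal_congr {x y : ι → E} (hx : IsInfinitesimal (nsPoint 𝒰 x))
    (hxy : ∀ᶠ i in 𝒰, x i = y i) : IsInfinitesimal (nsPoint 𝒰 y) := fun p hp ε hε => by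
  have h1 := isInfinitesimal_iff.1 hx p hp ε hε
  change ∀ᶠ i in 𝒰, p (y i) < ε
  filter_upwards [h1, hxy] with i h1 h2
  rwa [← h2]

lemma isInfinitesimal_symm {x y : ι → E} (h : IsInfinitesimal (nsPoint 𝒰 fun i => x i - y i)) :
    IsInfinitesimal (nsPoint 𝒰 fun i => y i - x i) := by
  simpa using isInfinitesimal_neg h

lemma isInfinitesimal_trans {x y z : ι → E} (h : IsInfinitesimal (nsPoint 𝒰 fun i => x i - y i))
    (h' : IsInfinitesimal (nsPoint 𝒰 fun i => y i - z i)) :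
    IsInfinitesimal (nsPoint 𝒰 fun i => x i - z i) := by
  simpa using isInfinitesimal_add h h'

lemma isFin_of_isInfinitesimal {x : ι → E} (h : IsInfinitesimal (nsPoint 𝒰 x)) :
    IsFin (nsPoint 𝒰 x) := fun p hp =>
  ⟨1, (isInfinitesimal_iff.1 h p hp 1 one_pos).mono fun _ hi => hi.le⟩

lemma isFin_of_near {x y : ι → E} (hx : IsFin (nsPoint 𝒰 x))
    (h : IsInfinitesimal (nsPoint 𝒰 fun i => y i - x i)) : IsFin (nsPoint 𝒰 y) := by
  simpa using isFin_add (isFin_of_isInfinitesimal h) hx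

lemma isFin_smul {δ : ι → ℝ} {c : ℝ} {x : ι → E} (hδ : Tendsto δ 𝒰 (𝓝 c))
    (hx : IsFin (nsPoint 𝒰 x)) : IsFin (nsPoint 𝒰 fun i => δ i • x i) := fun p hp => by
  obtain ⟨C, hC⟩ := isFin_iff.1 hx p hp
  refine ⟨(|c| + 1) * |C|, ?_⟩
  change ∀ᶠ i in 𝒰, p (δ i • x i) ≤ (|c| + 1) * |C|
  filter_upwards [hC, hδ.abs.eventually (gt_mem_nhds (lt_add_one |c|))] with i h1 h2
  rw [map_smul_eq_mul, Real.norm_eq_abs]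
  exact mul_le_mul h2.le (h1.trans (le_abs_self C)) (apply_nonneg p _) (by positivity)

/-- Infinitesimal multiples of finite vectors are infinitesimal. -/
lemma isInfinitesimal_smul {δ : ι → ℝ} {x : ι → E} (hδ : Tendsto δ 𝒰 (𝓝 0))
    (hx : IsFin (nsPoint 𝒰 x)) : IsInfinitesimal (nsPoint 𝒰 fun i => δ i • x i) := by
  rw [isInfinitesimal_iff_tendsto]
  intro p hp
  have h1 := hδ.abs.mul (tendsto_seminorm_standardPart hx p hp)
  rw [abs_zero, zero_mul] at h1
  refine h1.congr fun i => ?_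
  rw [map_smul_eq_mul, Real.norm_eq_abs]

lemma seminorm_prod_le (P : Seminorm ℝ (E × F)) (hP : Continuous P) :
    ∃ (p : Seminorm ℝ E) (q : Seminorm ℝ F), Continuous p ∧ Continuous q ∧
      ∀ x y, P (x, y) ≤ p x + q y := by
  refine ⟨P.comp (LinearMap.inl ℝ E F), P.comp (LinearMap.inr ℝ E F), ?_, ?_, fun x y => ?_⟩
  · exact hP.comp (continuous_id.prodMk continuous_const)
  · exact hP.comp (continuous_const.prodMk continuous_id)
  · have := map_add_le_add P (x, 0) (0, y)
    simpa using this

lemma isFin_prod {x : ι → E} {y : ι → F} (hx : IsFin (nsPoint 𝒰 x)) (hy : IsFin (nsPoint 𝒰 y)) :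
    IsFin (nsPoint 𝒰 fun i => (x i, y i)) := fun P hP => by
  obtain ⟨p, q, hp, hq, h⟩ := seminorm_prod_le P hP
  obtain ⟨C, hC⟩ := isFin_iff.1 hx p hp
  obtain ⟨C', hC'⟩ := isFin_iff.1 hy q hq
  refine ⟨C + C', ?_⟩
  change ∀ᶠ i in 𝒰, P (x i, y i) ≤ C + C'
  filter_upwards [hC, hC'] with i h1 h2
  exact (h _ _).trans (add_le_add h1 h2)

lemma isInfinitesimal_prod {x : ι → E} {y : ι → F} (hx : IsInfinitesimal (nsPoint 𝒰 x))
    (hy : IsInfinitesimal (nsPoint 𝒰 y)) : IsInfinitesimal (nsPoint 𝒰 fun i => (x i, y i)) := by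
  intro P hP ε hε
  obtain ⟨p, q, hp, hq, h⟩ := seminorm_prod_le P hP
  change ∀ᶠ i in 𝒰, P (x i, y i) < ε
  filter_upwards [isInfinitesimal_iff.1 hx p hp _ (half_pos hε),
    isInfinitesimal_iff.1 hy q hq _ (half_pos hε)] with i h1 h2
  linarith [h (x i) (y i)]

lemma isInfinitesimal_fst {x : ι → E × F} (hx : IsInfinitesimal (nsPoint 𝒰 x)) :
    IsInfinitesimal (nsPoint 𝒰 fun i => (x i).1) := fun p hp ε hε =>
  hx (p.comp (LinearMap.fst ℝ E F)) (hp.comp continuous_fst) ε hε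

lemma isInfinitesimal_snd {x : ι → E × F} (hx : IsInfinitesimal (nsPoint 𝒰 x)) :
    IsInfinitesimal (nsPoint 𝒰 fun i => (x i).2) := fun p hp ε hε =>
  hx (p.comp (LinearMap.snd ℝ E F)) (hp.comp continuous_snd) ε hε

lemma InIntStar.near {O : Set E} {a b : ι → E} (ha : InIntStar 𝒰 O a)
    (hab : IsInfinitesimal (nsPoint 𝒰 fun i => b i - a i)) : InIntStar 𝒰 O b := fun c hc =>
  ha c (isInfinitesimal_trans hc hab)

lemma InIntStar.eventually_mem {O : Set E} {a : ι → E} (ha : InIntStar 𝒰 O a) :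
    ∀ᶠ i in 𝒰, a i ∈ O :=
  ha a (by simpa using isInfinitesimal_zero)

lemma inIntStar_const [IsTopologicalAddGroup E] [ContinuousSMul ℝ E] [LocallyConvexSpace ℝ E]
    {O : Set E} (hO : IsOpen O) {a : E} (ha : a ∈ O) : InIntStar 𝒰 O fun _ => a := by
  intro b hb
  have h1 : Tendsto b 𝒰 (𝓝 a) := by
    rw [tendsto_iff_contSeminorm]
    exact fun q ε hε => isInfinitesimal_iff.1 hb q.1 q.2 ε hε
  exact h1.eventually (hO.mem_nhds ha)

/-! ### Uniformly smooth maps -/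

lemma MultilinearMap.map_snoc_neg {E F : Type*} [AddCommGroup E] [Module ℝ E] [AddCommGroup F]
    [Module ℝ F] {k : ℕ} (L : MultilinearMap ℝ (fun _ : Fin (k + 1) => E) F) (h : Fin k → E)
    (x : E) :
    L (Fin.snoc (α := fun _ => E) h (-x)) = -L (Fin.snoc (α := fun _ => E) h x) := by
  have h1 := L.map_update_smul (Fin.snoc (α := fun _ => E) h x) (Fin.last k) (-1) x
  rwa [Fin.update_snoc_last, Fin.update_snoc_last, neg_one_smul, neg_one_smul] at h1

variable (𝒰) in
/-- The maps `d^k` witness that `f : O → F` is uniformly smooth at finite points. -/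
structure UniformDerivs (f : E → F) (O : Set E)
    (d : (k : ℕ) → E → MultilinearMap ℝ (fun _ : Fin k => E) F) : Prop where
  zero : ∀ a ∈ O, ∀ h : Fin 0 → E, d 0 a h = f a
  isFin : ∀ (k : ℕ) (a : ι → E), InIntStar 𝒰 O a → IsFin (nsPoint 𝒰 a) →
    ∀ h : Fin (k + 1) → ι → E, (∀ j, IsFin (nsPoint 𝒰 (h j))) →
      IsFin (nsPoint 𝒰 fun i => d (k + 1) (a i) fun j => h j i)
  quotient_pos : ∀ (k : ℕ) (a : ι → E), InIntStar 𝒰 O a → IsFin (nsPoint 𝒰 a) →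
    ∀ (x : ι → E) (h : Fin k → ι → E) (δ : ι → ℝ),
      IsFin (nsPoint 𝒰 x) → (∀ j, IsFin (nsPoint 𝒰 (h j))) →
      (∀ᶠ i in 𝒰, 0 < δ i) → Tendsto δ 𝒰 (𝓝 0) →
      IsInfinitesimal (nsPoint 𝒰 fun i =>
        (δ i)⁻¹ • (d k (a i + δ i • x i) (fun j => h j i) - d k (a i) fun j => h j i) -
          d (k + 1) (a i) (Fin.snoc (α := fun _ => E) (fun j => h j i) (x i)))

lemma UniformlySmoothAtFinitePoints.exists_uniformDerivs {f : E → F} {O : Set E}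
    (h : UniformlySmoothAtFinitePoints 𝒰 f O) : ∃ d, UniformDerivs 𝒰 f O d := by
  obtain ⟨d, h0, h1⟩ := h
  exact ⟨d, h0, fun k a ha hf => (h1 k a ha hf).1, fun k a ha hf => (h1 k a ha hf).2⟩

variable (𝒰 E) in
/-- Every infinitesimal vector is the product of a positive infinitesimal and a finite vector. -/
def HasScale : Prop :=
  ∀ x : ι → E, IsInfinitesimal (nsPoint 𝒰 x) → ∃ δ : ι → ℝ, (∀ᶠ i in 𝒰, 0 < δ i) ∧
    Tendsto δ 𝒰 (𝓝 0) ∧ IsFin (nsPoint 𝒰 fun i => (δ i)⁻¹ • x i)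

namespace UniformDerivs

variable {f : E → F} {O : Set E} {d : (k : ℕ) → E → MultilinearMap ℝ (fun _ : Fin k => E) F}
  (H : UniformDerivs 𝒰 f O d)
include H

/-- The difference quotients converge for infinitesimals of both signs. -/
lemma quotient {k : ℕ} {a : ι → E} (ha : InIntStar 𝒰 O a) (hf : IsFin (nsPoint 𝒰 a))
    {x : ι → E} {h : Fin k → ι → E} {δ : ι → ℝ} (hx : IsFin (nsPoint 𝒰 x))
    (hh : ∀ j, IsFin (nsPoint 𝒰 (h j))) (hδ0 : ∀ᶠ i in 𝒰, δ i ≠ 0) (hδ : Tendsto δ 𝒰 (𝓝 0)) :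
    IsInfinitesimal (nsPoint 𝒰 fun i =>
      (δ i)⁻¹ • (d k (a i + δ i • x i) (fun j => h j i) - d k (a i) fun j => h j i) -
        d (k + 1) (a i) (Fin.snoc (α := fun _ => E) (fun j => h j i) (x i))) := by
  have h1 : ∀ᶠ i in 𝒰, 0 < δ i ∨ δ i < 0 := hδ0.mono fun i hi => (lt_or_gt_of_ne hi).symm
  rcases Ultrafilter.eventually_or.1 h1 with h2 | h2
  · exact H.quotient_pos k a ha hf x h δ hx hh h2 hδ
  · have h3 := H.quotient_pos k a ha hf (fun i => -x i) h (fun i => -δ i)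
      (by simpa using isFin_smul (tendsto_const_nhds (x := (-1 : ℝ))) hx) hh
      (h2.mono fun i hi => by simpa using hi) (by simpa using hδ.neg)
    refine isInfinitesimal_congr (isInfinitesimal_neg h3) (Eventually.of_forall fun i => ?_)
    rw [MultilinearMap.map_snoc_neg, neg_smul_neg, inv_neg, neg_smul]
    abel

/-- The derivatives at infinitesimally close base points are infinitesimally close, since the next
derivative is finite. -/
lemma near_base (hE : HasScale 𝒰 E) {k : ℕ} {a a' : ι → E} (ha : InIntStar 𝒰 O a)
    (hf : IsFin (nsPoint 𝒰 a)) (haa' : IsInfinitesimal (nsPoint 𝒰 fun i => a' i - a i))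
    {h : Fin k → ι → E} (hh : ∀ j, IsFin (nsPoint 𝒰 (h j))) :
    IsInfinitesimal
      (nsPoint 𝒰 fun i => d k (a' i) (fun j => h j i) - d k (a i) fun j => h j i) := by
  obtain ⟨δ, hδ0, hδ, hx⟩ := hE _ haa'
  have h1 := H.quotient_pos k a ha hf _ h δ hx hh hδ0 hδ
  have h2 := H.isFin k a ha hf
    (Fin.snoc (α := fun _ => ι → E) h fun i => (δ i)⁻¹ • (a' i - a i)) (fun j => by
      refine Fin.lastCases ?_ (fun j => ?_) j
      · simpa using hx
      · simpa using hh j)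
  have h3 : ∀ i, (fun j => (Fin.snoc (α := fun _ => ι → E) h
      (fun i => (δ i)⁻¹ • (a' i - a i)) : Fin (k + 1) → ι → E) j i) =
      Fin.snoc (α := fun _ => E) (fun j => h j i) ((δ i)⁻¹ • (a' i - a i)) := by
    intro i
    ext j
    refine Fin.lastCases ?_ (fun j => ?_) j <;> simp
  simp only [h3] at h2
  have h4 := isInfinitesimal_smul hδ (isFin_of_near h2 h1)
  refine isInfinitesimal_congr h4 (hδ0.mono fun i hi => ?_)
  rw [smul_inv_smul₀ hi.ne', smul_inv_smul₀ hi.ne', add_sub_cancel]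

lemma near_vector (hE : HasScale 𝒰 E) {k : ℕ} {a : ι → E} (ha : InIntStar 𝒰 O a)
    (hf : IsFin (nsPoint 𝒰 a)) {h : Fin k → ι → E} (hh : ∀ j, IsFin (nsPoint 𝒰 (h j)))
    {j : Fin k} {y : ι → E} (hy : IsInfinitesimal (nsPoint 𝒰 fun i => y i - h j i)) :
    IsInfinitesimal (nsPoint 𝒰 fun i => d k (a i) (Function.update (fun j => h j i) j (y i)) -
      d k (a i) fun j => h j i) := by
  obtain ⟨δ, hδ0, hδ, hx⟩ := hE _ hy
  obtain _ | k := k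
  · exact j.elim0
  · have h1 := H.isFin k a ha hf (Function.update h j fun i => (δ i)⁻¹ • (y i - h j i)) fun l => by
      by_cases hl : l = j
      · subst hl
        simpa using hx
      · simpa [hl] using hh l
    have h2 : ∀ i, (fun l => Function.update h j (fun i => (δ i)⁻¹ • (y i - h j i)) l i) =
        Function.update (fun j => h j i) j ((δ i)⁻¹ • (y i - h j i)) := by
      intro i
      ext l
      by_cases hl : l = j
      · subst hl
        simp
      · simp [hl]
    simp only [h2] at h1
    refine isInfinitesimal_congr (isInfinitesimal_smul hδ h1) (hδ0.mono fun i hi => ?_)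
    rw [← MultilinearMap.map_update_smul, smul_inv_smul₀ hi.ne', MultilinearMap.map_update_sub]
    congr 2
    exact Function.update_eq_self j fun j => h j i

/-- At finite points, infinitesimally close arguments give infinitesimally close derivatives. -/
theorem near (hE : HasScale 𝒰 E) {k : ℕ} {a a' : ι → E} (ha : InIntStar 𝒰 O a)
    (hf : IsFin (nsPoint 𝒰 a)) (haa' : IsInfinitesimal (nsPoint 𝒰 fun i => a' i - a i))
    {h h' : Fin k → ι → E} (hh : ∀ j, IsFin (nsPoint 𝒰 (h j)))
    (hhh' : ∀ j, IsInfinitesimal (nsPoint 𝒰 fun i => h' j i - h j i)) :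
    IsInfinitesimal (nsPoint 𝒰 fun i =>
      d k (a' i) (fun j => h' j i) - d k (a i) fun j => h j i) := by
  classical
  refine isInfinitesimal_trans ?_ (H.near_base hE ha hf haa' hh)
  have ha' := ha.near haa'
  have hf' := isFin_of_near hf haa'
  have key : ∀ s : Finset (Fin k), IsInfinitesimal (nsPoint 𝒰 fun i =>
      d k (a' i) (fun j => s.piecewise h' h j i) - d k (a' i) fun j => h j i) := by
    intro s
    induction s using Finset.induction_on with
    | empty => simpa using isInfinitesimal_zero
    | insert j s hj ih =>
      refine isInfinitesimal_trans ?_ ih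
      have h1 := H.near_vector hE ha' hf' (h := s.piecewise h' h) (j := j) (y := h' j)
        (fun l => by
          by_cases hl : l ∈ s
          · rw [Finset.piecewise_eq_of_mem _ _ _ hl]
            exact isFin_of_near (hh l) (hhh' l)
          · rw [Finset.piecewise_eq_of_notMem _ _ _ hl]
            exact hh l)
        (by
          rw [Finset.piecewise_eq_of_notMem _ _ _ hj]
          exact hhh' j)
      refine isInfinitesimal_congr h1 (Eventually.of_forall fun i => ?_)
      congr 2
      ext l
      rw [Finset.piecewise_insert]
      by_cases hl : l = j
      · subst hl
        simp
      · simp [hl]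
  simpa using key Finset.univ

end UniformDerivs

end Nonstandard

/-! ### Saturation -/

section Saturation

variable {ι : Type v} {𝒰 : Ultrafilter ι} {E : Type u} [AddCommGroup E] [Module ℝ E]
  [TopologicalSpace E]

lemma exists_contSeminorm_ge (q q' : ContSeminorm E) :
    ∃ r : ContSeminorm E, q.1 ≤ r.1 ∧ q'.1 ≤ r.1 :=
  ⟨⟨q.1 ⊔ q'.1, q.2.sup q'.2⟩, le_sup_left, le_sup_right⟩

lemma exists_contSeminorm_nsmul (q : ContSeminorm E) {C : ℝ} (hC : 0 ≤ C) :
    ∃ r : ContSeminorm E, ∀ x, r.1 x = C * q.1 x :=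
  ⟨⟨C.toNNReal • q.1, q.2.const_smul C.toNNReal⟩, fun x => by
    change (C.toNNReal : ℝ) * q.1 x = _
    rw [Real.coe_toNNReal _ hC]⟩

/-- The form in which saturation is used: decreasing families of nonempty internal sets, indexed by
the continuous seminorms and the natural numbers, have nonempty intersection. -/
theorem IsSaturated.exists_forall_mem
    (hsat : IsSaturated.{u, v} 𝒰 (max Cardinal.aleph0 (Cardinal.mk (ContSeminorm E)))) {X : Type u}
    (A : ContSeminorm E → ℕ → ι → Set X) (hne : ∀ q n, ∀ᶠ i in 𝒰, (A q n i).Nonempty)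
    (hA : ∀ (q q' : ContSeminorm E) (n n' : ℕ), q.1 ≤ q'.1 → n ≤ n' → ∀ i, A q' n' i ⊆ A q n i) :
    ∃ x : ι → X, ∀ q n, ∀ᶠ i in 𝒰, x i ∈ A q n i := by
  have hcard : Cardinal.mk (ContSeminorm E × ULift.{u} ℕ) ≤
      max Cardinal.aleph0 (Cardinal.mk (ContSeminorm E)) := by
    simp only [Cardinal.mk_prod, Cardinal.lift_id, Cardinal.mk_uLift, Cardinal.mk_nat,
      Cardinal.lift_aleph0]
    exact (Cardinal.mul_le_max _ _).trans
      (max_le (max_le (le_max_right _ _) (le_max_left _ _)) (le_max_left _ _))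
  obtain ⟨x, hx⟩ := hsat (ContSeminorm E × ULift.{u} ℕ) X hcard
      (fun j => A j.1 j.2.down) fun s => by
    have hbound : ∃ (Q : ContSeminorm E) (N : ℕ), ∀ j ∈ s, j.1.1 ≤ Q.1 ∧ j.2.down ≤ N := by
      classical
      induction s using Finset.induction_on with
      | empty => exact ⟨⟨0, continuous_zero⟩, 0, by simp⟩
      | insert j s _ ih =>
        obtain ⟨Q, N, h⟩ := ih
        obtain ⟨r, h1, h2⟩ := exists_contSeminorm_ge Q j.1
        refine ⟨r, max N j.2.down, fun l hl => ?_⟩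
        rcases Finset.mem_insert.1 hl with rfl | hl
        · exact ⟨h2, le_max_right _ _⟩
        · exact ⟨(h l hl).1.trans h1, (h l hl).2.trans (le_max_left _ _)⟩
    obtain ⟨Q, N, h⟩ := hbound
    filter_upwards [hne Q N] with i hi
    exact hi.mono fun y hy => mem_iInter₂.2 fun j hj => hA _ _ _ _ (h j hj).1 (h j hj).2 i hy
  exact ⟨x, fun q n => hx (q, ⟨n⟩)⟩

/-- Saturation for internal sets of reals. -/
theorem IsSaturated.exists_real
    (hsat : IsSaturated.{u, v} 𝒰 (max Cardinal.aleph0 (Cardinal.mk (ContSeminorm E))))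
    (A : ContSeminorm E → ℕ → ι → Set ℝ) (hne : ∀ q n, ∀ᶠ i in 𝒰, (A q n i).Nonempty)
    (hA : ∀ (q q' : ContSeminorm E) (n n' : ℕ), q.1 ≤ q'.1 → n ≤ n' → ∀ i, A q' n' i ⊆ A q n i) :
    ∃ x : ι → ℝ, ∀ q n, ∀ᶠ i in 𝒰, x i ∈ A q n i := by
  obtain ⟨x, hx⟩ := hsat.exists_forall_mem (X := ULift.{u} ℝ)
    (fun q n i => ULift.down ⁻¹' A q n i)
    (fun q n => (hne q n).mono fun i ⟨y, hy⟩ => ⟨⟨y⟩, hy⟩)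
    fun q q' n n' hq hn i => preimage_mono (hA q q' n n' hq hn i)
  exact ⟨fun i => (x i).down, hx⟩

lemma tendsto_zero_of_forall_lt {δ : ι → ℝ}
    (h : ∀ n : ℕ, ∀ᶠ i in 𝒰, |δ i| < 1 / ((n : ℝ) + 1)) : Tendsto δ 𝒰 (𝓝 0) := by
  rw [Metric.tendsto_nhds]
  intro ε hε
  obtain ⟨n, hn⟩ := exists_nat_one_div_lt hε
  filter_upwards [h n] with i hi
  rw [Real.dist_0_eq_abs]
  exact hi.trans hn

lemma one_div_succ_le {n n' : ℕ} (h : n ≤ n') : 1 / ((n' : ℝ) + 1) ≤ 1 / ((n : ℝ) + 1) :=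
  Nat.one_div_le_one_div h

/-- Overspill: a property of nonzero infinitesimals holds for all sufficiently small nonzero
standard reals. -/
theorem IsSaturated.overspill
    (hsat : IsSaturated.{u, v} 𝒰 (max Cardinal.aleph0 (Cardinal.mk (ContSeminorm E))))
    {P : ι → ℝ → Prop}
    (hP : ∀ δ : ι → ℝ, (∀ᶠ i in 𝒰, δ i ≠ 0) → Tendsto δ 𝒰 (𝓝 0) → ∀ᶠ i in 𝒰, P i (δ i)) :
    ∀ᶠ t : ℝ in 𝓝[≠] 0, ∀ᶠ i in 𝒰, P i t := by
  by_contra hcon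
  have h1 (n : ℕ) : ∃ t : ℝ, t ≠ 0 ∧ |t| < 1 / ((n : ℝ) + 1) ∧ ∀ᶠ i in 𝒰, ¬P i t := by
    have h2 : ∃ᶠ t : ℝ in 𝓝[≠] 0, ¬∀ᶠ i in 𝒰, P i t := not_eventually.1 hcon
    have h3 : ∀ᶠ t : ℝ in 𝓝[≠] 0, |t| < 1 / ((n : ℝ) + 1) := by
      have h4 : Tendsto (fun t : ℝ => |t|) (𝓝[≠] 0) (𝓝 0) :=
        Tendsto.mono_left (Continuous.tendsto' (by fun_prop) _ _ (by simp)) nhdsWithin_le_nhds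
      exact h4.eventually (gt_mem_nhds (by positivity))
    obtain ⟨t, ht, ht', ht0⟩ := (h2.and_eventually (h3.and self_mem_nhdsWithin)).exists
    exact ⟨t, ht0, ht', Ultrafilter.eventually_not.2 ht⟩
  obtain ⟨δ, hδ⟩ := hsat.exists_real
    (A := fun _ n i => {t | t ≠ 0 ∧ |t| < 1 / ((n : ℝ) + 1) ∧ ¬P i t})
    (fun _ n => by
      obtain ⟨t, h2, h3, h4⟩ := h1 n
      filter_upwards [h4] with i hi using ⟨t, h2, h3, hi⟩)
    fun _ _ n n' _ hn i t ht => ⟨ht.1, ht.2.1.trans_le (one_div_succ_le hn), ht.2.2⟩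
  have hδ' := hδ ⟨0, continuous_zero⟩
  have h5 := hP δ ((hδ' 0).mono fun i hi => hi.1)
    (tendsto_zero_of_forall_lt fun n => (hδ' n).mono fun i hi => hi.2.1)
  obtain ⟨i, hi, hi'⟩ := (h5.and (hδ' 0)).exists
  exact hi'.2.2 hi

/-- By saturation there is a positive infinitesimal which bounds all seminorms of a given
infinitesimal vector. -/
theorem IsSaturated.hasScale_prod
    (hsat : IsSaturated.{u, v} 𝒰 (max Cardinal.aleph0 (Cardinal.mk (ContSeminorm E)))) :
    HasScale 𝒰 (E × E) := by
  intro x hx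
  obtain ⟨δ, hδ⟩ := hsat.exists_real
    (A := fun q n i => {t | 0 < t ∧ |t| < 1 / ((n : ℝ) + 1) ∧ q.1 (x i).1 ≤ t ∧ q.1 (x i).2 ≤ t})
    (fun q n => by
      have hpos : (0 : ℝ) < 1 / ((n : ℝ) + 1) := by positivity
      filter_upwards [isInfinitesimal_iff.1 (isInfinitesimal_fst hx) q.1 q.2 _ (half_pos hpos),
        isInfinitesimal_iff.1 (isInfinitesimal_snd hx) q.1 q.2 _ (half_pos hpos)] with i h1 h2
      exact ⟨_, half_pos hpos, by rw [abs_of_pos (half_pos hpos)]; exact half_lt_self hpos,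
        h1.le, h2.le⟩)
    fun q q' n n' hq hn i t ht => ⟨ht.1, ht.2.1.trans_le (one_div_succ_le hn),
      (hq _).trans ht.2.2.1, (hq _).trans ht.2.2.2⟩
  refine ⟨δ, (hδ ⟨0, continuous_zero⟩ 0).mono fun i hi => hi.1,
    tendsto_zero_of_forall_lt fun n => (hδ ⟨0, continuous_zero⟩ n).mono fun i hi => hi.2.1, ?_⟩
  refine isFin_prod (x := fun i => (δ i)⁻¹ • (x i).1) (y := fun i => (δ i)⁻¹ • (x i).2) ?_ ?_
  · refine isFin_iff.2 fun p hp => ⟨1, ?_⟩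
    filter_upwards [hδ ⟨p, hp⟩ 0] with i hi
    rw [map_smul_eq_mul, norm_inv, Real.norm_of_nonneg hi.1.le, inv_mul_le_one₀ hi.1]
    exact hi.2.2.1
  · refine isFin_iff.2 fun p hp => ⟨1, ?_⟩
    filter_upwards [hδ ⟨p, hp⟩ 0] with i hi
    rw [map_smul_eq_mul, norm_inv, Real.norm_of_nonneg hi.1.le, inv_mul_le_one₀ hi.1]
    exact hi.2.2.2

end Saturation

/-! ### The nonstandard hull -/

section Hull

variable {ι : Type v} {𝒰 : Ultrafilter ι} {𝔤 : Type u} [LieRing 𝔤] [LieAlgebra ℝ 𝔤]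
  [TopologicalSpace 𝔤] [LocallyConvexLieAlgebra 𝔤] {h : ι → LieSubalgebra ℝ 𝔤}

lemma hullMk_eq_iff {x y : finitePart 𝒰 h} :
    hullMk x = hullMk y ↔ IsInfinitesimal ((x : NSExt 𝒰 𝔤) - (y : NSExt 𝒰 𝔤)) :=
  Submodule.Quotient.eq (infinitesimalPart 𝒰 h).toSubmodule

/-- The point `α` of the hull is the class of a family infinitesimally close to `x`. -/
def IsNear (x : ι → 𝔤) (α : Hull 𝒰 h) : Prop :=
  ∃ (b : ι → 𝔤) (hb : nsPoint 𝒰 b ∈ finitePart 𝒰 h), hullMk ⟨nsPoint 𝒰 b, hb⟩ = α ∧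
    IsInfinitesimal (nsPoint 𝒰 fun i => x i - b i)

lemma isNear_hullMk {x : ι → 𝔤} (hx : nsPoint 𝒰 x ∈ finitePart 𝒰 h) :
    IsNear x (hullMk ⟨nsPoint 𝒰 x, hx⟩) :=
  ⟨x, hx, rfl, by simpa using isInfinitesimal_zero⟩

/-- Every point of the hull is represented by a family of elements of the subalgebras. -/
lemma exists_isNear (α : Hull 𝒰 h) : ∃ x : ι → 𝔤, (∀ i, x i ∈ h i) ∧ IsNear x α := by
  classical
  obtain ⟨⟨a, ha⟩, rfl⟩ : ∃ a : finitePart 𝒰 h, hullMk a = α :=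
    Submodule.Quotient.mk_surjective (infinitesimalPart 𝒰 h).toSubmodule α
  induction a using Germ.inductionOn with | _ a
  have ha1 : ∀ᶠ i in 𝒰, a i ∈ h i := ha.1
  refine ⟨fun i => if a i ∈ h i then a i else 0, fun i => ?_, a, ha, rfl, ?_⟩
  · dsimp only
    split_ifs with hi
    · exact hi
    · exact (h i).zero_mem
  · refine isInfinitesimal_congr isInfinitesimal_zero (ha1.mono fun i hi => ?_)
    simp [hi]

namespace IsNear

variable {x y : ι → 𝔤} {α β : Hull 𝒰 h}

lemma isFin (hx : IsNear x α) : IsFin (nsPoint 𝒰 x) := by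
  obtain ⟨b, hb, -, hxb⟩ := hx
  exact isFin_of_near hb.2 hxb

lemma near (hx : IsNear x α) (hxy : IsInfinitesimal (nsPoint 𝒰 fun i => y i - x i)) :
    IsNear y α := by
  obtain ⟨b, hb, rfl, hxb⟩ := hx
  exact ⟨b, hb, rfl, isInfinitesimal_trans hxy hxb⟩

lemma congr (hx : IsNear x α) (hxy : ∀ᶠ i in 𝒰, x i = y i) : IsNear y α :=
  hx.near (isInfinitesimal_congr isInfinitesimal_zero (hxy.mono fun i hi => by rw [hi, sub_self]))

lemma eq_iff (hx : IsNear x α) (hy : IsNear y β) :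
    α = β ↔ IsInfinitesimal (nsPoint 𝒰 fun i => x i - y i) := by
  obtain ⟨a, ha, rfl, hxa⟩ := hx
  obtain ⟨b, hb, rfl, hyb⟩ := hy
  rw [hullMk_eq_iff]
  change IsInfinitesimal (nsPoint 𝒰 fun i => a i - b i) ↔ _
  exact ⟨fun h => isInfinitesimal_trans hxa (isInfinitesimal_trans h (isInfinitesimal_symm hyb)),
    fun h => isInfinitesimal_trans (isInfinitesimal_symm hxa) (isInfinitesimal_trans h hyb)⟩

lemma unique (hx : IsNear x α) (hx' : IsNear x β) : α = β :=
  (hx.eq_iff hx').2 (by simpa using isInfinitesimal_zero)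

lemma isInfinitesimal (hx : IsNear x α) (hy : IsNear y α) :
    IsInfinitesimal (nsPoint 𝒰 fun i => x i - y i) := (hx.eq_iff hy).1 rfl

lemma mem_finitePart (hx : IsNear x α) (hxh : ∀ᶠ i in 𝒰, x i ∈ h i) :
    nsPoint 𝒰 x ∈ finitePart 𝒰 h := ⟨hxh, hx.isFin⟩

lemma add (hx : IsNear x α) (hy : IsNear y β) : IsNear (fun i => x i + y i) (α + β) := by
  obtain ⟨a, ha, rfl, hxa⟩ := hx
  obtain ⟨b, hb, rfl, hyb⟩ := hy
  refine ⟨fun i => a i + b i, (finitePart 𝒰 h).add_mem ha hb, rfl, ?_⟩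
  exact isInfinitesimal_congr (isInfinitesimal_add hxa hyb)
    (Eventually.of_forall fun i => (add_sub_add_comm _ _ _ _).symm)

lemma smul (c : ℝ) (hx : IsNear x α) : IsNear (fun i => c • x i) (c • α) := by
  obtain ⟨a, ha, rfl, hxa⟩ := hx
  refine ⟨fun i => c • a i, (finitePart 𝒰 h).smul_mem c ha, rfl, ?_⟩
  have := hxa.smul c
  change IsInfinitesimal (nsPoint 𝒰 fun i => c • (x i - a i)) at this
  simpa only [smul_sub] using this

lemma neg (hx : IsNear x α) : IsNear (fun i => -x i) (-α) := by
  simpa using hx.smul (-1)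

lemma sub (hx : IsNear x α) (hy : IsNear y β) : IsNear (fun i => x i - y i) (α - β) := by
  simpa only [sub_eq_add_neg] using hx.add hy.neg

lemma zero : IsNear (fun _ => 0) (0 : Hull 𝒰 h) :=
  ⟨fun _ => 0, (finitePart 𝒰 h).zero_mem, rfl, by simpa using isInfinitesimal_zero⟩

lemma lie (hx : IsNear x α) (hy : IsNear y β) : IsNear (fun i => ⁅x i, y i⁆) ⁅α, β⁆ := by
  have hxf := hx.isFin
  obtain ⟨a, ha, rfl, hxa⟩ := hx
  obtain ⟨b, hb, rfl, hyb⟩ := hy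
  refine ⟨fun i => ⁅a i, b i⁆, (finitePart 𝒰 h).lie_mem ha hb, rfl, ?_⟩
  have h1 : IsInfinitesimal (nsPoint 𝒰 fun i => ⁅x i, y i - b i⁆) := IsInfinitesimal.lie hxf hyb
  have h2 : IsInfinitesimal (nsPoint 𝒰 fun i => ⁅b i, x i - a i⁆) := IsInfinitesimal.lie hb.2 hxa
  refine isInfinitesimal_congr (isInfinitesimal_add h1 (isInfinitesimal_neg h2))
    (Eventually.of_forall fun i => ?_)
  rw [lie_skew, lie_sub, sub_lie]
  abel

/-- The seminorms of the hull are limits along the ultrafilter. -/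
lemma tendsto (hx : IsNear x α) (q : ContSeminorm 𝔤) :
    Tendsto (fun i => q.1 (x i)) 𝒰 (𝓝 (hullSeminorm 𝒰 h q α)) := by
  obtain ⟨a, ha, rfl, hxa⟩ := hx
  have h1 := tendsto_seminorm_standardPart ha.2 q.1 q.2
  have h2 : Tendsto (fun i => q.1 (x i) - q.1 (a i)) 𝒰 (𝓝 0) :=
    squeeze_zero_norm (fun i => abs_sub_map_le_sub q.1 _ _)
      (isInfinitesimal_iff_tendsto.1 hxa q.1 q.2)
  have h3 := h2.add h1
  simp only [sub_add_cancel, zero_add] at h3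
  exact h3

lemma eventually_lt (hx : IsNear x α) {q : ContSeminorm 𝔤} {c : ℝ} (hq : hullSeminorm 𝒰 h q α < c) :
    ∀ᶠ i in 𝒰, q.1 (x i) < c := (hx.tendsto q).eventually (gt_mem_nhds hq)

end IsNear

/-- By saturation, a finite vector is infinitesimally close to an element of the internal subalgebra
if it can be approximated by such elements with respect to each continuous seminorm. -/
theorem exists_isNear_of_approx
    (hsat : IsSaturated.{u, v} 𝒰 (max Cardinal.aleph0 (Cardinal.mk (ContSeminorm 𝔤))))
    {x : ι → 𝔤} (hx : IsFin (nsPoint 𝒰 x))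
    (happrox : ∀ q : ContSeminorm 𝔤, ∀ᶠ i in 𝒰, ∃ b ∈ h i, q.1 (x i - b) < 1) :
    ∃ α : Hull 𝒰 h, IsNear x α := by
  obtain ⟨b, hb⟩ := hsat.exists_forall_mem (A := fun q _ i => {b | b ∈ h i ∧ q.1 (x i - b) < 1})
    (fun q _ => happrox q)
    fun q q' _ _ hq _ i b hb => ⟨hb.1, (hq _).trans_lt hb.2⟩
  have h1 : IsInfinitesimal (nsPoint 𝒰 fun i => x i - b i) := by
    refine isInfinitesimal_iff.2 fun p hp ε hε => ?_
    obtain ⟨r, hr⟩ := exists_contSeminorm_nsmul ⟨p, hp⟩ (inv_nonneg.2 hε.le)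
    filter_upwards [hb r 0] with i hi
    have h2 := hi.2
    rwa [hr, inv_mul_lt_iff₀ hε, mul_one] at h2
  have h2 : nsPoint 𝒰 b ∈ finitePart 𝒰 h :=
    ⟨(hb ⟨0, continuous_zero⟩ 0).mono fun i hi => hi.1,
      isFin_of_near hx (isInfinitesimal_symm h1)⟩
  exact ⟨_, b, h2, rfl, h1⟩

open Classical in
/-- The point of the hull which is represented by families close to `x` (`0` by convention if there
is none). -/
def nearPt (𝒰 : Ultrafilter ι) (h : ι → LieSubalgebra ℝ 𝔤) (x : ι → 𝔤) : Hull 𝒰 h :=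
  if hx : ∃ α : Hull 𝒰 h, IsNear x α then hx.choose else 0

lemma IsNear.nearPt_eq {x : ι → 𝔤} {α : Hull 𝒰 h} (hx : IsNear x α) : nearPt 𝒰 h x = α := by
  have hx' : ∃ α : Hull 𝒰 h, IsNear x α := ⟨α, hx⟩
  rw [nearPt, dif_pos hx']
  exact hx'.choose_spec.unique hx

/-- A representative of a point of the hull. -/
def rep (α : Hull 𝒰 h) : ι → 𝔤 := (exists_isNear α).choose

lemma rep_mem (α : Hull 𝒰 h) (i : ι) : rep α i ∈ h i := (exists_isNear α).choose_spec.1 i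

lemma isNear_rep (α : Hull 𝒰 h) : IsNear (rep α) α := (exists_isNear α).choose_spec.2

lemma hull_tendsto_iff {X : Type*} {l : Filter X} {f : X → Hull 𝒰 h} {α : Hull 𝒰 h} :
    Tendsto f l (𝓝 α) ↔ ∀ q : ContSeminorm 𝔤, ∀ ε : ℝ, 0 < ε →
      ∀ᶠ x in l, hullSeminorm 𝒰 h q (f x - α) < ε :=
  hull_withSeminorms.tendsto_nhds f α

instance hullIsTopologicalAddGroup : IsTopologicalAddGroup (Hull 𝒰 h) :=
  hull_withSeminorms.topologicalAddGroup

instance hullContinuousSMul : ContinuousSMul ℝ (Hull 𝒰 h) := hull_withSeminorms.continuousSMul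

instance hullLocallyConvexSpace : LocallyConvexSpace ℝ (Hull 𝒰 h) :=
  hull_withSeminorms.toLocallyConvexSpace

lemma continuous_hullSeminorm (q : ContSeminorm 𝔤) : Continuous (hullSeminorm 𝒰 h q) :=
  hull_withSeminorms.continuous_seminorm q

instance hullT2Space : T2Space (Hull 𝒰 h) := by
  have : T1Space (Hull 𝒰 h) := hull_withSeminorms.T1_of_separating fun α hα => by
    by_contra hcon
    push Not at hcon
    refine hα (((isNear_rep α).eq_iff IsNear.zero).2 ?_)
    rw [isInfinitesimal_iff_tendsto]
    intro p hp
    have h1 := (isNear_rep α).tendsto ⟨p, hp⟩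
    rw [hcon] at h1
    simpa using h1
  infer_instance

lemma hullSeminorm_lie_le {q r : ContSeminorm 𝔤} (hqr : ∀ a b : 𝔤, q.1 ⁅a, b⁆ ≤ r.1 a * r.1 b)
    (α β : Hull 𝒰 h) : hullSeminorm 𝒰 h q ⁅α, β⁆ ≤ hullSeminorm 𝒰 h r α * hullSeminorm 𝒰 h r β :=
  le_of_tendsto_of_tendsto' (((isNear_rep α).lie (isNear_rep β)).tendsto q)
    (((isNear_rep α).tendsto r).mul ((isNear_rep β).tendsto r)) fun _ => hqr _ _

instance hullLocallyConvexLieAlgebra : LocallyConvexLieAlgebra (Hull 𝒰 h) where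
  continuous_lie := by
    rw [continuous_iff_continuousAt]
    rintro ⟨α, β⟩
    refine hull_tendsto_iff.2 fun q ε hε => ?_
    obtain ⟨r, hr, hqr⟩ := exists_seminorm_lie_le q.1 q.2
    have hc := continuous_hullSeminorm (𝒰 := 𝒰) (h := h) ⟨r, hr⟩
    have h1 : Continuous fun z : Hull 𝒰 h × Hull 𝒰 h =>
        hullSeminorm 𝒰 h ⟨r, hr⟩ (z.1 - α) * hullSeminorm 𝒰 h ⟨r, hr⟩ z.2 +
          hullSeminorm 𝒰 h ⟨r, hr⟩ α * hullSeminorm 𝒰 h ⟨r, hr⟩ (z.2 - β) :=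
      ((hc.comp (continuous_fst.sub continuous_const)).mul (hc.comp continuous_snd)).add
        (continuous_const.mul (hc.comp (continuous_snd.sub continuous_const)))
    have h2 := h1.tendsto' (α, β) 0 (by simp)
    filter_upwards [h2.eventually (gt_mem_nhds hε)] with z hz
    have h3 : ⁅z.1, z.2⁆ - ⁅α, β⁆ = ⁅z.1 - α, z.2⁆ + ⁅α, z.2 - β⁆ := by
      rw [sub_lie, lie_sub]
      abel
    rw [h3]
    exact ((map_add_le_add _ _ _).trans (add_le_add
      (hullSeminorm_lie_le (q := q) (r := ⟨r, hr⟩) hqr _ _)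
      (hullSeminorm_lie_le (q := q) (r := ⟨r, hr⟩) hqr _ _))).trans_lt hz

end Hull

/-! ### The product on the nonstandard hull -/

section HullGroup

lemma HasSmoothDerivs.mono {E F : Type*} [AddCommGroup E] [Module ℝ E] [TopologicalSpace E]
    [AddCommGroup F] [Module ℝ F] [TopologicalSpace F] {f : E → F} {U U' : Set E}
    {d : (k : ℕ) → E → (Fin k → E) → F} (h : HasSmoothDerivs f U d) (hU : U' ⊆ U) :
    HasSmoothDerivs f U' d where
  zero a ha := h.zero a (hU ha)
  succ k a ha := h.succ k a (hU ha)
  continuousOn k := (h.continuousOn k).mono (prod_mono hU Subset.rfl)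

lemma snoc_apply_family {ι E : Type*} {k : ℕ} (h : Fin k → ι → E) (x : ι → E) (i : ι) :
    (fun j => (Fin.snoc (α := fun _ => ι → E) h x : Fin (k + 1) → ι → E) j i) =
      Fin.snoc (α := fun _ => E) (fun j => h j i) (x i) := by
  ext j
  refine Fin.lastCases ?_ (fun j => ?_) j <;> simp

variable {ι : Type v} {𝒰 : Ultrafilter ι} {𝔤 : Type u} [LieRing 𝔤] [LieAlgebra ℝ 𝔤]
  [TopologicalSpace 𝔤] [LocallyConvexLieAlgebra 𝔤] {h : ι → LieSubalgebra ℝ 𝔤}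

/-- The family of pairs `a` represents the pair `z` of points of the hull. -/
def IsNearPair (a : ι → 𝔤 × 𝔤) (z : Hull 𝒰 h × Hull 𝒰 h) : Prop :=
  IsNear (fun i => (a i).1) z.1 ∧ IsNear (fun i => (a i).2) z.2

/-- A representative of a pair of points of the hull. -/
def repPair (z : Hull 𝒰 h × Hull 𝒰 h) (i : ι) : 𝔤 × 𝔤 := (rep z.1 i, rep z.2 i)

lemma isNearPair_repPair (z : Hull 𝒰 h × Hull 𝒰 h) : IsNearPair (repPair z) z :=
  ⟨isNear_rep z.1, isNear_rep z.2⟩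

namespace IsNearPair

variable {a b : ι → 𝔤 × 𝔤} {z w : Hull 𝒰 h × Hull 𝒰 h}

lemma isFin (ha : IsNearPair a z) : IsFin (nsPoint 𝒰 a) := isFin_prod ha.1.isFin ha.2.isFin

lemma isInfinitesimal (ha : IsNearPair a z) (hb : IsNearPair b z) :
    IsInfinitesimal (nsPoint 𝒰 fun i => a i - b i) :=
  isInfinitesimal_prod (ha.1.isInfinitesimal hb.1) (ha.2.isInfinitesimal hb.2)

lemma add (ha : IsNearPair a z) (hb : IsNearPair b w) : IsNearPair (fun i => a i + b i) (z + w) :=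
  ⟨ha.1.add hb.1, ha.2.add hb.2⟩

lemma smul (c : ℝ) (ha : IsNearPair a z) : IsNearPair (fun i => c • a i) (c • z) :=
  ⟨ha.1.smul c, ha.2.smul c⟩

lemma snoc {k : ℕ} {v : Fin k → ι → 𝔤 × 𝔤} {η : Fin k → Hull 𝒰 h × Hull 𝒰 h}
    (hv : ∀ j, IsNearPair (v j) (η j)) (ha : IsNearPair a z) (j : Fin (k + 1)) :
    IsNearPair ((Fin.snoc (α := fun _ => ι → 𝔤 × 𝔤) v a : Fin (k + 1) → ι → 𝔤 × 𝔤) j)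
      ((Fin.snoc (α := fun _ => Hull 𝒰 h × Hull 𝒰 h) η z :
        Fin (k + 1) → Hull 𝒰 h × Hull 𝒰 h) j) := by
  refine Fin.lastCases ?_ (fun j => ?_) j
  · simpa using ha
  · simpa using hv j

end IsNearPair

/-- The situation in which the product of `𝔤` induces a product on the hull: `m` is uniformly smooth
at finite points, with derivatives `d`, it maps pairs in the unit ball of `p` in the internal
subalgebra to the internal subalgebra, and it maps finite vectors in the unit ball to finite
vectors. -/
structure IsHullProduct (𝒰 : Ultrafilter ι) (h : ι → LieSubalgebra ℝ 𝔤) (p : ContSeminorm 𝔤)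
    (D : Set (𝔤 × 𝔤)) (m : 𝔤 × 𝔤 → 𝔤)
    (d : (k : ℕ) → 𝔤 × 𝔤 → MultilinearMap ℝ (fun _ : Fin k => 𝔤 × 𝔤) 𝔤) : Prop where
  sat : IsSaturated.{u, v} 𝒰 (max Cardinal.aleph0 (Cardinal.mk (ContSeminorm 𝔤)))
  derivs : UniformDerivs 𝒰 m D d
  mem_domain : ∀ x y : 𝔤, p.1 x < 1 → p.1 y < 1 → (x, y) ∈ D
  mul_mem : ∀ i, ∀ x ∈ h i, ∀ y ∈ h i, p.1 x < 1 → p.1 y < 1 → m (x, y) ∈ h i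
  isFin_mul : ∀ x y : ι → 𝔤, IsFin (nsPoint 𝒰 x) → IsFin (nsPoint 𝒰 y) →
    (∀ᶠ i in 𝒰, p.1 (x i) < 1) → (∀ᶠ i in 𝒰, p.1 (y i) < 1) →
      IsFin (nsPoint 𝒰 fun i => m (x i, y i))

variable (𝒰 h) in
/-- The derivatives of the product on the hull. -/
def hullDeriv (d : (k : ℕ) → 𝔤 × 𝔤 → MultilinearMap ℝ (fun _ : Fin k => 𝔤 × 𝔤) 𝔤) (k : ℕ)
    (z : Hull 𝒰 h × Hull 𝒰 h) (η : Fin k → Hull 𝒰 h × Hull 𝒰 h) : Hull 𝒰 h :=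
  nearPt 𝒰 h fun i => d k (repPair z i) fun j => repPair (η j) i

variable (𝒰 h) in
/-- The product on the hull. -/
def hullMul (m : 𝔤 × 𝔤 → 𝔤) (z : Hull 𝒰 h × Hull 𝒰 h) : Hull 𝒰 h :=
  nearPt 𝒰 h fun i => m (repPair z i)

variable (𝒰 h) in
/-- The product of two copies of the unit ball of `p` in the hull. -/
def ballProd (p : ContSeminorm 𝔤) : Set (Hull 𝒰 h × Hull 𝒰 h) :=
  {z | hullSeminorm 𝒰 h p z.1 < 1 ∧ hullSeminorm 𝒰 h p z.2 < 1}

lemma isOpen_ballProd (p : ContSeminorm 𝔤) : IsOpen (ballProd 𝒰 h p) :=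
  (isOpen_lt ((continuous_hullSeminorm p).comp continuous_fst) continuous_const).inter
    (isOpen_lt ((continuous_hullSeminorm p).comp continuous_snd) continuous_const)

lemma eventually_mem_ballProd {p : ContSeminorm 𝔤} {z : Hull 𝒰 h × Hull 𝒰 h}
    (hz : z ∈ ballProd 𝒰 h p) (ξ : Hull 𝒰 h × Hull 𝒰 h) :
    ∀ᶠ t : ℝ in 𝓝[≠] 0, z + t • ξ ∈ ballProd 𝒰 h p := by
  have h1 : Tendsto (fun t : ℝ => z + t • ξ) (𝓝[≠] 0) (𝓝 z) :=
    Tendsto.mono_left (Continuous.tendsto' (by fun_prop) _ _ (by simp)) nhdsWithin_le_nhds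
  exact h1.eventually ((isOpen_ballProd p).mem_nhds hz)

namespace IsHullProduct

variable {p : ContSeminorm 𝔤} {D : Set (𝔤 × 𝔤)} {m : 𝔤 × 𝔤 → 𝔤}
  {d : (k : ℕ) → 𝔤 × 𝔤 → MultilinearMap ℝ (fun _ : Fin k => 𝔤 × 𝔤) 𝔤}
  (S : IsHullProduct 𝒰 h p D m d)
include S

lemma inIntStar {a : ι → 𝔤 × 𝔤} {z : Hull 𝒰 h × Hull 𝒰 h} (ha : IsNearPair a z)
    (hz : z ∈ ballProd 𝒰 h p) : InIntStar 𝒰 D a := by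
  intro b hb
  have hbz : IsNearPair b z :=
    ⟨ha.1.near (isInfinitesimal_fst hb), ha.2.near (isInfinitesimal_snd hb)⟩
  filter_upwards [hbz.1.eventually_lt hz.1, hbz.2.eventually_lt hz.2] with i h1 h2
  exact S.mem_domain _ _ h1 h2

lemma near {k : ℕ} {a b : ι → 𝔤 × 𝔤} {z : Hull 𝒰 h × Hull 𝒰 h} (ha : IsNearPair a z)
    (hb : IsInfinitesimal (nsPoint 𝒰 fun i => b i - a i)) (hz : z ∈ ballProd 𝒰 h p)
    {v w : Fin k → ι → 𝔤 × 𝔤} {η : Fin k → Hull 𝒰 h × Hull 𝒰 h} (hv : ∀ j, IsNearPair (v j) (η j))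
    (hw : ∀ j, IsInfinitesimal (nsPoint 𝒰 fun i => w j i - v j i)) :
    IsInfinitesimal (nsPoint 𝒰 fun i => d k (b i) (fun j => w j i) - d k (a i) fun j => v j i) :=
  S.derivs.near S.sat.hasScale_prod (S.inIntStar ha hz) ha.isFin hb (fun j => (hv j).isFin) hw

/-- The difference quotients with a standard step size approximate the next derivative, by
overspill. -/
lemma eventually_quotient {k : ℕ} {a x : ι → 𝔤 × 𝔤} {z ξ : Hull 𝒰 h × Hull 𝒰 h}
    (ha : IsNearPair a z) (hz : z ∈ ballProd 𝒰 h p) {v : Fin k → ι → 𝔤 × 𝔤}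
    {η : Fin k → Hull 𝒰 h × Hull 𝒰 h} (hv : ∀ j, IsNearPair (v j) (η j)) (hx : IsNearPair x ξ)
    (q : ContSeminorm 𝔤) {ε : ℝ} (hε : 0 < ε) : ∀ᶠ t : ℝ in 𝓝[≠] 0, ∀ᶠ i in 𝒰,
      q.1 (t⁻¹ • (d k (a i + t • x i) (fun j => v j i) - d k (a i) fun j => v j i) -
        d (k + 1) (a i) (Fin.snoc (α := fun _ => 𝔤 × 𝔤) (fun j => v j i) (x i))) < ε :=
  S.sat.overspill fun _ hδ0 hδ => S.derivs.quotient (S.inIntStar ha hz) ha.isFin hx.isFin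
    (fun j => (hv j).isFin) hδ0 hδ q.1 q.2 ε hε

/-- The derivatives of the product take points of the hull to points of the hull. For the induction
step, the next derivative is approximated by difference quotients with a standard step size. -/
theorem isNear_hullDeriv (k : ℕ) {a : ι → 𝔤 × 𝔤} {z : Hull 𝒰 h × Hull 𝒰 h} (ha : IsNearPair a z)
    (hz : z ∈ ballProd 𝒰 h p) {v : Fin k → ι → 𝔤 × 𝔤} {η : Fin k → Hull 𝒰 h × Hull 𝒰 h}
    (hv : ∀ j, IsNearPair (v j) (η j)) :
    IsNear (fun i => d k (a i) fun j => v j i) (hullDeriv 𝒰 h d k z η) := by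
  suffices hex : ∃ α : Hull 𝒰 h, IsNear (fun i => d k (repPair z i) fun j => repPair (η j) i) α by
    obtain ⟨α, hα⟩ := hex
    rw [hullDeriv, hα.nearPt_eq]
    refine hα.near (S.near (isNearPair_repPair z) (ha.isInfinitesimal (isNearPair_repPair z)) hz
      (fun j => isNearPair_repPair (η j)) fun j => (hv j).isInfinitesimal (isNearPair_repPair _))
  induction k generalizing a z with
  | zero =>
    have h1 := (isNearPair_repPair z).1.eventually_lt hz.1
    have h2 := (isNearPair_repPair z).2.eventually_lt hz.2
    have h3 := S.isFin_mul _ _ (isNear_rep z.1).isFin (isNear_rep z.2).isFin h1 h2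
    have h4 : nsPoint 𝒰 (fun i => m (rep z.1 i, rep z.2 i)) ∈ finitePart 𝒰 h := by
      refine ⟨?_, h3⟩
      change ∀ᶠ i in 𝒰, m (rep z.1 i, rep z.2 i) ∈ h i
      filter_upwards [h1, h2] with i e1 e2
      exact S.mul_mem i _ (rep_mem _ i) _ (rep_mem _ i) e1 e2
    refine ⟨_, (isNear_hullMk h4).congr ?_⟩
    filter_upwards [h1, h2] with i e1 e2
    exact (S.derivs.zero _ (S.mem_domain _ _ e1 e2) _).symm
  | succ k ih =>
    have hr (z : Hull 𝒰 h × Hull 𝒰 h) := isNearPair_repPair z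
    have hfin := S.derivs.isFin k _ (S.inIntStar (hr z) hz) (hr z).isFin (fun j => repPair (η j))
      fun j => (hr (η j)).isFin
    refine exists_isNear_of_approx S.sat hfin fun q => ?_
    have h1 := S.eventually_quotient (hr z) hz (v := fun j => repPair (η j.castSucc))
      (η := fun j => η j.castSucc) (fun j => hr _) (hr (η (Fin.last k))) q one_half_pos
    obtain ⟨t, h2, h3⟩ := (h1.and (eventually_mem_ballProd hz (η (Fin.last k)))).exists
    have key {z : Hull 𝒰 h × Hull 𝒰 h} (hz : z ∈ ballProd 𝒰 h p) {a : ι → 𝔤 × 𝔤}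
        (ha : IsNearPair a z) : ∃ α : Hull 𝒰 h,
        IsNear (fun i => d k (a i) fun j => repPair (η j.castSucc) i) α := by
      obtain ⟨α, hα⟩ := ih (hr z) hz (v := fun j => repPair (η j.castSucc))
        (η := fun j => η j.castSucc) (fun j => hr _)
      exact ⟨α, hα.near (S.near (hr z) (ha.isInfinitesimal (hr z)) hz (fun j => hr _)
        fun j => by simpa using isInfinitesimal_zero)⟩
    obtain ⟨α, hα⟩ := key hz (hr z)
    obtain ⟨β, hβ⟩ := key h3 ((hr z).add ((hr (η (Fin.last k))).smul t))
    have h4 := (hβ.sub hα).smul t⁻¹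
    have h5 := isInfinitesimal_iff.1 (h4.isInfinitesimal (isNear_rep _)) q.1 q.2 _ one_half_pos
    filter_upwards [h2, h5] with i e1 e2
    refine ⟨_, rep_mem (t⁻¹ • (β - α)) i, ?_⟩
    have e3 : (Fin.snoc (α := fun _ => 𝔤 × 𝔤) (fun j => repPair (η j.castSucc) i)
        (repPair (η (Fin.last k)) i) : Fin (k + 1) → 𝔤 × 𝔤) = fun j => repPair (η j) i :=
      Fin.snoc_init_self (α := fun _ => 𝔤 × 𝔤) fun j => repPair (η j) i
    rw [e3, map_sub_rev] at e1
    have e4 := map_add_le_add q.1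
      (d (k + 1) (repPair z i) (fun j => repPair (η j) i) - t⁻¹ •
        (d k (repPair z i + t • repPair (η (Fin.last k)) i) (fun j => repPair (η j.castSucc) i) -
          d k (repPair z i) fun j => repPair (η j.castSucc) i))
      (t⁻¹ •
        (d k (repPair z i + t • repPair (η (Fin.last k)) i) (fun j => repPair (η j.castSucc) i) -
          d k (repPair z i) fun j => repPair (η j.castSucc) i) -
        rep (t⁻¹ • (β - α)) i)
    rw [sub_add_sub_cancel] at e4
    linarith

lemma isNear_hullMul {x y : ι → 𝔤} {α β : Hull 𝒰 h} (hx : IsNear x α) (hy : IsNear y β)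
    (hα : hullSeminorm 𝒰 h p α < 1) (hβ : hullSeminorm 𝒰 h p β < 1) :
    IsNear (fun i => m (x i, y i)) (hullMul 𝒰 h m (α, β)) := by
  have key {a : ι → 𝔤 × 𝔤} (ha : IsNearPair a (α, β)) :
      IsNear (fun i => m (a i)) (hullDeriv 𝒰 h d 0 (α, β) Fin.elim0) := by
    refine (S.isNear_hullDeriv 0 ha ⟨hα, hβ⟩ (v := Fin.elim0) fun j => j.elim0).congr ?_
    filter_upwards [(S.inIntStar ha ⟨hα, hβ⟩).eventually_mem] with i hi
    exact S.derivs.zero _ hi _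
  have h1 : hullMul 𝒰 h m (α, β) = hullDeriv 𝒰 h d 0 (α, β) Fin.elim0 :=
    (key (isNearPair_repPair (α, β))).nearPt_eq
  rw [h1]
  exact key (a := fun i => (x i, y i)) ⟨hx, hy⟩

/-- The product on the hull is smooth. -/
theorem hasSmoothDerivs : HasSmoothDerivs (hullMul 𝒰 h m) (ballProd 𝒰 h p) (hullDeriv 𝒰 h d) where
  zero z hz η := by
    have h1 := S.isNear_hullDeriv 0 (isNearPair_repPair z) hz (v := fun j => repPair (η j))
      (η := η) fun j => j.elim0
    refine h1.unique ((S.isNear_hullMul (isNear_rep z.1) (isNear_rep z.2) hz.1 hz.2).congr ?_)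
    filter_upwards [(S.inIntStar (isNearPair_repPair z) hz).eventually_mem] with i hi
    exact (S.derivs.zero _ hi _).symm
  succ k z hz η ξ := by
    rw [hull_tendsto_iff]
    intro q ε hε
    have hr (z : Hull 𝒰 h × Hull 𝒰 h) := isNearPair_repPair z
    filter_upwards [S.eventually_quotient (hr z) hz (fun j => hr (η j)) (hr ξ) q (half_pos hε),
      eventually_mem_ballProd hz ξ] with t ht htz
    have h1 := ((S.isNear_hullDeriv k ((hr z).add ((hr ξ).smul t)) htz fun j => hr (η j)).sub
      (S.isNear_hullDeriv k (hr z) hz fun j => hr (η j))).smul t⁻¹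
    have h2 := S.isNear_hullDeriv (k + 1) (hr z) hz (IsNearPair.snoc (fun j => hr (η j)) (hr ξ))
    simp only [snoc_apply_family] at h2
    have h3 := le_of_tendsto ((h1.sub h2).tendsto q) (ht.mono fun i hi => hi.le)
    linarith
  continuousOn k := by
    refine continuousOn_of_forall_continuousAt ?_
    rintro ⟨z, η⟩ ⟨hz, -⟩
    refine hull_tendsto_iff.2 fun q ε hε => ?_
    by_contra hcon
    have hr (z : Hull 𝒰 h × Hull 𝒰 h) := isNearPair_repPair z
    -- bad points arbitrarily close to `(z, η)`
    have h1 (r : ContSeminorm 𝔤) : ∃ w : (Hull 𝒰 h × Hull 𝒰 h) × (Fin k → Hull 𝒰 h × Hull 𝒰 h),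
        w.1 ∈ ballProd 𝒰 h p ∧ (hullSeminorm 𝒰 h r (w.1.1 - z.1) < 1 ∧
        hullSeminorm 𝒰 h r (w.1.2 - z.2) < 1) ∧ (∀ j, hullSeminorm 𝒰 h r ((w.2 j).1 - (η j).1) < 1 ∧
        hullSeminorm 𝒰 h r ((w.2 j).2 - (η j).2) < 1) ∧
        ε ≤ hullSeminorm 𝒰 h q (hullDeriv 𝒰 h d k w.1 w.2 - hullDeriv 𝒰 h d k z η) := by
      have hc := continuous_hullSeminorm (𝒰 := 𝒰) (h := h) r
      have e (f : (Hull 𝒰 h × Hull 𝒰 h) × (Fin k → Hull 𝒰 h × Hull 𝒰 h) → Hull 𝒰 h)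
          (hf : Continuous f) : ∀ᶠ w in 𝓝 (z, η), hullSeminorm 𝒰 h r (f w - f (z, η)) < 1 :=
        ((hc.comp (hf.sub continuous_const)).tendsto' (z, η) 0 (by simp)).eventually
          (gt_mem_nhds one_pos)
      have e1 : ∀ᶠ w : (Hull 𝒰 h × Hull 𝒰 h) × (Fin k → Hull 𝒰 h × Hull 𝒰 h) in 𝓝 (z, η),
          w.1 ∈ ballProd 𝒰 h p :=
        continuous_fst.continuousAt.eventually ((isOpen_ballProd p).mem_nhds hz)
      have e2 := (e (fun w => w.1.1) (by fun_prop)).and (e (fun w => w.1.2) (by fun_prop))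
      have e3 := eventually_all.2 fun j => (e (fun w => (w.2 j).1) (by fun_prop)).and
        (e (fun w => (w.2 j).2) (by fun_prop))
      obtain ⟨w, hw, h4, h5, h6⟩ := ((not_eventually.1 hcon).and_eventually
        (e1.and (e2.and e3))).exists
      exact ⟨w, h4, h5, h6, not_lt.1 hw⟩
    obtain ⟨w, hw⟩ := S.sat.exists_forall_mem (X := (𝔤 × 𝔤) × (Fin k → 𝔤 × 𝔤))
      (A := fun r _ i => {w | (r.1 (w.1.1 - (repPair z i).1) < 1 ∧
        r.1 (w.1.2 - (repPair z i).2) < 1) ∧ (∀ j, r.1 ((w.2 j).1 - (repPair (η j) i).1) < 1 ∧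
        r.1 ((w.2 j).2 - (repPair (η j) i).2) < 1) ∧
        ε / 2 < q.1 (d k w.1 w.2 - d k (repPair z i) fun j => repPair (η j) i)})
      (fun r _ => by
        obtain ⟨w, hw, h2, h3, h4⟩ := h1 r
        have n1 := S.isNear_hullDeriv k (hr w.1) hw fun j => hr (w.2 j)
        have n2 := S.isNear_hullDeriv k (hr z) hz fun j => hr (η j)
        have n3 := ((n1.sub n2).tendsto q).eventually (lt_mem_nhds ((half_lt_self hε).trans_le h4))
        have n4 (j : Fin k) := (((hr (w.2 j)).1.sub (hr (η j)).1).eventually_lt (h3 j).1).and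
          (((hr (w.2 j)).2.sub (hr (η j)).2).eventually_lt (h3 j).2)
        filter_upwards [((hr w.1).1.sub (hr z).1).eventually_lt h2.1,
          ((hr w.1).2.sub (hr z).2).eventually_lt h2.2, eventually_all.2 n4, n3] with i e1 e2 e3 e4
        exact ⟨(repPair w.1 i, fun j => repPair (w.2 j) i), ⟨e1, e2⟩, e3, e4⟩)
      fun r r' _ _ hrr' _ i w hw => ⟨⟨(hrr' _).trans_lt hw.1.1, (hrr' _).trans_lt hw.1.2⟩,
        fun j => ⟨(hrr' _).trans_lt (hw.2.1 j).1, (hrr' _).trans_lt (hw.2.1 j).2⟩, hw.2.2⟩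
    have hinf {x : ι → 𝔤} (hx : ∀ r : ContSeminorm 𝔤, ∀ᶠ i in 𝒰, r.1 (x i) < 1) :
        IsInfinitesimal (nsPoint 𝒰 x) := by
      refine isInfinitesimal_iff.2 fun p hp δ hδ => ?_
      obtain ⟨r, hr⟩ := exists_contSeminorm_nsmul ⟨p, hp⟩ (inv_nonneg.2 hδ.le)
      filter_upwards [hx r] with i hi
      rwa [hr, inv_mul_lt_iff₀ hδ, mul_one] at hi
    have n1 := S.near (b := fun i => (w i).1) (w := fun j i => (w i).2 j) (hr z)
      (isInfinitesimal_prod (hinf fun r => (hw r 0).mono fun i hi => hi.1.1)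
        (hinf fun r => (hw r 0).mono fun i hi => hi.1.2)) hz (fun j => hr (η j))
      fun j => isInfinitesimal_prod (hinf fun r => (hw r 0).mono fun i hi => (hi.2.1 j).1)
        (hinf fun r => (hw r 0).mono fun i hi => (hi.2.1 j).2)
    obtain ⟨i, hi, hi'⟩ := ((isInfinitesimal_iff.1 n1 q.1 q.2 _ (half_pos hε)).and (hw q 0)).exists
    exact hi.not_gt hi'.2.2

end IsHullProduct
end HullGroup

/-! ### The local group on the nonstandard hull -/

section Witness

lemma lcSmoothOn_neg {E : Type*} [AddCommGroup E] [Module ℝ E] [TopologicalSpace E]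
    [IsTopologicalAddGroup E] (W : Set E) : LCSmoothOn (fun a : E => -a) W := by
  refine ⟨fun k => match k with
    | 0 => fun a _ => -a
    | 1 => fun _ h => -h 0
    | _ + 2 => fun _ _ => 0, ?_, ?_, ?_⟩
  · intro a _ _
    rfl
  · rintro (_ | _ | k) a _ h x
    · refine tendsto_const_nhds.congr' ?_
      filter_upwards [self_mem_nhdsWithin] with t ht
      have ht' : t ≠ 0 := ht
      rw [neg_sub_neg, sub_add_cancel_left, smul_neg, inv_smul_smul₀ ht']
      rfl
    · simpa using tendsto_const_nhds
    · simpa using tendsto_const_nhds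
  · rintro (_ | _ | k)
    · exact (continuous_fst.neg).continuousOn
    · exact ((continuous_apply 0).comp continuous_snd).neg.continuousOn
    · exact continuousOn_const

lemma exists_contSeminorm_bound {E : Type*} [AddCommGroup E] [Module ℝ E] [TopologicalSpace E]
    (s : Finset (ContSeminorm E)) : ∃ Q : ContSeminorm E, ∀ q ∈ s, q.1 ≤ Q.1 := by
  classical
  induction s using Finset.induction_on with
  | empty => exact ⟨⟨0, continuous_zero⟩, by simp⟩
  | insert j s _ ih =>
    obtain ⟨Q, hQ⟩ := ih
    obtain ⟨r, h1, h2⟩ := exists_contSeminorm_ge Q j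
    refine ⟨r, fun l hl => ?_⟩
    rcases Finset.mem_insert.1 hl with rfl | hl
    · exact h2
    · exact (hQ l hl).trans h1

lemma exists_contSeminorm_ball_subset {E : Type*} [AddCommGroup E] [Module ℝ E]
    [TopologicalSpace E] [IsTopologicalAddGroup E] [ContinuousSMul ℝ E] [LocallyConvexSpace ℝ E]
    {N : Set E} (hN : N ∈ 𝓝 0) : ∃ r : ContSeminorm E, ∀ x, r.1 x < 1 → x ∈ N := by
  obtain ⟨s, ε, hε, hs⟩ := ((PolynormableSpace.withSeminorms ℝ E).mem_nhds_iff 0 N).1 hN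
  obtain ⟨Q, hQ⟩ := exists_contSeminorm_bound s
  obtain ⟨r, hr⟩ := exists_contSeminorm_nsmul Q (inv_nonneg.2 hε.le)
  refine ⟨r, fun x hx => hs ?_⟩
  rw [hr, inv_mul_lt_iff₀ hε, mul_one] at hx
  rw [Seminorm.mem_ball_zero]
  have h1 : s.sup (fun q : ContSeminorm E => q.1) ≤ Q.1 := Finset.sup_le hQ
  exact (h1 x).trans_lt hx

/-- A uniformly continuous product maps finite vectors to finite vectors: a vector of size less
than `n + 1` is reached from zero in `n + 1` steps of size less than one. -/
lemma exists_seminorm_mul_le {𝔤 : Type*} [AddCommGroup 𝔤] [Module ℝ 𝔤] [UniformSpace 𝔤]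
    [IsUniformAddGroup 𝔤] [ContinuousSMul ℝ 𝔤] [LocallyConvexSpace ℝ 𝔤] {m : 𝔤 × 𝔤 → 𝔤}
    {p : ContSeminorm 𝔤} (hm0 : m (0, 0) = 0)
    (hm : UniformContinuousOn m {z | p.1 z.1 < 1 ∧ p.1 z.2 < 1}) (q : ContSeminorm 𝔤) :
    ∃ r : ContSeminorm 𝔤, ∀ (n : ℕ) (x y : 𝔤), p.1 x < 1 → p.1 y < 1 → r.1 x < n + 1 →
      r.1 y < n + 1 → q.1 (m (x, y)) ≤ n + 1 := by
  have h1 : {w : 𝔤 × 𝔤 | q.1 (w.2 - w.1) < 1} ∈ uniformity 𝔤 := by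
    rw [uniformity_eq_comap_nhds_zero 𝔤]
    exact preimage_mem_comap ((isOpen_lt q.2 continuous_const).mem_nhds (by simp))
  have h2 := hm h1
  rw [mem_map, uniformity_eq_comap_nhds_zero (𝔤 × 𝔤), mem_inf_principal, mem_comap] at h2
  obtain ⟨N, hN, hNs⟩ := h2
  rw [Prod.zero_eq_mk, nhds_prod_eq, mem_prod_same_iff] at hN
  obtain ⟨N', hN', hN's⟩ := hN
  obtain ⟨r, hr⟩ := exists_contSeminorm_ball_subset hN'
  refine ⟨r, fun n x y hx hy hrx hry => ?_⟩
  have hn : (0 : ℝ) < n + 1 := by positivity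
  have hp {x : 𝔤} (hx : p.1 x < 1) {k : ℕ} (hk : k ≤ n + 1) :
      p.1 (((k : ℝ) / (n + 1)) • x) < 1 := by
    have hk' : (k : ℝ) ≤ n + 1 := by exact_mod_cast hk
    rw [map_smul_eq_mul, Real.norm_of_nonneg (by positivity)]
    exact (mul_le_of_le_one_left (apply_nonneg p.1 _) ((div_le_one hn).2 hk')).trans_lt hx
  have hstep {x : 𝔤} (hx : r.1 x < n + 1) (k : ℕ) :
      (((k + 1 : ℕ) : ℝ) / (n + 1)) • x - ((k : ℝ) / (n + 1)) • x ∈ N' := by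
    refine hr _ ?_
    have e1 : (((k + 1 : ℕ) : ℝ) / (n + 1)) - ((k : ℝ) / (n + 1)) = ((n : ℝ) + 1)⁻¹ := by
      push_cast
      ring
    rw [← sub_smul, e1, map_smul_eq_mul, norm_inv, Real.norm_of_nonneg hn.le,
      inv_mul_lt_iff₀ hn, mul_one]
    exact hx
  have key : ∀ k : ℕ, k ≤ n + 1 →
      q.1 (m (((k : ℝ) / (n + 1)) • x, ((k : ℝ) / (n + 1)) • y)) ≤ k := by
    intro k
    induction k with
    | zero =>
      intro _
      simp [hm0]
    | succ k ih =>
      intro hk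
      have hk' : k ≤ n + 1 := by omega
      have e1 := hNs (a := ((((k : ℝ) / (n + 1)) • x, ((k : ℝ) / (n + 1)) • y),
        ((((k + 1 : ℕ) : ℝ) / (n + 1)) • x, (((k + 1 : ℕ) : ℝ) / (n + 1)) • y)))
        (hN's ⟨hstep hrx k, hstep hry k⟩) ⟨⟨hp hx hk', hp hy hk'⟩, ⟨hp hx hk, hp hy hk⟩⟩
      have e2 := map_add_le_add q.1
        (m ((((k + 1 : ℕ) : ℝ) / (n + 1)) • x, (((k + 1 : ℕ) : ℝ) / (n + 1)) • y) -
          m (((k : ℝ) / (n + 1)) • x, ((k : ℝ) / (n + 1)) • y))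
        (m (((k : ℝ) / (n + 1)) • x, ((k : ℝ) / (n + 1)) • y))
      rw [sub_add_cancel] at e2
      have e3 : q.1 (m ((((k + 1 : ℕ) : ℝ) / (n + 1)) • x, (((k + 1 : ℕ) : ℝ) / (n + 1)) • y) -
          m (((k : ℝ) / (n + 1)) • x, ((k : ℝ) / (n + 1)) • y)) < 1 := e1
      have e4 := ih hk'
      push_cast at e2 e3 e4 ⊢
      linarith
  have h3 := key (n + 1) le_rfl
  push_cast at h3
  rwa [div_self hn.ne', one_smul, one_smul] at h3

variable {ι : Type v} {𝒰 : Ultrafilter ι} {𝔤 : Type u} [LieRing 𝔤] [LieAlgebra ℝ 𝔤]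

lemma isFin_mul_of_bound {𝔤 : Type*} [AddCommGroup 𝔤] [Module ℝ 𝔤] [TopologicalSpace 𝔤]
    {p : ContSeminorm 𝔤} {m : 𝔤 × 𝔤 → 𝔤}
    (hm : ∀ q : ContSeminorm 𝔤, ∃ r : ContSeminorm 𝔤, ∀ (n : ℕ) (x y : 𝔤), p.1 x < 1 → p.1 y < 1 →
      r.1 x < n + 1 → r.1 y < n + 1 → q.1 (m (x, y)) ≤ n + 1) {x y : ι → 𝔤}
    (hx : IsFin (nsPoint 𝒰 x)) (hy : IsFin (nsPoint 𝒰 y)) (hpx : ∀ᶠ i in 𝒰, p.1 (x i) < 1)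
    (hpy : ∀ᶠ i in 𝒰, p.1 (y i) < 1) : IsFin (nsPoint 𝒰 fun i => m (x i, y i)) := by
  refine isFin_iff.2 fun q hq => ?_
  obtain ⟨r, hr⟩ := hm ⟨q, hq⟩
  obtain ⟨C, hC⟩ := isFin_iff.1 hx r.1 r.2
  obtain ⟨C', hC'⟩ := isFin_iff.1 hy r.1 r.2
  obtain ⟨n, hn⟩ := exists_nat_ge (max C C')
  refine ⟨n + 1, ?_⟩
  filter_upwards [hC, hC', hpx, hpy] with i h1 h2 h3 h4
  refine hr n _ _ h3 h4 ?_ ?_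
  · linarith [le_max_left C C']
  · linarith [le_max_right C C']

variable [TopologicalSpace 𝔤] [LocallyConvexLieAlgebra 𝔤] {h : ι → LieSubalgebra ℝ 𝔤}

/-- At standard points, the derivatives of a map which is uniformly smooth at finite points are its
iterated directional derivatives. -/
theorem UniformDerivs.eq_of_hasSmoothDerivs
    (hsat : IsSaturated.{u, v} 𝒰 (max Cardinal.aleph0 (Cardinal.mk (ContSeminorm 𝔤))))
    {m : 𝔤 × 𝔤 → 𝔤} {D : Set (𝔤 × 𝔤)}
    {d : (k : ℕ) → 𝔤 × 𝔤 → MultilinearMap ℝ (fun _ : Fin k => 𝔤 × 𝔤) 𝔤}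
    {d' : (k : ℕ) → 𝔤 × 𝔤 → (Fin k → 𝔤 × 𝔤) → 𝔤} (H : UniformDerivs 𝒰 m D d)
    (H' : HasSmoothDerivs m D d') (hD : IsOpen D) (k : ℕ) :
    ∀ a ∈ D, ∀ v : Fin k → 𝔤 × 𝔤, d k a v = d' k a v := by
  induction k with
  | zero =>
    intro a ha v
    rw [H.zero a ha, H'.zero a ha]
  | succ k ih =>
    intro a ha v
    have h1 := H'.succ k a ha (Fin.init (α := fun _ => 𝔤 × 𝔤) v) (v (Fin.last k))
    rw [Fin.snoc_init_self] at h1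
    refine tendsto_nhds_unique ?_ h1
    rw [tendsto_iff_contSeminorm]
    intro q ε hε
    have h2 : Tendsto (fun t : ℝ => a + t • v (Fin.last k)) (𝓝[≠] 0) (𝓝 a) :=
      Tendsto.mono_left (Continuous.tendsto' (by fun_prop) _ _ (by simp)) nhdsWithin_le_nhds
    have h3 := hsat.overspill (P := fun _ t => q.1 (t⁻¹ • (d k (a + t • v (Fin.last k))
      (Fin.init (α := fun _ => 𝔤 × 𝔤) v) - d k a (Fin.init (α := fun _ => 𝔤 × 𝔤) v)) -
        d (k + 1) a v) < ε) fun δ hδ0 hδ => by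
      have h4 := H.quotient (inIntStar_const hD ha) (isFin_const a)
        (h := fun j _ => Fin.init (α := fun _ => 𝔤 × 𝔤) v j)
        (isFin_const (v (Fin.last k))) (fun j => isFin_const _) hδ0 hδ q.1 q.2 ε hε
      have e1 : (Fin.snoc (α := fun _ => 𝔤 × 𝔤) (fun j => Fin.init (α := fun _ => 𝔤 × 𝔤) v j)
        (v (Fin.last k)) : Fin (k + 1) → 𝔤 × 𝔤) = v := Fin.snoc_init_self v
      simp only [e1] at h4
      exact h4
    filter_upwards [h3, h2.eventually (hD.mem_nhds ha)] with t ht hat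
    rw [← ih _ hat, ← ih _ ha]
    exact ht.exists.choose_spec

namespace IsHullProduct

variable {p : ContSeminorm 𝔤} {D : Set (𝔤 × 𝔤)} {m : 𝔤 × 𝔤 → 𝔤}
  {d : (k : ℕ) → 𝔤 × 𝔤 → MultilinearMap ℝ (fun _ : Fin k => 𝔤 × 𝔤) 𝔤}
  (S : IsHullProduct 𝒰 h p D m d)
include S

lemma hullMul_eq {x y w : ι → 𝔤} {α β γ : Hull 𝒰 h} (hx : IsNear x α) (hy : IsNear y β)
    (hw : IsNear w γ) (hα : hullSeminorm 𝒰 h p α < 1) (hβ : hullSeminorm 𝒰 h p β < 1)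
    (heq : ∀ᶠ i in 𝒰, m (x i, y i) = w i) : hullMul 𝒰 h m (α, β) = γ :=
  ((S.isNear_hullMul hx hy hα hβ).congr heq).unique hw

/-- Associativity transfers from the internal subalgebra to its hull. -/
lemma hullMul_assoc (hassoc : ∀ i, ∀ x ∈ h i, ∀ y ∈ h i, ∀ z ∈ h i, p.1 x < 1 → p.1 y < 1 →
      p.1 z < 1 → p.1 (m (x, y)) < 1 → p.1 (m (y, z)) < 1 →
      m (m (x, y), z) = m (x, m (y, z))) {α β γ : Hull 𝒰 h} (hα : hullSeminorm 𝒰 h p α < 1)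
    (hβ : hullSeminorm 𝒰 h p β < 1) (hγ : hullSeminorm 𝒰 h p γ < 1)
    (hαβ : hullSeminorm 𝒰 h p (hullMul 𝒰 h m (α, β)) < 1)
    (hβγ : hullSeminorm 𝒰 h p (hullMul 𝒰 h m (β, γ)) < 1) :
    hullMul 𝒰 h m (hullMul 𝒰 h m (α, β), γ) = hullMul 𝒰 h m (α, hullMul 𝒰 h m (β, γ)) := by
  have n1 := S.isNear_hullMul (isNear_rep α) (isNear_rep β) hα hβ
  have n2 := S.isNear_hullMul (isNear_rep β) (isNear_rep γ) hβ hγ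
  refine S.hullMul_eq n1 (isNear_rep γ) (S.isNear_hullMul (isNear_rep α) n2 hα hβγ) hαβ hγ ?_
  filter_upwards [(isNear_rep α).eventually_lt hα, (isNear_rep β).eventually_lt hβ,
    (isNear_rep γ).eventually_lt hγ, n1.eventually_lt hαβ, n2.eventually_lt hβγ]
    with i h1 h2 h3 h4 h5
  exact hassoc i _ (rep_mem α i) _ (rep_mem β i) _ (rep_mem γ i) h1 h2 h3 h4 h5

/-- The unit ball of the hull is a local group in exponential coordinates. -/
theorem isLocExpWitness {U : Set 𝔤} {d' : (k : ℕ) → 𝔤 × 𝔤 → (Fin k → 𝔤 × 𝔤) → 𝔤}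
    (T : IsLocExpGroup U D m d')
    (hassoc : ∀ i, ∀ x ∈ h i, ∀ y ∈ h i, ∀ z ∈ h i, p.1 x < 1 → p.1 y < 1 →
      p.1 z < 1 → p.1 (m (x, y)) < 1 → p.1 (m (y, z)) < 1 → m (m (x, y), z) = m (x, m (y, z))) :
    IsLocExpWitness {α : Hull 𝒰 h | hullSeminorm 𝒰 h p α < 1}
      {z | hullSeminorm 𝒰 h p z.1 < 1 ∧ hullSeminorm 𝒰 h p z.2 < 1 ∧
        hullSeminorm 𝒰 h p (hullMul 𝒰 h m z) < 1} (hullMul 𝒰 h m) := by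
  have hsub : {z | hullSeminorm 𝒰 h p z.1 < 1 ∧ hullSeminorm 𝒰 h p z.2 < 1 ∧
      hullSeminorm 𝒰 h p (hullMul 𝒰 h m z) < 1} ⊆ ballProd 𝒰 h p := fun z hz => ⟨hz.1, hz.2.1⟩
  have hsmooth := S.hasSmoothDerivs.mono hsub
  have hU {x : 𝔤} (hx : p.1 x < 1) : x ∈ U := T.snd_mem (S.mem_domain x x hx hx)
  have hr (α : Hull 𝒰 h) := isNear_rep α
  have hp0 : hullSeminorm 𝒰 h p 0 < 1 := by simp
  have hmz {α : Hull 𝒰 h} (hα : hullSeminorm 𝒰 h p α < 1) : hullMul 𝒰 h m (α, 0) = α := by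
    refine S.hullMul_eq (hr α) IsNear.zero (hr α) hα hp0 ?_
    filter_upwards [(hr α).eventually_lt hα] with i hi using T.mul_zero (hU hi)
  have hzm {α : Hull 𝒰 h} (hα : hullSeminorm 𝒰 h p α < 1) : hullMul 𝒰 h m (0, α) = α := by
    refine S.hullMul_eq IsNear.zero (hr α) (hr α) hp0 hα ?_
    filter_upwards [(hr α).eventually_lt hα] with i hi using T.zero_mul (hU hi)
  have hpn {α : Hull 𝒰 h} (hα : hullSeminorm 𝒰 h p α < 1) : hullSeminorm 𝒰 h p (-α) < 1 := by
    rwa [map_neg_eq_map]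
  have hmn {α : Hull 𝒰 h} (hα : hullSeminorm 𝒰 h p α < 1) : hullMul 𝒰 h m (α, -α) = 0 := by
    refine S.hullMul_eq (hr α) (hr α).neg IsNear.zero hα (hpn hα) ?_
    filter_upwards [(hr α).eventually_lt hα] with i hi using (T.mul_neg (hU hi)).2
  have hnm {α : Hull 𝒰 h} (hα : hullSeminorm 𝒰 h p α < 1) : hullMul 𝒰 h m (-α, α) = 0 := by
    simpa using hmn (hpn hα)
  have hball : {α : Hull 𝒰 h | hullSeminorm 𝒰 h p α < 1} = (hullSeminorm 𝒰 h p).ball 0 1 :=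
    (Seminorm.ball_zero_eq _).symm
  refine ⟨?_, ?_, ⟨?_, ?_, ?_, fun z hz => hz.2.2, ⟨_, hsmooth⟩, ?_, hp0, ?_, ?_, ?_⟩, ?_,
    ⟨_, hsmooth, ?_⟩⟩
  · rw [hball]
    exact Seminorm.balanced_ball_zero _ _
  · rw [hball]
    exact Seminorm.convex_ball _ _ _
  · exact isOpen_lt (continuous_hullSeminorm p) continuous_const
  · have hc : ContinuousOn (fun z => hullSeminorm 𝒰 h p (hullMul 𝒰 h m z)) (ballProd 𝒰 h p) :=
      (continuous_hullSeminorm p).comp_continuousOn fun z hz =>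
        (S.hasSmoothDerivs.continuousAt (isOpen_ballProd p) hz).continuousWithinAt
    convert hc.isOpen_inter_preimage (isOpen_ballProd p) isOpen_Iio (t := Iio 1) using 1
    ext z
    simp [ballProd, and_assoc]
  · exact fun z hz => ⟨hz.1, hz.2.1⟩
  · rintro x y z ⟨hx, hy, hxy⟩ ⟨-, hz, hyz⟩
    have h1 := S.hullMul_assoc hassoc hx hy hz hxy hyz
    refine ⟨⟨fun h2 => ⟨hx, hyz, h1 ▸ h2.2.2⟩, fun h2 => ⟨hxy, hz, ?_⟩⟩, fun _ => h1⟩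
    rw [h1]
    exact h2.2.2
  · intro x hx
    refine ⟨⟨hx, hp0, ?_⟩, hmz hx⟩
    rw [hmz hx]
    exact hx
  · intro x hx
    refine ⟨⟨hp0, hx, ?_⟩, hzm hx⟩
    rw [hzm hx]
    exact hx
  · refine ⟨fun x => -x, lcSmoothOn_neg _, fun x hx => ⟨hpn hx, ⟨⟨hx, hpn hx, ?_⟩, hmn hx⟩,
      ⟨⟨hpn hx, hx, ?_⟩, hnm hx⟩, ?_⟩, ?_⟩
    · rw [hmn hx]
      exact hp0
    · rw [hnm hx]
      exact hp0
    · rintro y hy ⟨-, hxy⟩ -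
      have h1 := S.hullMul_assoc hassoc (hpn hx) hx hy (by rw [hnm hx]; exact hp0)
        (by rw [hxy]; exact hp0)
      rw [hnm hx, hxy, hzm hy, hmz (hpn hx)] at h1
      exact h1
    · rintro x y ⟨hx, hy, hxy⟩
      have h1 : hullMul 𝒰 h m (-y, -x) = -hullMul 𝒰 h m (x, y) := by
        refine S.hullMul_eq (hr y).neg (hr x).neg (S.isNear_hullMul (hr x) (hr y) hx hy).neg
          (hpn hy) (hpn hx) ?_
        filter_upwards [(hr x).eventually_lt hx, (hr y).eventually_lt hy] with i h1 h2
        exact (T.neg_mul_rev (S.mem_domain _ _ h1 h2)).2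
      refine ⟨hpn hy, hpn hx, ?_⟩
      change hullSeminorm 𝒰 h p (hullMul 𝒰 h m (-y, -x)) < 1
      rw [h1]
      exact hpn hxy
  · intro x hx t s ht hs hts
    have hpt {t : ℝ} (ht : |t| ≤ 1) : hullSeminorm 𝒰 h p (t • x) < 1 := by
      rw [map_smul_eq_mul, Real.norm_eq_abs]
      exact (mul_le_of_le_one_left (apply_nonneg _ _) ht).trans_lt hx
    have h1 : hullMul 𝒰 h m (t • x, s • x) = (t + s) • x := by
      refine S.hullMul_eq ((hr x).smul t) ((hr x).smul s) ((hr x).smul (t + s)) (hpt ht) (hpt hs) ?_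
      filter_upwards [(hr x).eventually_lt hx] with i hi
      exact (T.E1 _ (hU hi) t s ht hs hts).2
    refine ⟨⟨hpt ht, hpt hs, ?_⟩, h1⟩
    rw [h1]
    exact hpt hts
  -- The second derivative at the standard point `(0, 0)` is that of `m`, so it is the bracket.
  · intro x y
    have hxy : IsNearPair (fun i => (rep x i, rep y i)) ((x, y) : Hull 𝒰 h × Hull 𝒰 h) :=
      ⟨hr x, hr y⟩
    have h1 := S.isNear_hullDeriv 2 (a := fun _ => (0, 0)) (z := (0, 0))
      ⟨IsNear.zero, IsNear.zero⟩ ⟨hp0, hp0⟩ (v := fun _ i => (rep x i, rep y i))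
      (η := ![(x, y), (x, y)]) (fun j => by fin_cases j <;> exact hxy)
    refine h1.unique (((hr x).lie (hr y)).congr (Eventually.of_forall fun i => ?_))
    rw [S.derivs.eq_of_hasSmoothDerivs S.sat T.smooth T.isOpen_D 2 _ (T.mem_zero T.zero_mem),
      ← T.bracket]
    congr 1
    funext j
    fin_cases j <;> rfl

end IsHullProduct

end Witness

end

theorem mainTheorem5
    {𝔤 : Type u} [LieRing 𝔤] [LieAlgebra ℝ 𝔤] [UniformSpace 𝔤] [IsUniformAddGroup 𝔤]
    [LocallyConvexLieAlgebra 𝔤]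
    -- a sufficiently saturated nonstandard extension
    {ι : Type v} (𝒰 : Ultrafilter ι)
    (hsat : IsSaturated.{u, v} 𝒰 (max Cardinal.aleph0 (Cardinal.mk (ContSeminorm 𝔤))))
    -- `𝔤` is locally exponential, witnessed by `(U, D, m, 0)`
    (U : Set 𝔤) (D : Set (𝔤 × 𝔤)) (m : 𝔤 × 𝔤 → 𝔤) (hU : IsLocExpWitness U D m)
    -- the directed family of closed subalgebras and the neighborhood `V`
    (ℋ : Set (LieSubalgebra ℝ 𝔤)) (hclosed : ∀ 𝔥 ∈ ℋ, IsClosed (𝔥 : Set 𝔤))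
    (hdirected : DirectedOn (· ≤ ·) ℋ)
    (V : Set 𝔤) (hVopen : IsOpen V) (hV0 : 0 ∈ V) (hVsymm : ∀ x ∈ V, -x ∈ V) (hVU : V ⊆ U)
    (hVD : V ×ˢ V ⊆ D)
    -- (1)
    (h1 : Dense (⋃ 𝔥 ∈ ℋ, (𝔥 : Set 𝔤)))
    -- (2) and the choice of connected groups
    (G : ∀ 𝔥 : ℋ, LocExpLieGroup 𝔥.1) (hconn : ∀ 𝔥 : ℋ, ConnectedSpace (G 𝔥).H)
    -- (3)
    (h3 : ∀ 𝔥 : ℋ, InjOn (G 𝔥).exp {x | (x : 𝔤) ∈ V})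
    -- the neighborhoods `W_𝔥` and the seminorm `p`
    (W : ∀ 𝔥 : ℋ, Set (G 𝔥).H) (hWopen : ∀ 𝔥, IsOpen (W 𝔥)) (hW1 : ∀ 𝔥, 1 ∈ W 𝔥)
    (hWsymm : ∀ 𝔥, ∀ g ∈ W 𝔥, g⁻¹ ∈ W 𝔥)
    (hWV : ∀ 𝔥, W 𝔥 ⊆ (G 𝔥).exp '' {x | (x : 𝔤) ∈ V})
    (p : ContSeminorm 𝔤)
    -- (4)
    (h4 : ∀ (𝔥 : ℋ) (x y : 𝔥.1), p.1 x < 1 → p.1 y < 1 → (G 𝔥).exp x * (G 𝔥).exp y ∈ W 𝔥)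
    -- (5)
    (h5 : ∀ x y : 𝔤, p.1 x < 1 → p.1 y < 1 → (x, y) ∈ D)
    (h5' : UniformContinuousOn m {z | p.1 z.1 < 1 ∧ p.1 z.2 < 1})
    -- (6)
    (h6 : UniformlySmoothAtFinitePoints 𝒰 m D)
    -- an internal element of `ℋ*`
    (h : ι → ℋ) :
    IsLocallyExponentialLieAlgebra (Hull 𝒰 fun i => (h i).1) ∧
    ∃ mhat : Hull 𝒰 (fun i => (h i).1) × Hull 𝒰 (fun i => (h i).1) → Hull 𝒰 fun i => (h i).1,
      -- `⟦x⟧ * ⟦y⟧ = ⟦x * y⟧` on `Ŵ × Ŵ`, where `x * y = m (x, y)`, which is also the element of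
      -- `V ∩ 𝔥` with `exp (x * y) = exp x · exp y`
      (∀ (x y : ι → 𝔤) (hx : nsPoint 𝒰 x ∈ finitePart 𝒰 fun i => (h i).1)
        (hy : nsPoint 𝒰 y ∈ finitePart 𝒰 fun i => (h i).1),
        hullSeminorm 𝒰 _ p (hullMk ⟨nsPoint 𝒰 x, hx⟩) < 1 →
        hullSeminorm 𝒰 _ p (hullMk ⟨nsPoint 𝒰 y, hy⟩) < 1 →
        (∀ᶠ i in 𝒰, ∃ x' y' z' : (h i).1, (x' : 𝔤) = x i ∧ (y' : 𝔤) = y i ∧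
          (z' : 𝔤) = m (x i, y i) ∧ (z' : 𝔤) ∈ V ∧
          (G (h i)).exp z' = (G (h i)).exp x' * (G (h i)).exp y') ∧
        ∃ hz : nsPoint 𝒰 (fun i => m (x i, y i)) ∈ finitePart 𝒰 fun i => (h i).1,
          mhat (hullMk ⟨nsPoint 𝒰 x, hx⟩, hullMk ⟨nsPoint 𝒰 y, hy⟩) =
            hullMk ⟨nsPoint 𝒰 (fun i => m (x i, y i)), hz⟩) ∧
      -- the local group on `Ŵ` witnesses that the hull is locally exponential
      IsLocExpWitness {a | hullSeminorm 𝒰 _ p a < 1}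
        {z | hullSeminorm 𝒰 _ p z.1 < 1 ∧ hullSeminorm 𝒰 _ p z.2 < 1 ∧
          hullSeminorm 𝒰 _ p (mhat z) < 1} mhat := by
  obtain ⟨d', T⟩ := hU.exists_isLocExpGroup
  obtain ⟨d, Hd⟩ := h6.exists_uniformDerivs
  have hV : IsSymmNhd U D V := ⟨hVopen, hVsymm, hVU, hVD⟩
  have hmul (𝔥 : ℋ) (x y : 𝔥.1) (hx : p.1 x < 1) (hy : p.1 y < 1) :
      ∃ z : 𝔥.1, (z : 𝔤) = m (x, y) ∧ (z : 𝔤) ∈ V ∧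
        (G 𝔥).exp z = (G 𝔥).exp x * (G 𝔥).exp y :=
    T.exists_coe_eq_mul (G := G 𝔥) hV hV0 (hclosed 𝔥.1 𝔥.2) (h3 𝔥) p.1 h5
      (fun x y hx hy => by
        obtain ⟨z, hzV, hz⟩ := hWV 𝔥 (h4 𝔥 x y hx hy)
        exact ⟨z, hzV, hz⟩) hx hy
  have S : IsHullProduct 𝒰 (fun i => (h i).1) p D m d :=
    { sat := hsat
      derivs := Hd
      mem_domain := h5
      mul_mem := fun i x hx y hy hpx hpy => by
        obtain ⟨z, hz, -, -⟩ := hmul (h i) ⟨x, hx⟩ ⟨y, hy⟩ hpx hpy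
        exact hz ▸ z.2
      isFin_mul := fun x y hx hy hpx hpy => isFin_mul_of_bound
        (fun q => exists_seminorm_mul_le (T.mul_zero T.zero_mem) h5' q) hx hy hpx hpy }
  -- Both bracketings are products in `V ∩ 𝔥` with the same image under the exponential map.
  have hassoc : ∀ i, ∀ x ∈ (h i).1, ∀ y ∈ (h i).1, ∀ z ∈ (h i).1, p.1 x < 1 → p.1 y < 1 →
      p.1 z < 1 → p.1 (m (x, y)) < 1 → p.1 (m (y, z)) < 1 →
      m (m (x, y), z) = m (x, m (y, z)) := by
    intro i x hx y hy z hz hpx hpy hpz hpxy hpyz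
    obtain ⟨a, ha, -, hea⟩ := hmul (h i) ⟨x, hx⟩ ⟨y, hy⟩ hpx hpy
    obtain ⟨b, hb, -, heb⟩ := hmul (h i) ⟨y, hy⟩ ⟨z, hz⟩ hpy hpz
    simp only at ha hb
    obtain ⟨c, hc, hcV, hec⟩ := hmul (h i) a ⟨z, hz⟩ (ha ▸ hpxy) hpz
    obtain ⟨e, he, heV, hee⟩ := hmul (h i) ⟨x, hx⟩ b hpx (hb ▸ hpyz)
    have hce : c = e := h3 (h i) hcV heV (by rw [hec, hee, hea, heb, mul_assoc])
    rw [← ha, ← hb, ← hc, ← he, hce]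
  have hwit := S.isLocExpWitness T hassoc
  refine ⟨⟨inferInstance, _, _, _, hwit⟩, hullMul 𝒰 _ m, ?_, hwit⟩
  intro x y hx hy hpx hpy
  have hnx := isNear_hullMk hx
  have hny := isNear_hullMk hy
  have hxm : ∀ᶠ i in 𝒰, x i ∈ (h i).1 := hx.1
  have hym : ∀ᶠ i in 𝒰, y i ∈ (h i).1 := hy.1
  have hprod : ∀ᶠ i in 𝒰, ∃ x' y' z' : (h i).1, (x' : 𝔤) = x i ∧ (y' : 𝔤) = y i ∧
      (z' : 𝔤) = m (x i, y i) ∧ (z' : 𝔤) ∈ V ∧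
      (G (h i)).exp z' = (G (h i)).exp x' * (G (h i)).exp y' := by
    filter_upwards [hxm, hym, hnx.eventually_lt hpx, hny.eventually_lt hpy] with i h1 h2 h3 h4
    obtain ⟨z, hz, hzV, hez⟩ := hmul (h i) ⟨x i, h1⟩ ⟨y i, h2⟩ h3 h4
    exact ⟨⟨x i, h1⟩, ⟨y i, h2⟩, z, rfl, rfl, hz, hzV, hez⟩
  have hnz := S.isNear_hullMul hnx hny hpx hpy
  have hz := hnz.mem_finitePart (hprod.mono fun i => by
    rintro ⟨-, -, z, -, -, hz, -, -⟩
    exact hz ▸ z.2)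
  exact ⟨hprod, hz, hnz.unique (isNear_hullMk hz)⟩
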